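/- **Setting.** Let $S\subset\mathbb R^2$ be a bounded open set, $L>0$ and $\Omega=S\times(-L,L)$; $\partial\Omega$ is assumed to have finite area and an outer unit normal $\nu$ for which the divergence theorem holds (for instance, $S$ Lipschitz). Let $Y=[0,1]^3$, $\Sigma_0=[0,1]^2\times\{0\}\subset Y$, and for $d>0$ let $\Gamma^d=\{k\in\mathbb Z:\ kd\in(-L,L-d)\}$ and $\Sigma^d=\bigcup_{k\in\Gamma^d}S\times\{kd\}$. A subscript $T$ denotes the tangential component $\vec u_T=(\nu\times\vec u)\times\nu$ (the tangential trace, defined through Green's formula for the curl), and $\vec u\cdot\vec v=\sum_i u_iv_i$. Let $X^d$ be the space of $\vec u\in L^2(\Omega;\mathbb C^3)$ with $\nabla\times\vec u\in L^2(\Omega;\mathbb C^3)$, $\vec u_T\in L^2(\partial\Omega;\mathbb C^3)$ and $\vec u_T\in L^2(\Sigma^d;\mathbb C^3)$. Let $\omega,\mu,\lambda>0$ be constants, $\vec J_a\in L^2(\Omega;\mathbb C^3)$, and let $\varepsilon(x,y)$, $\sigma(x,y)$ be complex-valued, $Y$-periodic in $y$, such that for some constants $0<c\le C$ one has $c\le\operatorname{Im}\varepsilon\le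 C$, $c\le\operatorname{Re}\sigma\le C$, $|\varepsilon|,|\sigma|\le C$ on $\Omega\times Y$, $x\mapsto\varepsilon(x,x/d)$ is measurable for all $d>0$, and $\sigma$ is continuous with bounded gradients $\nabla_x\sigma,\nabla_y\sigma$. Let $d_l>0$, $d_l\to0$, and let $\vec E^l\in X^{d_l}$ satisfy, with $d=d_l$ and for all $\vec\Psi\in X^{d}$, $$\int_\Omega\frac1\mu(\nabla\times\vec E^l)\cdot(\nabla\times\overline{\vec\Psi})\,dx-\int_\Omega\omega^2\varepsilon(x,x/d)\,\vec E^l\cdot\overline{\vec\Psi}\,dx-\int_{\Sigma^d}i\omega\, d\,\sigma(x,x/d)\,\vec E^l_T\cdot\overline{\vec\Psi}_T\,do_x-\int_{\partial\Omega}i\omega\lambda\,\vec E^l_T\cdot\overline{\vec\Psi}_T\,do_x=i\omega\int_\Omega\vec J_a\cdot\overline{\vec\Psi}\,dx .$$ Suppose that $\vec E^l$ two-scale converges to $\vec{\mathcal E}(x)+\nabla_y\varphi(x,y)$ with $\vec{\mathcal E}\in L^2(\Omega;\mathbb C^3)$ and $\varphi\in L^2(\Omega;H^1_\#(Y;\mathbb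 C))$, that is, $$\int_\Omega\vec E^l(x)\cdot\vec\Psi(x,x/d_l)\,dx\to\int_\Omega\int_Y(\vec{\mathcal E}(x)+\nabla_y\varphi(x,y))\cdot\vec\Psi(x,y)\,dy\,dx$$ for all continuous $\vec\Psi:\Omega\times\mathbb R^3\to\mathbb C^3$, $Y$-periodic in $y$ and compactly supported in $x\in\Omega$. **Proposition.** The tangential trace $(\nabla_y\varphi)_T$ on $\Omega\times\Sigma_0$ exists in $L^2(\Omega\times\Sigma_0)$, and for all $\vec F:\Omega\times\mathbb R^3\to\mathbb C^3$ that are $Y$-periodic in $y$ with $\vec F,\nabla_x\vec F,\nabla_y\vec F\in L^\infty$ (derivatives in the sense of distributions, $\vec F$ being the continuous representative), $$\lim_{l\to\infty}d_l\int_{\Sigma^{d_l}}\vec E^l_T(x)\cdot\vec F_T(x,x/d_l)\,do_x=\int_\Omega\int_{\Sigma_0}(\vec{\mathcal E}(x)+\nabla_y\varphi(x,y))_T\cdot\vec F_T(x,y)\,do_y\,dx .$$ -/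

import Mathlib

open MeasureTheory Filter Topology Set
open scoped Matrix ENNReal

noncomputable section

namespace LayeredMaxwell

/-- Points of physical space. -/
abbrev E3 := EuclideanSpace ℝ (Fin 3)

/-- Points of the horizontal plane. -/
abbrev E2 := EuclideanSpace ℝ (Fin 2)

/-- Complex vectors. `u ⬝ᵥ v` is the bilinear product `u · v` (no conjugation), `star v` is the
componentwise complex conjugate, `⨯₃` the cross product. -/
abbrev C3 := Fin 3 → ℂ

/-! ### Geometry -/

/-- The point `(x', s)` of space. -/
def lift (x' : E2) (s : ℝ) : E3 := !₂[x' 0, x' 1, s]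

/-- The horizontal part `x'` of `x = (x', x₃)`. -/
def proj (x : E3) : E2 := !₂[x 0, x 1]

/-- The cylinder `Ω = S × (-L, L)`. -/
def cyl (S : Set E2) (L : ℝ) : Set E3 := {x | proj x ∈ S ∧ x 2 ∈ Ioo (-L) L}

/-- `Γ^d = {k ∈ ℤ : k d ∈ (-L, L - d)}`, the indices of the sheets, for `d > 0`. -/
def layers (L d : ℝ) : Finset ℤ :=
  (Finset.Icc ⌊-L / d⌋ ⌈L / d⌉).filter fun k => (k : ℝ) * d ∈ Ioo (-L) (L - d)

theorem mem_layers {L d : ℝ} (hd : 0 < d) (k : ℤ) :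
    k ∈ layers L d ↔ (k : ℝ) * d ∈ Ioo (-L) (L - d) := by
  simp only [layers, Finset.mem_filter, Finset.mem_Icc, and_iff_right_iff_imp]
  rintro ⟨h1, h2⟩
  constructor
  · have h : -L / d < (k : ℝ) := by rwa [div_lt_iff₀ hd]
    exact_mod_cast (Int.floor_le _).trans h.le
  · have h : (k : ℝ) < L / d := by rw [lt_div_iff₀ hd]; linarith
    exact_mod_cast h.le.trans (Int.le_ceil _)

/-- The surface integral of `f` over `Σ^d = ⋃_{k ∈ Γ^d} S × {k d}`. -/
def sheetIntegral (S : Set E2) (L d : ℝ) (f : E3 → ℂ) : ℂ :=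
  ∑ k ∈ layers L d, ∫ x' in S, f (lift x' (k * d))

/-- The unit cell `Y = [0,1]³`. -/
def cellY : Set E3 := {y | ∀ i, y i ∈ Icc (0 : ℝ) 1}

/-- The square `[0,1]²`; the surface `Σ₀` of the unit cell is `[0,1]² × {0}`. -/
def cellY2 : Set E2 := {y | ∀ i, y i ∈ Icc (0 : ℝ) 1}

/-- The surface measure of the boundary of `Ω`. -/
def bdryMeasure (Ω : Set E3) : Measure E3 := (μHE[2] : Measure E3).restrict (frontier Ω)

/-! ### Vector calculus -/

/-- `∂_j f`. -/
def pderiv {W : Type*} [NormedAddCommGroup W] [NormedSpace ℝ W] (j : Fin 3) (f : E3 → W)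
    (x : E3) : W := fderiv ℝ f x (EuclideanSpace.single j 1)

/-- `∇ × Φ`. -/
def curl (Φ : E3 → C3) (x : E3) : C3 :=
  ![pderiv 1 Φ x 2 - pderiv 2 Φ x 1, pderiv 2 Φ x 0 - pderiv 0 Φ x 2,
    pderiv 0 Φ x 1 - pderiv 1 Φ x 0]

/-- A real vector as a complex one. -/
def toC (v : E3) : C3 := fun i => (v i : ℂ)

/-- The constant vector `e₃`. -/
def e3 : C3 := ![0, 0, 1]

/-- The component tangential to horizontal planes, `(e₃ × v) × e₃`. -/
def tang (v : C3) : C3 := ![v 0, v 1, 0]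

/-- `f ∈ C_c^∞(U; W)`. -/
def IsTest {V W : Type*} [NormedAddCommGroup V] [NormedSpace ℝ V] [NormedAddCommGroup W]
    [NormedSpace ℝ W] (U : Set V) (f : V → W) : Prop :=
  ContDiff ℝ (⊤ : ℕ∞) f ∧ HasCompactSupport f ∧ tsupport f ⊆ U

/-- `ν` is the outer unit normal of `Ω`: the boundary has finite area, and `ν` is a unit field on
it for which the divergence theorem holds. On a bounded Lipschitz domain this is the usual outer
unit normal, and in general it determines `ν` almost everywhere on the boundary. -/
structure IsOuterUnitNormal (Ω : Set E3) (ν : E3 → E3) : Prop where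
  finite_area : bdryMeasure Ω univ < ∞
  aesm : AEStronglyMeasurable ν (bdryMeasure Ω)
  unit : ∀ᵐ x ∂(bdryMeasure Ω), ‖ν x‖ = 1
  divergence : ∀ V : E3 → E3, IsTest univ V →
    ∫ x in Ω, ∑ i, pderiv i V x i = ∫ x, inner ℝ (V x) (ν x) ∂(bdryMeasure Ω)

/-! ### `H(curl; Ω)` and tangential traces -/

/-- `w = ∇ × u` in `Ω` in the sense of distributions. -/
def IsWeakCurl (Ω : Set E3) (u w : E3 → C3) : Prop :=
  ∀ Φ : E3 → C3, IsTest Ω Φ → ∫ x in Ω, w x ⬝ᵥ Φ x = ∫ x in Ω, u x ⬝ᵥ curl Φ x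

/-- `g ∈ L²(∂Ω; ℂ³)` is the tangential trace `u_T` on `∂Ω` of the field `u` with curl `w`:
`∫_Ω ((∇ × u) · Φ - u · (∇ × Φ)) = ∫_{∂Ω} (ν × u_T) · Φ` for all `Φ` smooth up to the boundary. -/
structure IsBdryTrace (Ω : Set E3) (ν : E3 → E3) (u w g : E3 → C3) : Prop where
  memLp : MemLp g 2 (bdryMeasure Ω)
  tangential : ∀ᵐ x ∂(bdryMeasure Ω), toC (ν x) ⬝ᵥ g x = 0
  green : ∀ Φ : E3 → C3, IsTest univ Φ →
    ∫ x in Ω, (w x ⬝ᵥ Φ x - u x ⬝ᵥ curl Φ x) =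
      ∫ x, (toC (ν x) ⨯₃ g x) ⬝ᵥ Φ x ∂(bdryMeasure Ω)

/-- `g ∈ L²(S; ℂ³)` is the tangential trace `u_T(·, s)` on the interior sheet `S × {s}` of the
field `u` with curl `w`: Green's formula in the part of `Ω` above the sheet, whose outer normal
on the sheet is `-e₃`, with test fields that vanish near `∂Ω`. (By `IsWeakCurl` the part below
gives the same trace.) -/
structure IsSheetTrace (S : Set E2) (L s : ℝ) (u w : E3 → C3) (g : E2 → C3) : Prop where
  memLp : MemLp g 2 (volume.restrict S)
  tangential : ∀ᵐ x' ∂(volume.restrict S), g x' 2 = 0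
  green : ∀ Φ : E3 → C3, IsTest (cyl S L) Φ →
    ∫ x in cyl S L ∩ {x | s < x 2}, (w x ⬝ᵥ Φ x - u x ⬝ᵥ curl Φ x) =
      ∫ x' in S, ((-e3) ⨯₃ g x') ⬝ᵥ Φ (lift x' s)

/-- A field together with its curl and its tangential traces on `∂Ω` and on the sheets. The last
three are determined by the field, through `MemX`. -/
structure FieldData where
  fld : E3 → C3
  rot : E3 → C3
  bdry : E3 → C3
  sheet : E3 → C3

/-- `u ∈ X^d`: `u ∈ H(curl; Ω)` with `u_T ∈ L²(∂Ω)` and `u_T ∈ L²(Σ^d)`. -/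
structure MemX (S : Set E2) (L : ℝ) (ν : E3 → E3) (d : ℝ) (u : FieldData) : Prop where
  memLp_fld : MemLp u.fld 2 (volume.restrict (cyl S L))
  memLp_rot : MemLp u.rot 2 (volume.restrict (cyl S L))
  weakCurl : IsWeakCurl (cyl S L) u.fld u.rot
  bdryTrace : IsBdryTrace (cyl S L) ν u.fld u.rot u.bdry
  sheetTrace : ∀ k ∈ layers L d,
    IsSheetTrace S L (k * d) u.fld u.rot fun x' => u.sheet (lift x' (k * d))

/-- The sesquilinear form `a^d` with permittivity `εd` and surface conductivity `σd`. -/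
def aForm (S : Set E2) (L d ω μ lam : ℝ) (εd σd : E3 → ℂ) (u v : FieldData) : ℂ :=
  (∫ x in cyl S L, (1 / μ : ℂ) * (u.rot x ⬝ᵥ star (v.rot x)))
    - (∫ x in cyl S L, (ω : ℂ) ^ 2 * εd x * (u.fld x ⬝ᵥ star (v.fld x)))
    - sheetIntegral S L d
        (fun x => Complex.I * ω * σd x * (u.sheet x ⬝ᵥ star (v.sheet x)))
    - ∫ x, Complex.I * ω * lam * (u.bdry x ⬝ᵥ star (v.bdry x)) ∂(bdryMeasure (cyl S L))

/-- `E` is a solution of Maxwell's system in weak form with scaling parameter `d`,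
`ε^d(x) = ε(x, x/d)`, `σ^d(x) = d σ(x, x/d)` and source `J`. -/
def IsSolution (S : Set E2) (L : ℝ) (ν : E3 → E3) (ω μ lam : ℝ) (ε σ : E3 → E3 → ℂ)
    (J : E3 → C3) (d : ℝ) (E : FieldData) : Prop :=
  MemX S L ν d E ∧ ∀ Ψ : FieldData, MemX S L ν d Ψ →
    aForm S L d ω μ lam (fun x => ε x (d⁻¹ • x)) (fun x => d * σ x (d⁻¹ • x)) E Ψ =
      Complex.I * ω * ∫ x in cyl S L, J x ⬝ᵥ star (Ψ.fld x)

/-! ### Functions of the slow variable `x ∈ Ω` and the periodic fast variable `y` -/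

/-- `f(x, y)`, `x ∈ Ω`, is `Y`-periodic in `y`. -/
def PeriodicY {W : Type*} (Ω : Set E3) (f : E3 → E3 → W) : Prop :=
  ∀ x ∈ Ω, ∀ y, ∀ i : Fin 3, f x (y + EuclideanSpace.single i 1) = f x y

/-- `g = ∇_x f` in `Ω × ℝ³` in the sense of distributions. -/
def IsWeakGradX (Ω : Set E3) (f : E3 → E3 → ℂ) (g : E3 → E3 → C3) : Prop :=
  ∀ ψ : E3 × E3 → ℂ, IsTest (Ω ×ˢ univ) ψ → ∀ j : Fin 3,
    ∫ z, f z.1 z.2 * pderiv j (fun x => ψ (x, z.2)) z.1 ∂((volume.restrict Ω).prod volume) =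
      - ∫ z, g z.1 z.2 j * ψ z ∂((volume.restrict Ω).prod volume)

/-- `g = ∇_y f` in `Ω × ℝ³` in the sense of distributions. -/
def IsWeakGradY (Ω : Set E3) (f : E3 → E3 → ℂ) (g : E3 → E3 → C3) : Prop :=
  ∀ ψ : E3 × E3 → ℂ, IsTest (Ω ×ˢ univ) ψ → ∀ j : Fin 3,
    ∫ z, f z.1 z.2 * pderiv j (fun y => ψ (z.1, y)) z.2 ∂((volume.restrict Ω).prod volume) =
      - ∫ z, g z.1 z.2 j * ψ z ∂((volume.restrict Ω).prod volume)

/-- `f(x, y)` is periodic in `y` and `f, ∇_x f, ∇_y f ∈ L^∞`; `f` is the continuous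
representative, so that its values on surfaces are meaningful. -/
structure IsW1Inf (Ω : Set E3) (f : E3 → E3 → ℂ) : Prop where
  periodic : PeriodicY Ω f
  cont : ContinuousOn (Function.uncurry f) (Ω ×ˢ univ)
  bdd : MemLp (Function.uncurry f) ∞ ((volume.restrict Ω).prod volume)
  gradX : ∃ g : E3 → E3 → C3, IsWeakGradX Ω f g ∧
    MemLp (Function.uncurry g) ∞ ((volume.restrict Ω).prod volume)
  gradY : ∃ g : E3 → E3 → C3, IsWeakGradY Ω f g ∧
    MemLp (Function.uncurry g) ∞ ((volume.restrict Ω).prod volume)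

/-- `φ ∈ L²(Ω; H¹_#(Y; ℂ))` with `∇_y φ = p`. -/
structure IsCorrector (Ω : Set E3) (φ : E3 → E3 → ℂ) (p : E3 → E3 → C3) : Prop where
  periodic : PeriodicY Ω φ
  periodic_grad : PeriodicY Ω p
  memLp : MemLp (Function.uncurry φ) 2 ((volume.restrict Ω).prod (volume.restrict cellY))
  memLp_grad : MemLp (Function.uncurry p) 2 ((volume.restrict Ω).prod (volume.restrict cellY))
  grad : IsWeakGradY Ω φ p

/-- Two-scale convergence of `u_l ∈ L²(Ω; ℂ³)` to `u₀ ∈ L²(Ω × Y; ℂ³)` along `d_l`, with test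
fields in `C_c(Ω; C_#(Y; ℂ³))`. -/
def TwoScale (Ω : Set E3) (d : ℕ → ℝ) (u : ℕ → E3 → C3) (u₀ : E3 → E3 → C3) : Prop :=
  (∀ l, MemLp (u l) 2 (volume.restrict Ω)) ∧
  MemLp (Function.uncurry u₀) 2 ((volume.restrict Ω).prod (volume.restrict cellY)) ∧
  ∀ Ψ : E3 → E3 → C3, Continuous (Function.uncurry Ψ) → PeriodicY univ Ψ →
    (∃ K ⊆ Ω, IsCompact K ∧ ∀ x ∉ K, ∀ y, Ψ x y = 0) →
    Tendsto (fun l => ∫ x in Ω, u l x ⬝ᵥ Ψ x ((d l)⁻¹ • x)) atTop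
      (𝓝 (∫ x in Ω, ∫ y in cellY, u₀ x y ⬝ᵥ Ψ x y))

/-- `G ∈ L²(Ω × Σ₀; ℂ³)`, periodic in `y'`, is the tangential trace `p_T` on `{y₃ = 0}` of
`p = ∇_y φ`, a curl-free field in `y`: Green's formula
`∫_{y₃>0} ((∇_y × p) · Φ - p · (∇_y × Φ)) = ∫_{y₃=0} (-e₃ × p_T) · Φ` with `∇_y × p = 0`. -/
structure IsCellTrace (Ω : Set E3) (p : E3 → E3 → C3) (G : E3 → E2 → C3) : Prop where
  periodic : ∀ x ∈ Ω, ∀ y', ∀ i : Fin 2, G x (y' + EuclideanSpace.single i 1) = G x y'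
  memLp : MemLp (Function.uncurry G) 2 ((volume.restrict Ω).prod (volume.restrict cellY2))
  tangential : ∀ x ∈ Ω, ∀ y', G x y' 2 = 0
  green : ∀ Φ : E3 × E3 → C3, IsTest (Ω ×ˢ univ) Φ →
    - ∫ z, p z.1 z.2 ⬝ᵥ curl (fun y => Φ (z.1, y)) z.2
        ∂((volume.restrict Ω).prod (volume.restrict {y : E3 | 0 < y 2})) =
      ∫ z : E3 × E2, ((-e3) ⨯₃ G z.1 z.2) ⬝ᵥ Φ (z.1, lift z.2 0)
        ∂((volume.restrict Ω).prod volume)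

/-- The assumptions on the material: `ε`, `σ` are periodic in `y`, bounded, with imaginary
respectively real part bounded below by `c > 0`; `ε^d` is measurable; `σ` has bounded
gradients. -/
structure IsMaterial (Ω : Set E3) (ε σ : E3 → E3 → ℂ) (c C : ℝ) : Prop where
  c_pos : 0 < c
  periodic_ε : PeriodicY Ω ε
  measurable_ε : ∀ d : ℝ, 0 < d →
    AEMeasurable (fun x => ε x (d⁻¹ • x)) (volume.restrict Ω)
  im_ε : ∀ x ∈ Ω, ∀ y, (ε x y).im ∈ Icc c C
  re_σ : ∀ x ∈ Ω, ∀ y, (σ x y).re ∈ Icc c C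
  norm_ε : ∀ x ∈ Ω, ∀ y, ‖ε x y‖ ≤ C
  norm_σ : ∀ x ∈ Ω, ∀ y, ‖σ x y‖ ≤ C
  lip_σ : IsW1Inf Ω σ

end LayeredMaxwell

end

noncomputable section

namespace LayeredMaxwell

/-! ### The splitting `ℝ³ = ℝ² × ℝ` -/

/-! Testing the equation with the solution itself bounds the fields, the curls and, with weight d,
the traces on the sheets in L², uniformly along the sequence (`energy_estimate`). This last bound is
why the limiting trace lies in L² at all; a general curl-free field has only a weaker tangential
trace.

For a tangential component u_j, Green's formula above the k-th sheet is tested with f(x, x/d - k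
e₃), where f(x, y) is smooth, periodic in the horizontal part of y, compactly supported in x, and
zero for y₃ > 1/2. Such a test field sees only the half period above its own sheet, so the sum over
k is a single integral over Ω with f evaluated at x/d, its height reduced modulo one. Multiplied by
d, the terms with the curl and with slow derivatives of f vanish in the limit, while the fast
derivatives, which carry 1/d, survive. These integrands jump across the sheets, but the jumps can be
smoothed at small L² cost, so that two-scale convergence still applies
(`ScalarTwoScale.tendsto_layer`). With u⁰ the two-scale limit and g the trace of u_j, this gives d
∑_k ∫ g f → ∫_Ω ∫_Y (-u⁰_j ∂_{y₃} f + u⁰_3 ∂_{y_j} f) (`tendsto_sheets_layer`).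

The energy bound and the averaging of |f|² over the sheets (`IsOsc.tendsto_sheets`) bound this limit
by √M times the L² norm of f on Ω × Σ₀. By Riesz it is the pairing of f with some G_j ∈ L²(Ω × Σ₀)
(`SheetSequence.exists_limit`). Cutting off near ∂Ω and mollifying extends the convergence to the
fields F of the statement (`SheetSequence.tendsto_pairing`).

It remains to identify G. Equating the two expressions of the limit gives Green's formula in the
cell for u⁰ = 𝓔 + ∇_yφ, for test functions concentrated near Σ₀; compactly supported ones are
reduced to layer fields by horizontal periodization (`SheetSequence.green_of_top`). Away from Σ₀ the
field ∇_yφ is curl-free and contributes nothing, and 𝓔, constant in y, contributes exactly its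
boundary value. Hence G_j - 𝓔_j is the j-th component of the trace of ∇_yφ
(`SheetSequence.cell_green`). The vertical part of Green's formula has no boundary term and follows
from the curl-free relation between the two horizontal components
(`IsCorrector.curl_free_horizontal`). -/

@[simp] theorem lift_zero (x' : E2) (s : ℝ) : lift x' s 0 = x' 0 := rfl
@[simp] theorem lift_one (x' : E2) (s : ℝ) : lift x' s 1 = x' 1 := rfl
@[simp] theorem lift_two (x' : E2) (s : ℝ) : lift x' s 2 = s := rfl
@[simp] theorem proj_zero (x : E3) : proj x 0 = x 0 := rfl
@[simp] theorem proj_one (x : E3) : proj x 1 = x 1 := rfl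

theorem E3_ext {x y : E3} (h0 : x 0 = y 0) (h1 : x 1 = y 1) (h2 : x 2 = y 2) : x = y := by
  ext i; fin_cases i <;> assumption

theorem E2_ext {x y : E2} (h0 : x 0 = y 0) (h1 : x 1 = y 1) : x = y := by
  ext i; fin_cases i <;> assumption

@[simp] theorem proj_lift (x' : E2) (s : ℝ) : proj (lift x' s) = x' := E2_ext rfl rfl

@[simp] theorem lift_proj (x : E3) : lift (proj x) (x 2) = x := E3_ext rfl rfl rfl

theorem lift_add (a b : E2) (s t : ℝ) : lift (a + b) (s + t) = lift a s + lift b t :=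
  E3_ext (by simp) (by simp) (by simp)

theorem smul_lift (r : ℝ) (a : E2) (s : ℝ) : r • lift a s = lift (r • a) (r * s) :=
  E3_ext (by simp) (by simp) (by simp)

/-- `lift` as a continuous linear map. -/
def liftL : E2 × ℝ →L[ℝ] E3 :=
  LinearMap.toContinuousLinearMap
    { toFun := fun z => lift z.1 z.2
      map_add' := fun a b => lift_add a.1 b.1 a.2 b.2
      map_smul' := fun r a => (smul_lift r a.1 a.2).symm }

/-- `proj` as a continuous linear map. -/
def projL : E3 →L[ℝ] E2 :=
  LinearMap.toContinuousLinearMap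
    { toFun := proj
      map_add' := fun a b => E2_ext (by simp) (by simp)
      map_smul' := fun r a => E2_ext (by simp) (by simp) }

/-- The vertical coordinate as a continuous linear map. -/
def vertL : E3 →L[ℝ] ℝ := EuclideanSpace.proj 2

@[fun_prop] theorem continuous_lift : Continuous fun z : E2 × ℝ => lift z.1 z.2 := liftL.continuous

@[fun_prop] theorem continuous_lift_comp {X : Type*} [TopologicalSpace X] {a : X → E2} {b : X → ℝ}
    (ha : Continuous a) (hb : Continuous b) : Continuous fun x => lift (a x) (b x) :=
  continuous_lift.comp (ha.prodMk hb)

@[fun_prop] theorem continuous_proj : Continuous proj := projL.continuous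

/-- `lift` as a measurable equivalence. -/
def liftEquiv : E2 × ℝ ≃ᵐ E3 where
  toFun z := lift z.1 z.2
  invFun x := (proj x, x 2)
  left_inv z := by simp
  right_inv x := by simp
  measurable_toFun := continuous_lift.measurable
  measurable_invFun := (continuous_proj.prodMk vertL.continuous).measurable

/-- A chain of measure-preserving maps: forget the Euclidean structure, swap the factors, insert the
height as coordinate 2, and restore the Euclidean structure. -/
theorem measurePreserving_lift :
    MeasurePreserving (fun z : E2 × ℝ => lift z.1 z.2) (volume.prod volume) volume := by
  have h1 : MeasurePreserving (fun z : (Fin 2 → ℝ) × ℝ => (z.2, z.1))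
      (volume.prod volume) (volume.prod volume) := Measure.measurePreserving_swap
  have h0 : MeasurePreserving (fun z : E2 × ℝ => ((WithLp.ofLp z.1 : Fin 2 → ℝ), z.2))
      (volume.prod volume) (volume.prod volume) :=
    (PiLp.volume_preserving_ofLp (Fin 2)).prod (MeasurePreserving.id volume)
  have h2 := (volume_preserving_piFinSuccAbove (fun _ : Fin 3 => ℝ) 2).symm
  have h3 := PiLp.volume_preserving_toLp (Fin 3)
  have h := h3.comp (h2.comp (h1.comp h0))
  have he : (fun z : E2 × ℝ => lift z.1 z.2) = (WithLp.toLp 2 : (Fin 3 → ℝ) → E3) ∘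
      (MeasurableEquiv.piFinSuccAbove (fun _ : Fin 3 => ℝ) 2).symm ∘ (fun z => (z.2, z.1)) ∘
      fun z : E2 × ℝ => ((WithLp.ofLp z.1 : Fin 2 → ℝ), z.2) := by
    funext z
    refine E3_ext ?_ ?_ ?_ <;> rfl
  rw [he]
  exact h

theorem measurableEmbedding_lift : MeasurableEmbedding fun z : E2 × ℝ => lift z.1 z.2 :=
  liftEquiv.measurableEmbedding

theorem preimage_lift (A : Set E2) (B : Set ℝ) :
    (fun z : E2 × ℝ => lift z.1 z.2) ⁻¹' {x : E3 | proj x ∈ A ∧ x 2 ∈ B} = A ×ˢ B := by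
  ext z; simp

theorem setIntegral_lift {W : Type*} [NormedAddCommGroup W] [NormedSpace ℝ W] (A : Set E2)
    (B : Set ℝ) (f : E3 → W) :
    ∫ x in {x : E3 | proj x ∈ A ∧ x 2 ∈ B}, f x =
      ∫ z, f (lift z.1 z.2) ∂((volume.restrict A).prod (volume.restrict B)) := by
  rw [Measure.prod_restrict, ← measurePreserving_lift.setIntegral_preimage_emb
    measurableEmbedding_lift, preimage_lift]

theorem integrable_lift_iff {W : Type*} [NormedAddCommGroup W] {A : Set E2}
    {B : Set ℝ} {f : E3 → W} : Integrable (fun z : E2 × ℝ => f (lift z.1 z.2))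
      ((volume.restrict A).prod (volume.restrict B)) ↔
      IntegrableOn f {x : E3 | proj x ∈ A ∧ x 2 ∈ B} := by
  rw [Measure.prod_restrict,
    ← measurePreserving_lift.integrableOn_comp_preimage measurableEmbedding_lift, preimage_lift]
  rfl

theorem volume_lift (A : Set E2) (B : Set ℝ) :
    volume {x : E3 | proj x ∈ A ∧ x 2 ∈ B} = volume A * volume B := by
  rw [← Measure.prod_prod, ← measurePreserving_lift.measure_preimage_emb measurableEmbedding_lift,
    preimage_lift]

theorem cellY_eq : cellY = {x : E3 | proj x ∈ cellY2 ∧ x 2 ∈ Icc (0 : ℝ) 1} := by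
  ext x
  simp only [cellY, cellY2, mem_ofPred_eq, Fin.forall_fin_succ]
  simp [and_assoc]

theorem isCompact_cube (n : ℕ) (a b : ℝ) :
    IsCompact {y : EuclideanSpace ℝ (Fin n) | ∀ i, y i ∈ Icc a b} := by
  have h : IsCompact (Set.pi univ fun _ : Fin n => Icc a b) := isCompact_univ_pi fun _ => isCompact_Icc
  have := h.image (PiLp.continuous_toLp 2 fun _ : Fin n => ℝ)
  convert this using 1
  ext y
  simp only [mem_ofPred_eq, mem_image, Set.mem_pi, mem_univ, true_imp_iff]
  exact ⟨fun hy => ⟨WithLp.ofLp y, hy, rfl⟩, by rintro ⟨z, hz, rfl⟩; exact hz⟩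

theorem volume_cube (n : ℕ) (a b : ℝ) :
    volume {y : EuclideanSpace ℝ (Fin n) | ∀ i, y i ∈ Icc a b} = ENNReal.ofReal (b - a) ^ n := by
  have h := (PiLp.volume_preserving_ofLp (Fin n)).measure_preimage
    (s := Set.pi univ fun _ : Fin n => Icc a b)
    (MeasurableSet.univ_pi fun _ => measurableSet_Icc).nullMeasurableSet
  rw [pi_univ_Icc, Real.volume_Icc_pi] at h
  simp only [Finset.prod_const, Finset.card_univ, Fintype.card_fin] at h
  rw [← h, ← pi_univ_Icc]
  congr 1
  ext y; simp [Pi.le_def, forall_and]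

theorem isCompact_cellY : IsCompact cellY := isCompact_cube 3 0 1
theorem isCompact_cellY2 : IsCompact cellY2 := isCompact_cube 2 0 1
theorem measurableSet_cellY : MeasurableSet cellY := isCompact_cellY.measurableSet
theorem measurableSet_cellY2 : MeasurableSet cellY2 := isCompact_cellY2.measurableSet
theorem volume_cellY : volume cellY = 1 := (volume_cube 3 0 1).trans (by simp)
theorem volume_cellY2 : volume cellY2 = 1 := (volume_cube 2 0 1).trans (by simp)

instance : IsProbabilityMeasure (volume.restrict cellY) := ⟨by simp [volume_cellY]⟩
instance : IsProbabilityMeasure (volume.restrict cellY2) := ⟨by simp [volume_cellY2]⟩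

theorem cyl_eq (S : Set E2) (L : ℝ) : cyl S L = {x : E3 | proj x ∈ S ∧ x 2 ∈ Ioo (-L) L} := rfl

theorem isOpen_cyl {S : Set E2} (hS : IsOpen S) (L : ℝ) : IsOpen (cyl S L) :=
  (hS.preimage continuous_proj).inter (isOpen_Ioo.preimage vertL.continuous)

theorem volume_cyl_lt_top {S : Set E2} (hS : Bornology.IsBounded S) (L : ℝ) :
    volume (cyl S L) < ∞ := by
  rw [cyl_eq, volume_lift]
  exact ENNReal.mul_lt_top hS.measure_lt_top (by simp)

/-! ### Periodic functions -/

/-- The vector with integer coordinates `n`. -/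
def intVec {m : ℕ} (n : Fin m → ℤ) : EuclideanSpace ℝ (Fin m) := WithLp.toLp 2 fun i => (n i : ℝ)

@[simp] theorem intVec_apply {m : ℕ} (n : Fin m → ℤ) (i : Fin m) : intVec n i = n i := rfl

/-- The translations that leave q invariant form an additive group, and it contains the basis
vectors. -/
theorem periodic_intVec {m : ℕ} {W : Type*} {q : EuclideanSpace ℝ (Fin m) → W}
    (hq : ∀ y, ∀ i, q (y + EuclideanSpace.single i 1) = q y) (n : Fin m → ℤ)
    (y : EuclideanSpace ℝ (Fin m)) : q (y + intVec n) = q y := by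
  let P : AddSubgroup (EuclideanSpace ℝ (Fin m)) :=
    { carrier := {v | ∀ y, q (y + v) = q y}
      zero_mem' := fun y => by simp
      add_mem' := fun {a b} ha hb y => by rw [← add_assoc, hb, ha]
      neg_mem' := fun {a} ha y => by rw [← ha (y + -a)]; simp }
  have h : intVec n = ∑ i, n i • (EuclideanSpace.single i 1 : EuclideanSpace ℝ (Fin m)) := by
    ext j
    simp [intVec, Finset.sum_apply, Pi.single_apply]
  have : intVec n ∈ P := by
    rw [h]
    exact P.sum_mem fun i _ => P.zsmul_mem (fun y => hq y i) _
  exact this y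

/-- The half-open unit cube. -/
def cube (m : ℕ) : Set (EuclideanSpace ℝ (Fin m)) := {y | ∀ i, y i ∈ Ico (0 : ℝ) 1}

/-- The half-open cube tiles space without overlap, while the unit cell is closed; the difference
consists of faces and is null. -/
theorem cube_ae_eq (m : ℕ) :
    cube m =ᵐ[volume] {y : EuclideanSpace ℝ (Fin m) | ∀ i, y i ∈ Icc (0 : ℝ) 1} := by
  have h := (PiLp.volume_preserving_ofLp (Fin m)).quasiMeasurePreserving.preimage_ae_eq
    (Measure.univ_pi_Ico_ae_eq_Icc (f := fun _ : Fin m => (0 : ℝ)) (g := fun _ => 1)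
      (μ := fun _ => volume))
  have h1 : cube m = WithLp.ofLp ⁻¹' univ.pi fun _ : Fin m => Ico (0 : ℝ) 1 := by
    ext y; simp [cube]
  have h2 : {y : EuclideanSpace ℝ (Fin m) | ∀ i, y i ∈ Icc (0 : ℝ) 1} =
      WithLp.ofLp ⁻¹' Icc (fun _ => 0) fun _ => 1 := by
    ext y; simp [Pi.le_def, forall_and]
  rw [h1, h2]
  exact h

/-- The cube and its translate are both fundamental domains of the integer lattice, and a periodic
function has the same integral over each. -/
theorem setIntegral_cube_add {m : ℕ} {W : Type*} [NormedAddCommGroup W] [NormedSpace ℝ W]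
    {q : EuclideanSpace ℝ (Fin m) → W}
    (hq : ∀ y, ∀ i, q (y + EuclideanSpace.single i 1) = q y) (y₀ : EuclideanSpace ℝ (Fin m)) :
    ∫ z in cube m, q (y₀ + z) = ∫ z in cube m, q z := by
  let b := (EuclideanSpace.basisFun (Fin m) ℝ).toBasis
  have hD : cube m = ZSpan.fundamentalDomain b := by
    ext y; simp [cube, b]
  have hs := ZSpan.isAddFundamentalDomain' b volume
  have ht := hs.vadd_of_comm y₀
  have : Countable (Submodule.span ℤ (range b)).toAddSubgroup :=
    inferInstanceAs (Countable (Submodule.span ℤ (range b)))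
  have h := ht.setIntegral_eq hs (f := q) (by
    intro g x
    have hg : ∀ v ∈ Submodule.span ℤ (range b), ∀ x, q (v + x) = q x := by
      intro v hv
      induction hv using Submodule.span_induction with
      | mem v hv => 
        obtain ⟨i, rfl⟩ := hv
        intro x
        rw [add_comm]
        simpa [b] using hq x i
      | zero => simp
      | add v w _ _ hv hw => intro x; rw [add_assoc, hv, hw]
      | smul n v _ hv => 
        let P : AddSubgroup (EuclideanSpace ℝ (Fin m)) :=
          { carrier := {v | ∀ x, q (v + x) = q x}
            zero_mem' := fun y => by simp
            add_mem' := fun {a b} ha hb y => by rw [add_assoc, ha, hb]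
            neg_mem' := fun {a} ha y => by rw [← ha (-a + y)]; simp }
        exact P.zsmul_mem (x := v) hv n
    exact hg g g.2 x)
  rw [hD, ← h]
  exact ((measurePreserving_vadd y₀ volume).setIntegral_image_emb
    (measurableEmbedding_const_vadd y₀) q _).symm

theorem setIntegral_cellY_add {W : Type*} [NormedAddCommGroup W] [NormedSpace ℝ W] {q : E3 → W}
    (hq : ∀ y, ∀ i, q (y + EuclideanSpace.single i 1) = q y) (y₀ : E3) :
    ∫ z in cellY, q (y₀ + z) = ∫ z in cellY, q z := by
  have h := setIntegral_cube_add hq y₀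
  rwa [setIntegral_congr_set (cube_ae_eq 3), setIntegral_congr_set (cube_ae_eq 3)] at h

/-! ### Averaging of oscillating functions -/

/-- `f(x, y)` is continuous, periodic in `y`, and vanishes for `x` outside of `K`. -/
structure IsOsc {W : Type*} [NormedAddCommGroup W] (K : Set E3) (b : E3 × E3 → W) : Prop where
  cont : Continuous b
  periodic : ∀ x y, ∀ i : Fin 3, b (x, y + EuclideanSpace.single i 1) = b (x, y)
  zero : ∀ x ∉ K, ∀ y, b (x, y) = 0

/-- The integer part of a vector. -/
def floorVec (y : E3) : Fin 3 → ℤ := fun i => ⌊y i⌋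

theorem sub_floorVec_mem (y : E3) (i : Fin 3) : (y - intVec (floorVec y)) i ∈ Ico (0 : ℝ) 1 := by
  have : (y - intVec (floorVec y)) i = Int.fract (y i) := by
    simp [floorVec, ← Int.self_sub_floor]
  rw [this]
  exact ⟨Int.fract_nonneg _, Int.fract_lt_one _⟩

namespace IsOsc

variable {W : Type*} [NormedAddCommGroup W] {K : Set E3} {b : E3 × E3 → W}

theorem sub_intVec (hb : IsOsc K b) (x y : E3) (n : Fin 3 → ℤ) :
    b (x, y - intVec n) = b (x, y) := by
  have := periodic_intVec (q := fun y => b (x, y)) (hb.periodic x) n (y - intVec n)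
  simpa using this.symm

/-- Shifting both fast variables by the same integer vector brings nearby points into a fixed
compact box, where Heine–Cantor applies. -/
theorem uniformContinuous (hb : IsOsc K b) (hK : IsCompact K) : UniformContinuous b := by
  rw [Metric.uniformContinuous_iff]
  intro ε hε
  -- After the shift y lies in [0,1)³, and y', at distance at most 1 from y, lies in [-1,2]³.
  have hC : IsCompact (Metric.cthickening 1 K ×ˢ {y : E3 | ∀ i, y i ∈ Icc (-1 : ℝ) 2}) :=
    hK.cthickening.prod (isCompact_cube 3 (-1) 2)
  obtain ⟨δ, hδ, h⟩ := Metric.uniformContinuousOn_iff.1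
    (hC.uniformContinuousOn_of_continuous hb.cont.continuousOn) ε hε
  refine ⟨min δ 1, by positivity, ?_⟩
  rintro ⟨x, y⟩ ⟨x', y'⟩ hd
  rw [Prod.dist_eq, max_lt_iff] at hd
  obtain ⟨hx, hy⟩ := hd
  by_cases hK' : x ∉ K ∧ x' ∉ K
  · rw [hb.zero x hK'.1, hb.zero x' hK'.2, dist_self]; exact hε
  have hmem : x ∈ Metric.cthickening 1 K ∧ x' ∈ Metric.cthickening 1 K := by
    have hx1 : dist x x' ≤ 1 := (hx.trans_le (min_le_right _ _)).le
    rcases not_and_or.1 hK' with h | h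
    · exact ⟨Metric.self_subset_cthickening _ (not_not.1 h),
        Metric.mem_cthickening_of_dist_le _ _ _ _ (not_not.1 h) (by rwa [dist_comm])⟩
    · exact ⟨Metric.mem_cthickening_of_dist_le _ _ _ _ (not_not.1 h) hx1,
        Metric.self_subset_cthickening _ (not_not.1 h)⟩
  have key := h (x, y - intVec (floorVec y)) ⟨hmem.1, fun i => ?_⟩
    (x', y' - intVec (floorVec y)) ⟨hmem.2, fun i => ?_⟩ ?_
  · rwa [hb.sub_intVec, hb.sub_intVec] at key
  · have := sub_floorVec_mem y i
    exact ⟨by linarith [this.1], by linarith [this.2]⟩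
  · have h1 := sub_floorVec_mem y i
    have h2 : |y i - y' i| ≤ dist y y' := by
      rw [dist_eq_norm]; exact PiLp.norm_apply_le (y - y') i
    have h3 := abs_le.1 (h2.trans (hy.trans_le (min_le_right _ _)).le)
    simp only [PiLp.sub_apply, intVec_apply] at h1 ⊢
    exact ⟨by linarith [h1.1, h3.2], by linarith [h1.2, h3.1]⟩
  · rw [Prod.dist_eq, max_lt_iff, dist_sub_right]
    exact ⟨hx.trans_le (min_le_left _ _), hy.trans_le (min_le_left _ _)⟩

theorem exists_bound (hb : IsOsc K b) (hK : IsCompact K) : ∃ M, 0 ≤ M ∧ ∀ z, ‖b z‖ ≤ M := by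
  obtain ⟨M, hM⟩ := (hK.prod isCompact_cellY).exists_bound_of_continuousOn hb.cont.continuousOn
  refine ⟨max M 0, le_max_right _ _, ?_⟩
  rintro ⟨x, y⟩
  by_cases hx : x ∈ K
  · rw [← hb.sub_intVec x y (floorVec y)]
    exact (hM _ ⟨hx, fun i => Ico_subset_Icc_self (sub_floorVec_mem y i)⟩).trans (le_max_left _ _)
  · rw [hb.zero x hx, norm_zero]; exact le_max_right _ _

theorem integrable_comp (hb : IsOsc K b) (hK : IsCompact K) {g : E3 → E3} (hg : Continuous g) :
    Integrable fun x => b (x, g x) :=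
  (hb.cont.comp (continuous_id.prodMk hg)).integrable_of_hasCompactSupport
    (HasCompactSupport.intro hK fun x hx => hb.zero x hx _)

/-- Translating x by d z leaves the integral unchanged and moves the fast variable by exactly z.
Averaging over z ∈ Y gives the mean of b(x + d z, x/d + z). For small d the slow argument can be
frozen at x by uniform continuity, and by periodicity the remaining z-integral of b(x, x/d + z) is
the cell mean. -/
theorem tendsto_average [NormedSpace ℝ W] [CompleteSpace W] (hb : IsOsc K b) (hK : IsCompact K) :
    Tendsto (fun d : ℝ => ∫ x, b (x, d⁻¹ • x)) (𝓝[>] 0) (𝓝 (∫ x, ∫ y in cellY, b (x, y))) := by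
  obtain ⟨R, hR0, hR⟩ : ∃ R, 0 < R ∧ ∀ z ∈ cellY, ‖z‖ ≤ R :=
    isCompact_cellY.isBounded.exists_pos_norm_le
  rw [Metric.tendsto_nhds]
  intro ε hε
  -- Once |d z| < 1 for all z ∈ Y, both integrands vanish outside `K1`; the tolerance ε / (2(V + 1))
  -- integrated over `K1` stays below ε.
  set K1 := Metric.cthickening 1 K
  have hK1 : IsCompact K1 := hK.cthickening
  set V := volume.real K1
  obtain ⟨δ, hδ, hu⟩ := Metric.uniformContinuous_iff.1 (hb.uniformContinuous hK)
    (ε / (2 * (V + 1))) (by positivity)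
  have hsmall : ∀ᶠ d : ℝ in 𝓝[>] 0, d < min δ 1 / R :=
    (eventually_lt_nhds (by positivity)).filter_mono nhdsWithin_le_nhds
  filter_upwards [hsmall, self_mem_nhdsWithin] with d hd hd0
  have hd0 : 0 < d := hd0
  rw [lt_div_iff₀ hR0] at hd
  have hdz : ∀ z ∈ cellY, ‖d • z‖ < min δ 1 := fun z hz => by
    rw [norm_smul, Real.norm_of_nonneg hd0.le]
    exact (mul_le_mul_of_nonneg_left (hR z hz) hd0.le).trans_lt hd
  have hcell : ∀ x, ∫ z in cellY, b (x, d⁻¹ • x + z) = ∫ z in cellY, b (x, z) := fun x =>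
    setIntegral_cellY_add (q := fun y => b (x, y)) (hb.periodic x) _
  have hprod : Integrable (fun p : E3 × E3 => b (p.1, d⁻¹ • p.1 + p.2))
      (volume.prod (volume.restrict cellY)) := by
    obtain ⟨M, hM0, hM⟩ := hb.exists_bound hK
    have hc : Continuous fun p : E3 × E3 => b (p.1, d⁻¹ • p.1 + p.2) :=
      hb.cont.comp (by fun_prop)
    have h1 : IntegrableOn (fun p : E3 × E3 => b (p.1, d⁻¹ • p.1 + p.2)) (K ×ˢ cellY)
        (volume.prod volume) := hc.continuousOn.integrableOn_compact (hK.prod isCompact_cellY)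
    have h2 : IntegrableOn (fun p : E3 × E3 => b (p.1, d⁻¹ • p.1 + p.2)) (univ ×ˢ cellY)
        (volume.prod volume) := by
      refine h1.of_forall_sdiff_eq_zero (MeasurableSet.univ.prod measurableSet_cellY) ?_
      rintro ⟨x, y⟩ ⟨⟨_, hy⟩, hxy⟩
      refine hb.zero x (fun hx => hxy ⟨hx, hy⟩) _
    rw [IntegrableOn, ← Measure.prod_restrict, Measure.restrict_univ] at h2
    exact h2
  have hJ : ∫ x, ∫ z in cellY, b (x, z) = ∫ z in cellY, ∫ x, b (x, d⁻¹ • x + z) := by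
    simp_rw [← hcell]
    exact integral_integral_swap hprod
  have hI : ∀ z, ∫ x, b (x, d⁻¹ • x) = ∫ x, b (x + d • z, d⁻¹ • x + z) := fun z => by
    rw [← integral_add_right_eq_self (fun x => b (x, d⁻¹ • x)) (d • z)]
    simp [smul_add, smul_smul, hd0.ne']
  have hint : ∀ z, Integrable fun x => b (x, d⁻¹ • x + z) := fun z =>
    hb.integrable_comp hK (by fun_prop)
  have hint' : ∀ z, Integrable fun x => b (x + d • z, d⁻¹ • x + z) := fun z => by
    have := (hb.integrable_comp hK (g := fun x => d⁻¹ • x) (by fun_prop)).comp_add_right (d • z)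
    simpa [smul_add, smul_smul, hd0.ne'] using this
  have hdiff : ∀ z ∈ cellY, ‖∫ x, (b (x + d • z, d⁻¹ • x + z) - b (x, d⁻¹ • x + z))‖ ≤
      ε / (2 * (V + 1)) * V := by
    intro z hz
    rw [← setIntegral_eq_integral_of_forall_compl_eq_zero (s := K1)]
    · refine norm_setIntegral_le_of_norm_le_const hK1.measure_lt_top fun x _ => ?_
      rw [← dist_eq_norm]
      refine (hu ?_).le
      rw [Prod.dist_eq, max_lt_iff]
      simpa using ⟨(hdz z hz).trans_le (min_le_left _ _), hδ⟩
    · intro x hx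
      have h1 : x ∉ K := fun h => hx (Metric.self_subset_cthickening _ h)
      have h2 : x + d • z ∉ K := fun h => hx (Metric.mem_cthickening_of_dist_le _ _ _ _ h (by
        simpa [dist_eq_norm] using ((hdz z hz).trans_le (min_le_right _ _)).le))
      rw [hb.zero _ h1, hb.zero _ h2, sub_zero]
  rw [hJ, dist_eq_norm]
  have hIz : (∫ x, b (x, d⁻¹ • x)) - ∫ z in cellY, ∫ x, b (x, d⁻¹ • x + z) =
      ∫ z in cellY, ∫ x, (b (x + d • z, d⁻¹ • x + z) - b (x, d⁻¹ • x + z)) := by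
    simp_rw [integral_sub (hint' _) (hint _), ← hI]
    rw [integral_sub (integrable_const _) hprod.integral_prod_right]
    simp
  rw [hIz]
  have hle := norm_setIntegral_le_of_norm_le_const (μ := volume)
    (by simp [volume_cellY]) hdiff
  have hV : (0 : ℝ) ≤ V := measureReal_nonneg
  refine hle.trans_lt ?_
  simp only [measureReal_def, volume_cellY, ENNReal.toReal_one, mul_one]
  rw [div_mul_eq_mul_div, div_lt_iff₀ (by positivity)]
  nlinarith

/-- Restriction of the fast variable to the plane `y₃ = 0`. -/
theorem flat (hb : IsOsc K b) : IsOsc K fun z : E3 × E3 => b (z.1, lift (proj z.2) 0) where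
  cont := hb.cont.comp (by fun_prop)
  periodic x y i := by
    have h := hb.periodic x (lift (proj y) 0) i
    by_cases hi : i = 2
    · subst hi
      congr 2
      exact E3_ext (by simp) (by simp) (by simp)
    · rw [← h]
      congr 2
      refine E3_ext (by simp) (by simp) ?_
      simp [Ne.symm hi]
  zero x hx y := hb.zero x hx _

end IsOsc

/-! ### Sums over the sheets -/

theorem sum_layers_indicator {L d : ℝ} (hd : 0 < d) (q : ℤ → ℝ) (s : ℝ) :
    ∑ k ∈ layers L d, (Ico (k * d) (k * d + d)).indicator (fun _ => q k) s =
      if ⌊s / d⌋ ∈ layers L d then q ⌊s / d⌋ else 0 := by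
  have hmem : ∀ k : ℤ, s ∈ Ico (k * d) (k * d + d) ↔ ⌊s / d⌋ = k := fun k => by
    rw [Int.floor_eq_iff, le_div_iff₀ hd, div_lt_iff₀ hd, mem_Ico, add_mul, one_mul]
  simp only [indicator_apply, hmem]
  rw [Finset.sum_ite_eq]

theorem integrableOn_layers {S : Set E2} {L d : ℝ} (hd : 0 < d) {q : ℤ → E2 → ℝ}
    (hq : ∀ k ∈ layers L d, IntegrableOn (q k) S) :
    IntegrableOn (fun x : E3 =>
      if ⌊x 2 / d⌋ ∈ layers L d then q ⌊x 2 / d⌋ (proj x) else 0) (cyl S L) := by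
  simp_rw [← fun x : E3 => sum_layers_indicator (L := L) hd (fun k => q k (proj x)) (x 2)]
  rw [cyl_eq, ← integrable_lift_iff]
  refine integrable_finsetSum _ fun k hk => ?_
  have h2 : Integrable ((Ico (k * d) (k * d + d)).indicator fun _ => (1 : ℝ))
      (volume.restrict (Ioo (-L) L)) := (integrable_const _).indicator measurableSet_Ico
  refine ((hq k hk).integrable.mul_prod h2).congr (ae_of_all _ fun z => ?_)
  simp [indicator_apply]

/-- The factor d is the height of the slab [kd, kd + d) above the k-th sheet. The slab stays inside
Ω because k d < L - d, so a weighted sum over sheets is the volume integral of a function constant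
in height on each slab. -/
theorem mul_sum_layers_setIntegral {S : Set E2} {L d : ℝ} (hd : 0 < d) {q : ℤ → E2 → ℝ}
    (hq : ∀ k ∈ layers L d, IntegrableOn (q k) S) :
    d * ∑ k ∈ layers L d, ∫ x' in S, q k x' =
      ∫ x in cyl S L, if ⌊x 2 / d⌋ ∈ layers L d then q ⌊x 2 / d⌋ (proj x) else 0 := by
  have h1 : ∀ k ∈ layers L d, ∫ s in Ioo (-L) L,
      (Ico (k * d) (k * d + d)).indicator (fun _ => (1 : ℝ)) s = d := by
    intro k hk
    obtain ⟨h, h'⟩ := (mem_layers hd k).1 hk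
    rw [setIntegral_indicator measurableSet_Ico, inter_eq_self_of_subset_right]
    · simp [hd.le]
    · intro s hs
      exact ⟨h.trans_le hs.1, hs.2.trans_le (by linarith)⟩
  simp_rw [← fun x : E3 => sum_layers_indicator (L := L) hd (fun k => q k (proj x)) (x 2)]
  rw [cyl_eq, setIntegral_lift, integral_finsetSum, Finset.mul_sum]
  · refine Finset.sum_congr rfl fun k hk => ?_
    have := integral_prod_mul (μ := volume.restrict S) (ν := volume.restrict (Ioo (-L) L)) (q k)
      ((Ico (k * d) (k * d + d)).indicator fun _ => (1 : ℝ))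
    rw [h1 k hk] at this
    rw [mul_comm d, ← this]
    congr 1 with z
    simp [indicator_apply]
  · intro k hk
    have h2 : Integrable ((Ico (k * d) (k * d + d)).indicator fun _ => (1 : ℝ))
        (volume.restrict (Ioo (-L) L)) := (integrable_const _).indicator measurableSet_Ico
    refine ((hq k hk).integrable.mul_prod h2).congr (ae_of_all _ fun z => ?_)
    simp [indicator_apply]

/-- The compact set keeps a positive distance from the bottom and the top of the cylinder; for d
below it, the slab containing a point of K belongs to an admissible sheet. -/
theorem exists_floor_mem_layers {S : Set E2} {L : ℝ} {K : Set E3} (hK : IsCompact K)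
    (hKS : K ⊆ cyl S L) :
    ∃ δ > 0, ∀ d, 0 < d → d < δ → ∀ x ∈ K, ⌊x 2 / d⌋ ∈ layers L d := by
  have h1 : (fun x : E3 => x 2) '' K ⊆ Ioo (-L) L := by
    rintro _ ⟨x, hx, rfl⟩; exact (hKS hx).2
  obtain ⟨δ, hδ, h2⟩ := (hK.image (f := fun x : E3 => x 2)
    (by fun_prop)).exists_cthickening_subset_open isOpen_Ioo h1
  refine ⟨δ, hδ, fun d hd hdδ x hx => ?_⟩
  have hm : ∀ t, |t| ≤ δ → x 2 + t ∈ Ioo (-L) L := fun t ht =>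
    h2 (Metric.mem_cthickening_of_dist_le _ _ _ _ (mem_image_of_mem _ hx)
      (by simpa [Real.dist_eq] using ht))
  have ha := (hm (-d) (by rw [abs_neg, abs_of_pos hd]; exact hdδ.le)).1
  have hb := (hm d (by rw [abs_of_pos hd]; exact hdδ.le)).2
  rw [mem_layers hd]
  have hf1 := Int.floor_le (x 2 / d)
  have hf2 := Int.lt_floor_add_one (x 2 / d)
  rw [le_div_iff₀ hd] at hf1
  rw [div_lt_iff₀ hd] at hf2
  exact ⟨by linarith, by linarith⟩

/-- The slabs above the sheets are disjoint and contained in Ω. -/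
theorem mul_card_layers_le {S : Set E2} (hSb : Bornology.IsBounded S) {L d : ℝ} (hd : 0 < d) :
    d * ∑ k ∈ layers L d, ∫ _ in S, (1 : ℝ) ≤ volume.real (cyl S L) := by
  rw [mul_sum_layers_setIntegral hd (q := fun _ _ => 1) fun _ _ => by
    simpa using hSb.measure_lt_top]
  have hvol := volume_cyl_lt_top hSb L
  refine (setIntegral_mono (integrableOn_layers hd (q := fun _ _ => 1) fun _ _ => by
    simpa using hSb.measure_lt_top) (integrableOn_const hvol.ne (C := (1 : ℝ))) fun x => ?_).trans ?_
  · dsimp only; split_ifs <;> norm_num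
  · simp

/-- On the volume side the height of x has been rounded down to a multiple of d. Undoing the
rounding moves the slow variable by less than d, which uniform continuity absorbs; what remains is
the average of b with y₃ set to 0. -/
theorem IsOsc.tendsto_sheets {S : Set E2} (hSb : Bornology.IsBounded S) {L : ℝ}
    {K : Set E3} (hK : IsCompact K) (hKS : K ⊆ cyl S L) {b : E3 × E3 → ℝ} (hb : IsOsc K b) :
    Tendsto (fun d : ℝ => d * ∑ k ∈ layers L d, ∫ x' in S,
        b (lift x' (k * d), lift (d⁻¹ • x') 0)) (𝓝[>] 0)
      (𝓝 (∫ x in cyl S L, ∫ y' in cellY2, b (x, lift y' 0))) := by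
  have hav := hb.flat.tendsto_average hK
  have hlim : ∫ x, ∫ y in cellY, b (x, lift (proj y) 0) =
      ∫ x in cyl S L, ∫ y' in cellY2, b (x, lift y' 0) := by
    rw [setIntegral_eq_integral_of_forall_compl_eq_zero]
    · congr 1 with x
      rw [cellY_eq, setIntegral_lift]
      simp only [proj_lift]
      rw [integral_fun_fst (f := fun y' => b (x, lift y' 0))]
      simp
    · intro x hx
      simp [hb.zero x fun h => hx (hKS h)]
  simp only [hlim] at hav
  have hvol := volume_cyl_lt_top hSb L
  have hdiff : Tendsto (fun d : ℝ => (d * ∑ k ∈ layers L d, ∫ x' in S,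
        b (lift x' (k * d), lift (d⁻¹ • x') 0)) - ∫ x, b (x, lift (proj (d⁻¹ • x)) 0))
        (𝓝[>] 0) (𝓝 0) := by
    rw [Metric.tendsto_nhds]
    intro ε hε
    obtain ⟨δ, hδ, hu⟩ := Metric.uniformContinuous_iff.1 (hb.uniformContinuous hK)
      (ε / (volume.real (cyl S L) + 1)) (by positivity)
    obtain ⟨δ', hδ', hfl⟩ := exists_floor_mem_layers hK hKS
    have hsmall : ∀ᶠ d : ℝ in 𝓝[>] 0, d < min δ δ' :=
      (eventually_lt_nhds (by positivity)).filter_mono nhdsWithin_le_nhds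
    filter_upwards [hsmall, self_mem_nhdsWithin] with d hd hd0
    have hd0 : 0 < d := hd0
    have hcont : ∀ k : ℤ, Continuous fun x' : E2 => b (lift x' (k * d), lift (d⁻¹ • x') 0) :=
      fun k => hb.cont.comp (by fun_prop)
    obtain ⟨M, hM0, hM⟩ := hb.exists_bound hK
    have hq : ∀ k ∈ layers L d,
        IntegrableOn (fun x' : E2 => b (lift x' (k * d), lift (d⁻¹ • x') 0)) S := fun k _ =>
      IntegrableOn.of_bound hSb.measure_lt_top (hcont k).aestronglyMeasurable M
        (ae_of_all _ fun _ => hM _)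
    rw [mul_sum_layers_setIntegral hd0
      (q := fun k x' => b (lift x' (k * d), lift (d⁻¹ • x') 0)) hq]
    rw [← setIntegral_eq_integral_of_forall_compl_eq_zero (s := cyl S L)
      (f := fun x => b (x, lift (proj (d⁻¹ • x)) 0)) fun x hx => hb.zero x (fun h => hx (hKS h)) _]
    rw [← integral_sub (integrableOn_layers hd0 hq)
      (hb.integrable_comp hK (by fun_prop)).integrableOn, dist_zero_right]
    refine (norm_setIntegral_le_of_norm_le_const hvol
      (C := ε / (volume.real (cyl S L) + 1)) fun x _ => ?_).trans_lt ?_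
    · have hproj : proj (d⁻¹ • x) = d⁻¹ • proj x := E2_ext (by simp) (by simp)
      split_ifs with h
      · rw [hproj, ← dist_eq_norm]
        refine (hu ?_).le
        rw [Prod.dist_eq, dist_self, max_lt_iff]
        refine ⟨?_, hδ⟩
        have hx : lift (proj x) (⌊x 2 / d⌋ * d) - x = lift 0 (⌊x 2 / d⌋ * d - x 2) :=
          E3_ext (by simp) (by simp) (by simp)
        have hf1 := Int.floor_le (x 2 / d)
        have hf2 := Int.lt_floor_add_one (x 2 / d)
        rw [le_div_iff₀ hd0] at hf1
        rw [div_lt_iff₀ hd0] at hf2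
        rw [dist_eq_norm, hx, EuclideanSpace.norm_eq]
        simp only [Fin.sum_univ_three, lift_zero, lift_one, lift_two, PiLp.zero_apply, norm_zero]
        rw [Real.sqrt_lt' hδ, Real.norm_eq_abs, sq_abs]
        have := hd.trans_le (min_le_left _ _)
        nlinarith
      · have hx : x ∉ K := fun hx => h (hfl d hd0 (hd.trans_le (min_le_right _ _)) x hx)
        rw [hb.zero x hx, sub_zero, norm_zero]
        positivity
    · rw [div_mul_eq_mul_div, div_lt_iff₀ (by positivity)]
      nlinarith [measureReal_nonneg (μ := (volume : Measure E3)) (s := cyl S L)]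
  simpa using hdiff.add hav

/-! ### The energy estimate -/

/-- The square of the Euclidean norm of a complex vector. -/
def nsq (v : C3) : ℝ := ∑ i, ‖v i‖ ^ 2

theorem nsq_nonneg (v : C3) : 0 ≤ nsq v := Finset.sum_nonneg fun _ _ => by positivity

theorem dotProduct_star_self (v : C3) : v ⬝ᵥ star v = (nsq v : ℂ) := by
  simp only [dotProduct, nsq, Pi.star_apply, RCLike.star_def, Complex.mul_conj,
    Complex.normSq_eq_norm_sq, Complex.ofReal_sum]

theorem norm_sq_le_nsq (v : C3) (i : Fin 3) : ‖v i‖ ^ 2 ≤ nsq v :=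
  Finset.single_le_sum (f := fun i => ‖v i‖ ^ 2) (fun _ _ => by positivity) (Finset.mem_univ i)

theorem norm_dotProduct_star_le {κ : ℝ} (hκ : 0 < κ) (u v : C3) :
    ‖u ⬝ᵥ star v‖ ≤ nsq u / (2 * κ) + κ / 2 * nsq v := by
  have h : ∀ a b : ℝ, a * b ≤ a ^ 2 / (2 * κ) + κ / 2 * b ^ 2 := fun a b => by
    have : a ^ 2 / (2 * κ) + κ / 2 * b ^ 2 - a * b = (a - κ * b) ^ 2 / (2 * κ) := by
      field_simp; ring
    have h2 : 0 ≤ (a - κ * b) ^ 2 / (2 * κ) := by positivity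
    linarith
  calc ‖u ⬝ᵥ star v‖ ≤ ∑ i, ‖u i‖ * ‖v i‖ := by
        refine (norm_sum_le _ _).trans_eq ?_
        simp
    _ ≤ ∑ i, (‖u i‖ ^ 2 / (2 * κ) + κ / 2 * ‖v i‖ ^ 2) := Finset.sum_le_sum fun i _ => h _ _
    _ = _ := by rw [Finset.sum_add_distrib, ← Finset.sum_div, ← Finset.mul_sum]; rfl

/-! ### Quadratic bounds for integrals of complex fields. -/

section
variable {X : Type*} [MeasurableSpace X] {m : Measure X}

theorem memLp_component {u : X → C3} {p : ℝ≥0∞} (hu : MemLp u p m) (i : Fin 3) :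
    MemLp (fun x => u x i) p m :=
  hu.of_le ((continuous_apply i).comp_aestronglyMeasurable hu.1)
    (ae_of_all _ fun x => norm_le_pi_norm (u x) i)

theorem integrable_norm_sq {W : Type*} [NormedAddCommGroup W] {u : X → W} (hu : MemLp u 2 m) :
    Integrable (fun x => ‖u x‖ ^ 2) m :=
  (memLp_two_iff_integrable_sq_norm hu.1).1 hu

theorem integrable_nsq {u : X → C3} (hu : MemLp u 2 m) : Integrable (fun x => nsq (u x)) m :=
  integrable_finsetSum _ fun i _ => integrable_norm_sq (memLp_component hu i)

theorem norm_integral_dotProduct_star_le {κ : ℝ} (hκ : 0 < κ) {u v : X → C3} (hu : MemLp u 2 m)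
    (hv : MemLp v 2 m) : ‖∫ x, u x ⬝ᵥ star (v x) ∂m‖ ≤
      (∫ x, nsq (u x) ∂m) / (2 * κ) + κ / 2 * ∫ x, nsq (v x) ∂m := by
  rw [← integral_div, ← integral_const_mul, ← integral_add ((integrable_nsq hu).div_const _)
    ((integrable_nsq hv).const_mul _)]
  exact norm_integral_le_of_norm_le (((integrable_nsq hu).div_const _).add
    ((integrable_nsq hv).const_mul _)) (ae_of_all _ fun x => norm_dotProduct_star_le hκ _ _)

theorem integrable_mul_nsq {g : X → ℂ} (hg : AEStronglyMeasurable g m) {C : ℝ}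
    (hC : ∀ᵐ x ∂m, ‖g x‖ ≤ C) {u : X → C3} (hu : MemLp u 2 m) :
    Integrable (fun x => g x * (nsq (u x) : ℂ)) m :=
  (integrable_nsq hu).ofReal.bdd_mul hg hC

theorem norm_integral_mul_nsq_le {g : X → ℂ} {C : ℝ}
    (hC : ∀ᵐ x ∂m, ‖g x‖ ≤ C) {u : X → C3} (hu : MemLp u 2 m) :
    ‖∫ x, g x * (nsq (u x) : ℂ) ∂m‖ ≤ C * ∫ x, nsq (u x) ∂m := by
  rw [← integral_const_mul]
  refine norm_integral_le_of_norm_le ((integrable_nsq hu).const_mul _) ?_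
  filter_upwards [hC] with x hx
  rw [norm_mul, Complex.norm_real, Real.norm_of_nonneg (nsq_nonneg _)]
  exact mul_le_mul_of_nonneg_right hx (nsq_nonneg _)

theorem le_im_integral_mul_nsq {g : X → ℂ} (hg : AEStronglyMeasurable g m) {C c : ℝ}
    (hC : ∀ᵐ x ∂m, ‖g x‖ ≤ C) (hc : ∀ᵐ x ∂m, c ≤ (g x).im) {u : X → C3} (hu : MemLp u 2 m) :
    c * ∫ x, nsq (u x) ∂m ≤ (∫ x, g x * (nsq (u x) : ℂ) ∂m).im := by
  have h := integral_im (integrable_mul_nsq hg hC hu)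
  simp only [RCLike.im_to_complex] at h
  rw [← h, ← integral_const_mul]
  refine integral_mono_ae ((integrable_nsq hu).const_mul _) (integrable_mul_nsq hg hC hu).im ?_
  filter_upwards [hc] with x hx
  simpa using mul_le_mul_of_nonneg_right hx (nsq_nonneg (u x))
end

/-- `d ∑_k ∫_S |g|²` over the sheets. -/
def sheetEnergy (S : Set E2) (L d : ℝ) (g : E3 → C3) : ℝ :=
  d * ∑ k ∈ layers L d, ∫ x' in S, nsq (g (lift x' (k * d)))

theorem lift_mem_cyl {S : Set E2} {L d : ℝ} (hd : 0 < d) {k : ℤ} (hk : k ∈ layers L d) {x' : E2}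
    (hx : x' ∈ S) : lift x' (k * d) ∈ cyl S L := by
  have h := (mem_layers hd k).1 hk
  exact ⟨by simpa using hx, h.1, by simpa using h.2.trans (by linarith)⟩

/-- The test field is E itself. Since Im ε and Re σ are bounded below, the imaginary part of the
identity controls the field and its sheet traces; the real part then controls the curl. The source
is absorbed by Young's inequality. -/
theorem energy_estimate {S : Set E2} (hSo : IsOpen S) {L : ℝ} {ν : E3 → E3}
    {ω μ lam : ℝ} (hω : 0 < ω) (hμ : 0 < μ) (hlam : 0 < lam)
    {ε σ : E3 → E3 → ℂ} {c C : ℝ} (hmat : IsMaterial (cyl S L) ε σ c C)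
    {J : E3 → C3} (hJ : MemLp J 2 (volume.restrict (cyl S L))) :
    ∃ M, 0 < M ∧ ∀ d, 0 < d → ∀ E, IsSolution S L ν ω μ lam ε σ J d E →
      ∫ x in cyl S L, nsq (E.fld x) ≤ M ∧ ∫ x in cyl S L, nsq (E.rot x) ≤ M ∧
        sheetEnergy S L d E.sheet ≤ M := by
  set Q := ∫ x in cyl S L, nsq (J x) with hQ
  have hΩ := (isOpen_cyl hSo L).measurableSet
  have hc := hmat.c_pos
  have hQ0 : 0 ≤ Q := integral_nonneg fun _ => nsq_nonneg _
  -- The first inequality is the imaginary part of the identity, the second the real part; the rest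
  -- is arithmetic with bounds independent of d.
  suffices h : ∀ d, 0 < d → ∀ E, IsSolution S L ν ω μ lam ε σ J d E →
      ∃ A R D : ℝ, A = ∫ x in cyl S L, nsq (E.fld x) ∧ R = ∫ x in cyl S L, nsq (E.rot x) ∧
        D = sheetEnergy S L d E.sheet ∧ 0 ≤ A ∧ 0 ≤ D ∧
        ω ^ 2 * c * A + ω * c * D ≤ ω * (Q / (2 * (ω * c)) + ω * c / 2 * A) ∧
        R / μ ≤ ω ^ 2 * C * A + ω * C * D + ω * (Q / (2 * (ω * c)) + ω * c / 2 * A) by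
    -- After absorption the first inequality reads ω²c/2 · A + ωc · D ≤ Q/(2c); dropping either term
    -- on the left gives `A₁` and `D₁`.
    set A₁ := Q / (ω ^ 2 * c ^ 2) with hA₁
    set D₁ := Q / (2 * ω * c ^ 2) with hD₁
    set R₁ := μ * (ω ^ 2 * |C| * A₁ + ω * |C| * D₁ + (Q / (2 * c) + ω ^ 2 * c / 2 * A₁)) with hR₁
    have hA₁0 : 0 ≤ A₁ := by positivity
    have hD₁0 : 0 ≤ D₁ := by positivity
    have hR₁0 : 0 ≤ R₁ := by positivity
    refine ⟨A₁ + D₁ + R₁ + 1, by positivity, fun d hd E hE => ?_⟩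
    obtain ⟨A, R, D, hA, hR, hD, hA0, hD0, h1, h2⟩ := h d hd E hE
    rw [← hA, ← hR, ← hD]
    have hsimp : ω * (Q / (2 * (ω * c)) + ω * c / 2 * A) = Q / (2 * c) + ω ^ 2 * c / 2 * A := by
      field_simp
    rw [hsimp] at h1 h2
    have hAle : A ≤ A₁ := by
      rw [hA₁, le_div_iff₀ (by positivity)]
      have h3 : ω ^ 2 * c / 2 * A ≤ Q / (2 * c) := by
        have : 0 ≤ ω * c * D := by positivity
        linarith
      rw [le_div_iff₀ (by positivity)] at h3
      linarith
    have hDle : D ≤ D₁ := by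
      rw [hD₁, le_div_iff₀ (by positivity)]
      have h3 : ω * c * D ≤ Q / (2 * c) := by
        have : 0 ≤ ω ^ 2 * c / 2 * A := by positivity
        linarith
      rw [le_div_iff₀ (by positivity)] at h3
      linarith
    have hRle : R ≤ R₁ := by
      rw [div_le_iff₀' hμ] at h2
      refine h2.trans (mul_le_mul_of_nonneg_left ?_ hμ.le)
      have hC : C ≤ |C| := le_abs_self C
      have hC0 := abs_nonneg C
      gcongr
    exact ⟨by linarith, by linarith, by linarith⟩
  intro d hd E hE
  obtain ⟨hX, hEq⟩ := hE
  specialize hEq E hX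
  set A := ∫ x in cyl S L, nsq (E.fld x) with hA
  set R := ∫ x in cyl S L, nsq (E.rot x) with hR
  set D := sheetEnergy S L d E.sheet with hD
  set B := ∫ x, nsq (E.bdry x) ∂(bdryMeasure (cyl S L)) with hB
  have hB0 : 0 ≤ B := integral_nonneg fun _ => nsq_nonneg _
  refine ⟨A, R, D, rfl, rfl, rfl, integral_nonneg fun _ => nsq_nonneg _,
    mul_nonneg hd.le (Finset.sum_nonneg fun _ _ => integral_nonneg fun _ => nsq_nonneg _), ?_⟩
  -- The Young parameter ωc makes the field term of the source equal to half of the coercive term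
  -- ω²c A.
  have hJn := norm_integral_dotProduct_star_le (mul_pos hω hc) hJ hX.memLp_fld
  rw [← hQ, ← hA] at hJn
  simp only [aForm, dotProduct_star_self, sheetIntegral] at hEq
  set Jn := ∫ x in cyl S L, J x ⬝ᵥ star (E.fld x)
  have hT1 : ∫ x in cyl S L, (1 / μ : ℂ) * (nsq (E.rot x) : ℂ) = ((R / μ : ℝ) : ℂ) := by
    rw [integral_const_mul, integral_complex_ofReal, ← hR]; push_cast; ring
  have hT4 : ∫ x, Complex.I * ω * lam * (nsq (E.bdry x) : ℂ) ∂(bdryMeasure (cyl S L)) =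
      Complex.I * ((ω * lam * B : ℝ) : ℂ) := by
    rw [integral_const_mul, integral_complex_ofReal, ← hB]; push_cast; ring
  set T2 := ∫ x in cyl S L, (ω : ℂ) ^ 2 * ε x (d⁻¹ • x) * (nsq (E.fld x) : ℂ) with hT2
  have hgε : AEStronglyMeasurable (fun x => (ω : ℂ) ^ 2 * ε x (d⁻¹ • x))
      (volume.restrict (cyl S L)) := ((hmat.measurable_ε d hd).const_mul _).aestronglyMeasurable
  have hbε : ∀ᵐ x ∂(volume.restrict (cyl S L)), ‖(ω : ℂ) ^ 2 * ε x (d⁻¹ • x)‖ ≤ ω ^ 2 * C := by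
    filter_upwards [ae_restrict_mem hΩ] with x hx
    rw [norm_mul, norm_pow, Complex.norm_real, Real.norm_of_nonneg hω.le]
    exact mul_le_mul_of_nonneg_left (hmat.norm_ε x hx _) (by positivity)
  have hiε : ∀ᵐ x ∂(volume.restrict (cyl S L)), ω ^ 2 * c ≤ ((ω : ℂ) ^ 2 * ε x (d⁻¹ • x)).im := by
    filter_upwards [ae_restrict_mem hΩ] with x hx
    rw [← Complex.ofReal_pow, Complex.im_ofReal_mul]
    exact mul_le_mul_of_nonneg_left (hmat.im_ε x hx _).1 (by positivity)
  have h2a := norm_integral_mul_nsq_le hbε hX.memLp_fld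
  have h2b := le_im_integral_mul_nsq hgε hbε hiε hX.memLp_fld
  rw [← hT2, ← hA] at h2a h2b
  set T3 := ∑ k ∈ layers L d, ∫ x' in S, Complex.I * ω *
    (d * σ (lift x' (k * d)) (d⁻¹ • lift x' (k * d))) *
      (nsq (E.sheet (lift x' (k * d))) : ℂ) with hT3
  have hσ : ∀ k ∈ layers L d,
      AEStronglyMeasurable (fun x' : E2 => Complex.I * ω *
        (d * σ (lift x' (k * d)) (d⁻¹ • lift x' (k * d)))) (volume.restrict S) ∧
      (∀ᵐ x' ∂(volume.restrict S), ‖Complex.I * ω *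
        (d * σ (lift x' (k * d)) (d⁻¹ • lift x' (k * d)))‖ ≤ ω * C * d) ∧
      (∀ᵐ x' ∂(volume.restrict S), ω * c * d ≤ (Complex.I * ω *
        (d * σ (lift x' (k * d)) (d⁻¹ • lift x' (k * d)))).im) := by
    intro k hk
    refine ⟨?_, ?_, ?_⟩
    · refine ContinuousOn.aestronglyMeasurable ?_ hSo.measurableSet
      have h1 : ContinuousOn (fun x' : E2 => Function.uncurry σ
          (lift x' (k * d), d⁻¹ • lift x' (k * d))) S :=
        hmat.lip_σ.cont.comp (by fun_prop) fun x' hx => ⟨lift_mem_cyl hd hk hx, mem_univ _⟩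
      exact continuousOn_const.mul (continuousOn_const.mul h1)
    · filter_upwards [ae_restrict_mem hSo.measurableSet] with x' hx
      have := hmat.norm_σ _ (lift_mem_cyl hd hk hx) (d⁻¹ • lift x' (k * d))
      simp only [norm_mul, Complex.norm_I, Complex.norm_real, Real.norm_of_nonneg hω.le,
        Real.norm_of_nonneg hd.le, one_mul]
      calc ω * (d * _) ≤ ω * (d * C) := by gcongr
        _ = _ := by ring
    · filter_upwards [ae_restrict_mem hSo.measurableSet] with x' hx
      have := (hmat.re_σ _ (lift_mem_cyl hd hk hx) (d⁻¹ • lift x' (k * d))).1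
      simp only [mul_assoc, Complex.I_mul_im, Complex.re_ofReal_mul]
      calc ω * (c * d) = ω * (d * c) := by ring
        _ ≤ _ := by gcongr
  have h3a : ‖T3‖ ≤ ω * C * D := by
    rw [hT3, hD, sheetEnergy, ← mul_assoc, Finset.mul_sum]
    refine (norm_sum_le _ _).trans (Finset.sum_le_sum fun k hk => ?_)
    exact norm_integral_mul_nsq_le (hσ k hk).2.1 (hX.sheetTrace k hk).memLp
  have h3b : ω * c * D ≤ T3.im := by
    rw [hT3, hD, sheetEnergy, ← mul_assoc, Finset.mul_sum, Complex.im_sum]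
    refine Finset.sum_le_sum fun k hk => ?_
    exact le_im_integral_mul_nsq (hσ k hk).1 (hσ k hk).2.1 (hσ k hk).2.2 (hX.sheetTrace k hk).memLp
  rw [hT1, hT4] at hEq
  have him := congrArg Complex.im hEq
  have hre := congrArg Complex.re hEq
  simp only [Complex.sub_im, Complex.sub_re, Complex.ofReal_im, Complex.ofReal_re,
    Complex.I_mul_im, Complex.I_mul_re, mul_assoc, Complex.re_ofReal_mul,
    Complex.im_ofReal_mul] at him hre
  have hn1 := (abs_le.1 (Complex.abs_re_le_norm Jn)).1
  have hn2 := (abs_le.1 (Complex.abs_im_le_norm Jn)).1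
  have hn3 := (abs_le.1 (Complex.abs_re_le_norm T2)).2
  have hn4 := (abs_le.1 (Complex.abs_re_le_norm T3)).2
  -- The boundary term has the same sign as the coercive terms in the imaginary part and can be
  -- dropped; it is purely imaginary, so it is absent from the real part.
  have hlB : 0 ≤ ω * (lam * B) := by positivity
  constructor
  · have : ω * -Jn.re ≤ ω * (Q / (2 * (ω * c)) + ω * c / 2 * A) :=
      mul_le_mul_of_nonneg_left (by linarith) hω.le
    linarith
  · have : ω * -Jn.im ≤ ω * (Q / (2 * (ω * c)) + ω * c / 2 * A) :=
      mul_le_mul_of_nonneg_left (by linarith) hω.le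
    linarith

/-! ### Two-scale convergence tested with fields that jump across the sheets -/

theorem tendsto_of_approx {ι : Type*} {F : Filter ι} {a : ι → ℂ} {b : ℂ}
    (h : ∀ ε > 0, ∃ a' : ι → ℂ, ∃ b', Tendsto a' F (𝓝 b') ∧ (∀ᶠ l in F, ‖a l - a' l‖ ≤ ε) ∧
      ‖b' - b‖ ≤ ε) : Tendsto a F (𝓝 b) := by
  rw [Metric.tendsto_nhds]
  intro ε hε
  obtain ⟨a', b', h1, h2, h3⟩ := h (ε / 4) (by positivity)
  filter_upwards [Metric.tendsto_nhds.1 h1 (ε / 4) (by positivity), h2] with l hl hl'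
  rw [dist_eq_norm] at hl ⊢
  calc ‖a l - b‖ = ‖(a l - a' l) + (a' l - b') + (b' - b)‖ := by congr 1; ring
    _ ≤ ‖a l - a' l‖ + ‖a' l - b'‖ + ‖b' - b‖ := norm_add₃_le
    _ < ε := by linarith

theorem ae_vert_notMem {B : Set ℝ} (hB : volume B = 0) : ∀ᵐ y : E3, y 2 ∉ B := by
  have h := volume_lift univ B
  rw [hB, mul_zero] at h
  rw [ae_iff]
  convert h using 2
  ext y; simp

/-- Reduction of the vertical fast variable modulo one. -/
def fr (y : E3) : E3 := lift (proj y) (Int.fract (y 2))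

theorem fr_add_vert (y : E3) : fr (y + EuclideanSpace.single 2 1) = fr y :=
  E3_ext (by simp [fr]) (by simp [fr]) (by simp [fr])

theorem fr_add_horiz (y : E3) {i : Fin 3} (hi : i ≠ 2) :
    fr (y + EuclideanSpace.single i 1) = fr y + EuclideanSpace.single i 1 :=
  E3_ext (by simp [fr]) (by simp [fr]) (by simp [fr, hi.symm])

/-- `f(x, y)` is continuous, periodic in the horizontal part of `y`, and vanishes for `x` outside
of `K` and for `y₃ > 1/2`. -/
structure IsLayer {W : Type*} [NormedAddCommGroup W] (K : Set E3) (h : E3 × E3 → W) : Prop where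
  cont : Continuous h
  periodic : ∀ x y, ∀ i : Fin 3, i ≠ 2 → h (x, y + EuclideanSpace.single i 1) = h (x, y)
  zero : ∀ x ∉ K, ∀ y, h (x, y) = 0
  top : ∀ x y, 1 / 2 < y 2 → h (x, y) = 0

/-- The continuous cutoff `min(1, n t)`. -/
def ramp (n : ℕ) (t : ℝ) : ℝ := min 1 (n * t)

theorem continuous_ramp (n : ℕ) : Continuous (ramp n) := by unfold ramp; fun_prop

theorem ramp_le_one (n : ℕ) (t : ℝ) : ramp n t ≤ 1 := min_le_left _ _

theorem ramp_nonneg (n : ℕ) {t : ℝ} (ht : 0 ≤ t) : 0 ≤ ramp n t := le_min zero_le_one (by positivity)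

theorem ramp_mono (n : ℕ) {s t : ℝ} (h : s ≤ t) : ramp n s ≤ ramp n t :=
  min_le_min_left _ (mul_le_mul_of_nonneg_left h n.cast_nonneg)

@[simp] theorem ramp_zero (n : ℕ) : ramp n 0 = 0 := by simp [ramp]

theorem tendsto_ramp {t : ℝ} (ht : 0 < t) : Tendsto (fun n => ramp n t) atTop (𝓝 1) := by
  refine tendsto_const_nhds.congr' ?_
  filter_upwards [(tendsto_natCast_atTop_atTop (R := ℝ)).eventually_ge_atTop t⁻¹] with n hn
  rw [ramp, min_eq_left]
  calc (1 : ℝ) = t⁻¹ * t := by field_simp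
    _ ≤ n * t := by gcongr

namespace IsLayer

variable {W : Type*} [NormedAddCommGroup W] {K : Set E3} {h : E3 × E3 → W}

/-- Reducing the height modulo one creates a jump only at integer heights. From below the layer
field already vanishes there, and from above the ramp removes its value, so the product is
continuous and fully periodic. -/
theorem isOsc_ramp [NormedSpace ℝ W] (hh : IsLayer K h) (n : ℕ) :
    IsOsc K fun z : E3 × E3 => ramp n (Int.fract (z.2 2)) • h (z.1, fr z.2) where
  cont := by
    refine ContinuousOn.comp_fract (s := fun z : E3 × E3 => z.2 2)
      (f := fun z t => ramp n t • h (z.1, lift (proj z.2) t)) ?_ (by fun_prop) fun z => ?_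
    · refine Continuous.continuousOn ?_
      exact ((continuous_ramp n).comp continuous_snd).smul (hh.cont.comp (by fun_prop))
    -- The values at fractional part 0 and 1 must match: the ramp vanishes at 0, and the layer field
    -- vanishes at height 1 > 1/2.
    · simp only [ramp_zero, zero_smul]
      rw [hh.top _ _ (by simp; norm_num), smul_zero]
  periodic x y i := by
    by_cases hi : i = 2
    · subst hi
      simp only [fr_add_vert, PiLp.add_apply, PiLp.single_apply, if_true,
        Int.fract_add_one]
    · simp only [fr_add_horiz y hi, hh.periodic _ _ i hi]
      simp [Ne.symm hi]
  zero x hx y := by simp only [hh.zero x hx, smul_zero]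

/-- Horizontal periodicity and the vanishing above 1/2 reduce to the compact unit cell. Below height
0 nothing is controlled, whence the restriction to y₃ ≥ 0. -/
theorem exists_bound (hh : IsLayer K h) (hK : IsCompact K) :
    ∃ M, 0 ≤ M ∧ ∀ x y, 0 ≤ y 2 → ‖h (x, y)‖ ≤ M := by
  obtain ⟨M, hM⟩ := (hK.prod isCompact_cellY).exists_bound_of_continuousOn hh.cont.continuousOn
  refine ⟨max M 0, le_max_right _ _, fun x y hy => ?_⟩
  by_cases hx : x ∈ K
  swap
  · rw [hh.zero x hx, norm_zero]; exact le_max_right _ _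
  by_cases hy' : 1 / 2 < y 2
  · rw [hh.top x y hy', norm_zero]; exact le_max_right _ _
  push Not at hy'
  have hp := periodic_intVec (q := fun y' : E2 => h (x, lift y' (y 2))) (by
    intro y' i
    have := hh.periodic x (lift y' (y 2)) i.castSucc (by simp [Fin.ext_iff]; omega)
    rw [← this]
    congr 2
    fin_cases i <;> exact E3_ext (by simp) (by simp) (by simp)) 
    (fun i => -⌊proj y i⌋) (proj y)
  rw [lift_proj] at hp
  rw [← hp]
  refine (hM _ ⟨hx, ?_⟩).trans (le_max_left _ _)
  intro i
  have : ∀ i : Fin 2, (proj y + intVec fun i => -⌊proj y i⌋) i = Int.fract (proj y i) := fun i => by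
    simp [← Int.self_sub_floor, sub_eq_add_neg]
  fin_cases i
  · simpa [this] using (Int.fract_lt_one _).le
  · simpa [this] using (Int.fract_lt_one _).le
  · simpa using ⟨hy, by linarith⟩

end IsLayer

/-- Two-scale convergence of a bounded sequence of scalar functions. -/
structure ScalarTwoScale (Ω : Set E3) (M : ℝ) (d : ℕ → ℝ) (u : ℕ → E3 → ℂ) (u₀ : E3 × E3 → ℂ) :
    Prop where
  memLp : ∀ l, MemLp (u l) 2 (volume.restrict Ω)
  bound : ∀ l, ∫ x in Ω, ‖u l x‖ ^ 2 ≤ M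
  memLp_lim : MemLp u₀ 2 ((volume.restrict Ω).prod (volume.restrict cellY))
  tendsto : ∀ K ⊆ Ω, IsCompact K → ∀ b : E3 × E3 → ℂ, IsOsc K b →
    Tendsto (fun l => ∫ x in Ω, u l x * b (x, (d l)⁻¹ • x)) atTop
      (𝓝 (∫ z, u₀ z * b z ∂((volume.restrict Ω).prod (volume.restrict cellY))))

theorem young {κ : ℝ} (hκ : 0 < κ) (a b : ℝ) : a * b ≤ κ / 2 * a ^ 2 + b ^ 2 / (2 * κ) := by
  have : κ / 2 * a ^ 2 + b ^ 2 / (2 * κ) - a * b = (κ * a - b) ^ 2 / (2 * κ) := by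
    field_simp; ring
  have h2 : 0 ≤ (κ * a - b) ^ 2 / (2 * κ) := by positivity
  linarith

/-- Dominated convergence: the integrand is at most 1 and tends to 0 off the null set of integer
heights. -/
theorem tendsto_integral_ramp :
    Tendsto (fun n => ∫ y in cellY, (1 - ramp n (min (Int.fract (y 2)) (1 - Int.fract (y 2)))) ^ 2)
      atTop (𝓝 0) := by
  have h0 : (0 : ℝ) = ∫ y in cellY, (0 : ℝ) := by simp
  rw [h0]
  refine tendsto_integral_of_dominated_convergence (fun _ => 1) (fun n => ?_)
    (integrable_const _) (fun n => ae_of_all _ fun y => ?_) ?_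
  · refine Measurable.aestronglyMeasurable ?_
    have := (continuous_ramp n).measurable
    have h2 : Measurable fun y : E3 => y 2 := vertL.continuous.measurable
    fun_prop
  · have h1 := Int.fract_nonneg (y 2)
    have h2 := (Int.fract_lt_one (y 2)).le
    have h3 := ramp_nonneg n (le_min h1 (sub_nonneg.2 h2))
    have h4 := ramp_le_one n (min (Int.fract (y 2)) (1 - Int.fract (y 2)))
    rw [Real.norm_of_nonneg (by positivity)]
    exact pow_le_one₀ (by linarith) (by linarith)
  · have hint : volume (range ((↑) : ℤ → ℝ)) = 0 := (countable_range _).measure_zero _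
    filter_upwards [ae_restrict_of_ae (ae_vert_notMem hint)] with y hy
    have h1 : 0 < Int.fract (y 2) := Int.fract_pos.2 fun h => hy ⟨_, h.symm⟩
    have h2 := Int.fract_lt_one (y 2)
    simpa using ((tendsto_ramp (lt_min h1 (sub_pos.2 h2))).const_sub 1).pow 2

/-- This majorizes the squared error of replacing a layer field by its ramped version. With t the
fractional part of the height, 1 - ramp(t) would jump at integers; using min(t, 1 - t) makes the
majorant continuous there, so that its integral at x/d can be computed by averaging. -/
theorem isOsc_error (K : Set E3) (M : ℝ) (n : ℕ) :
    IsOsc (Metric.cthickening 1 K) fun z : E3 × E3 =>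
      (M * thickenedIndicator one_pos K z.1 *
        (1 - ramp n (min (Int.fract (z.2 2)) (1 - Int.fract (z.2 2))))) ^ 2 where
  cont := by
    refine Continuous.pow (Continuous.mul (by fun_prop) (continuous_const.sub ?_)) 2
    refine ContinuousOn.comp_fract (s := fun z : E3 × E3 => z.2 2)
      (f := fun _ t => ramp n (min t (1 - t))) ?_ (by fun_prop) fun z => by simp
    exact ((continuous_ramp n).comp (by fun_prop)).continuousOn
  periodic x y i := by
    by_cases hi : i = 2
    · subst hi; simp
    · simp [Ne.symm hi]
  zero x hx y := by
    have : x ∉ Metric.thickening 1 K := fun h => hx (Metric.thickening_subset_cthickening _ _ h)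
    simp [thickenedIndicator_zero one_pos K this]

/-- The discontinuous test function is replaced by its ramped version, which is admissible for
two-scale convergence. The replacement error is small in L² uniformly for small d, because its
square is dominated by an oscillating function with small mean, and the sequence u is bounded in L².
-/
theorem ScalarTwoScale.tendsto_layer {Ω : Set E3} (hΩ : volume Ω < ∞) {M : ℝ} {d : ℕ → ℝ}
    (hd : Tendsto d atTop (𝓝[>] 0)) {u : ℕ → E3 → ℂ} {u₀ : E3 × E3 → ℂ}
    (hu : ScalarTwoScale Ω M d u u₀) {K : Set E3} (hK : IsCompact K) (hKΩ : K ⊆ Ω)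
    {h : E3 × E3 → ℂ} (hh : IsLayer K h) :
    Tendsto (fun l => ∫ x in Ω, u l x * h (x, fr ((d l)⁻¹ • x))) atTop
      (𝓝 (∫ z, u₀ z * h z ∂((volume.restrict Ω).prod (volume.restrict cellY)))) := by
  have : IsFiniteMeasure (volume.restrict Ω) := ⟨by simpa using hΩ⟩
  obtain ⟨B, hB0, hB⟩ := hh.exists_bound hK
  have hM : 0 ≤ M := (integral_nonneg fun x => by positivity).trans (hu.bound 0)
  -- the limits converge
  have hlim : Tendsto (fun n => ∫ z, u₀ z * (ramp n (Int.fract (z.2 2)) • h (z.1, fr z.2))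
      ∂((volume.restrict Ω).prod (volume.restrict cellY))) atTop
      (𝓝 (∫ z, u₀ z * h z ∂((volume.restrict Ω).prod (volume.restrict cellY)))) := by
    refine tendsto_integral_of_dominated_convergence (fun z => ‖u₀ z‖ * B)
      (fun n => ?_) ?_ (fun n => ae_of_all _ fun z => ?_) ?_
    · exact hu.memLp_lim.1.mul (hh.isOsc_ramp n).cont.aestronglyMeasurable
    · exact ((hu.memLp_lim.integrable (by norm_num)).norm).mul_const _
    · rw [norm_mul, norm_smul]
      have h1 := Int.fract_nonneg (z.2 2)
      have h2 : ‖ramp n (Int.fract (z.2 2))‖ ≤ 1 := by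
        rw [Real.norm_of_nonneg (ramp_nonneg n h1)]; exact ramp_le_one _ _
      have h3 : ‖h (z.1, fr z.2)‖ ≤ B := hB _ _ (by simp [fr])
      gcongr
      calc _ ≤ 1 * B := by gcongr
        _ = B := one_mul _
    · have hint : volume (({0, 1} : Set ℝ)) = 0 := (Set.toFinite _).measure_zero _
      have h1 : ∀ᵐ y ∂(volume.restrict cellY), y 2 ∈ Ioo (0 : ℝ) 1 := by
        filter_upwards [ae_restrict_mem measurableSet_cellY,
          ae_restrict_of_ae (ae_vert_notMem hint)] with y hy hy'
        have := hy 2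
        simp only [mem_insert_iff, mem_singleton_iff, not_or] at hy'
        exact ⟨lt_of_le_of_ne this.1 (Ne.symm hy'.1), lt_of_le_of_ne this.2 hy'.2⟩
      have h2 : ∀ᵐ z ∂((volume.restrict Ω).prod (volume.restrict cellY)),
          z.2 2 ∈ Ioo (0 : ℝ) 1 :=
        Measure.quasiMeasurePreserving_snd.ae h1
      filter_upwards [h2] with z hz
      have hfz : Int.fract (z.2 2) = z.2 2 := Int.fract_eq_self.2 ⟨hz.1.le, hz.2⟩
      have hfr : fr z.2 = z.2 := by simp [fr, hfz]
      rw [hfz, hfr]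
      simpa using ((tendsto_ramp hz.1).smul_const (h z)).const_mul (u₀ z)
  refine tendsto_of_approx fun ε hε => ?_
  -- The Young term with u is at most κM/2 ≤ ε/2; n is then chosen so that the mean of the squared
  -- error is below εκ/2, which makes the other term at most ε/4.
  set κ := ε / (M + 1) with hκd
  have hκ : 0 < κ := by positivity
  set H := ∫ x : E3, (B * thickenedIndicator one_pos K x : ℝ) ^ 2 with hH
  have hE : Tendsto (fun n => (∫ x : E3, ∫ y in cellY,
      ((B * thickenedIndicator one_pos K x *
        (1 - ramp n (min (Int.fract (y 2)) (1 - Int.fract (y 2))))) ^ 2 : ℝ))) atTop (𝓝 0) := by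
    have := tendsto_integral_ramp.const_mul H
    rw [mul_zero] at this
    refine this.congr fun n => ?_
    rw [hH, ← integral_mul_const]
    congr 1 with x
    rw [← integral_const_mul]
    congr 1 with y
    ring
  obtain ⟨n, hn1, hn2⟩ := ((hE.eventually_lt_const (show 0 < ε * κ / 2 by positivity)).and
    (Metric.tendsto_nhds.1 hlim ε hε)).exists
  refine ⟨_, _, hu.tendsto K hKΩ hK _ (hh.isOsc_ramp n), ?_, ?_⟩
  · have hK1 : IsCompact (Metric.cthickening 1 K) := hK.cthickening
    have hav := ((isOsc_error K B n).tendsto_average hK1).comp hd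
    filter_upwards [hav.eventually_lt_const hn1] with l hl
    have hint1 := integrable_norm_sq (hu.memLp l)
    have hint2 := ((isOsc_error K B n).integrable_comp hK1 (g := fun x => (d l)⁻¹ • x)
      (by fun_prop)).integrableOn (s := Ω)
    have hfrm : Measurable fr := by
      have h2 : Measurable fun y : E3 => y 2 := vertL.continuous.measurable
      exact measurableEmbedding_lift.measurable.comp
        (continuous_proj.measurable.prodMk h2.fract)
    have hfr0 : ∀ y, 0 ≤ fr y 2 := fun y => Int.fract_nonneg _
    have hui := (hu.memLp l).integrable (q := 2) (by norm_num)
    have hint3 : IntegrableOn (fun x => u l x * h (x, fr ((d l)⁻¹ • x))) Ω := by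
      refine hui.mul_bdd (c := B) ?_ (ae_of_all _ fun x => hB _ _ (hfr0 _))
      exact (hh.cont.measurable.comp (measurable_id.prodMk
        (hfrm.comp (measurable_const_smul _)))).aestronglyMeasurable
    obtain ⟨B', -, hB'⟩ := (hh.isOsc_ramp n).exists_bound hK
    have hint4 : IntegrableOn (fun x => u l x * (ramp n (Int.fract (((d l)⁻¹ • x) 2)) •
        h (x, fr ((d l)⁻¹ • x)))) Ω := by
      refine hui.mul_bdd (c := B') ?_ (ae_of_all _ fun x => hB' (x, _))
      exact ((hh.isOsc_ramp n).cont.comp (g := fun z => _) (f := fun x => (x, (d l)⁻¹ • x))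
        (by fun_prop)).aestronglyMeasurable
    rw [← integral_sub hint3 hint4]
    refine (norm_integral_le_of_norm_le ((hint1.const_mul (κ / 2)).add
      (hint2.div_const (2 * κ))) (ae_of_all _ fun x => ?_)).trans ?_
    · refine le_trans ?_ (young hκ _ _)
      rw [← mul_sub, norm_mul]
      refine mul_le_mul_of_nonneg_left ?_ (norm_nonneg _)
      set t := Int.fract (((d l)⁻¹ • x) 2)
      have ht0 : 0 ≤ t := Int.fract_nonneg _
      have hr : 0 ≤ 1 - ramp n t := sub_nonneg.2 (ramp_le_one _ _)
      have hr' : 1 - ramp n t ≤ 1 - ramp n (min t (1 - t)) :=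
        sub_le_sub_left (ramp_mono n (min_le_left _ _)) _
      rw [show h (x, fr ((d l)⁻¹ • x)) - ramp n t • h (x, fr ((d l)⁻¹ • x)) =
        (1 - ramp n t) • h (x, fr ((d l)⁻¹ • x)) by rw [sub_smul, one_smul], norm_smul,
        Real.norm_of_nonneg hr]
      by_cases hx : x ∈ K
      · have h1 : (thickenedIndicator one_pos K x : ℝ) = 1 := by
          rw [thickenedIndicator_one one_pos K hx]; rfl
        rw [h1, mul_one, mul_comm]
        exact mul_le_mul (hB _ _ (hfr0 _)) hr' hr hB0
      · rw [hh.zero x hx, norm_zero, mul_zero]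
        have := hr.trans hr'
        positivity
    · have h1 : ∫ x in Ω, (κ / 2 * ‖u l x‖ ^ 2) ≤ κ / 2 * M := by
        rw [integral_const_mul]; exact mul_le_mul_of_nonneg_left (hu.bound l) (by positivity)
      have h2 := setIntegral_le_integral (s := Ω) ((isOsc_error K B n).integrable_comp hK1
        (g := fun x => (d l)⁻¹ • x) (by fun_prop)) (ae_of_all _ fun x => sq_nonneg _)
      have h3 : κ * M ≤ ε := by
        rw [hκd, div_mul_eq_mul_div, div_le_iff₀ (by positivity)]; nlinarith
      simp only [Pi.add_apply]
      rw [integral_add (hint1.const_mul _) (hint2.div_const _), integral_div]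
      have h4 : (∫ x in Ω, (B * thickenedIndicator one_pos K x *
        (1 - ramp n (min (Int.fract (((d l)⁻¹ • x) 2)) (1 - Int.fract (((d l)⁻¹ • x) 2))))) ^ 2)
          / (2 * κ) ≤ ε / 4 := by
        rw [div_le_iff₀ (by positivity)]
        have := h2.trans hl.le
        dsimp only at this
        linarith
      linarith
  · rw [dist_eq_norm] at hn2
    exact hn2.le

/-! ### Green's formula on the sheets, for oscillating test fields -/

/-- `∂_{x_i} f` for `f(x, y)`. -/
def dX (i : Fin 3) (f : E3 × E3 → ℂ) (z : E3 × E3) : ℂ :=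
  fderiv ℝ f z (EuclideanSpace.single i 1, 0)

/-- `∂_{y_i} f` for `f(x, y)`. -/
def dY (i : Fin 3) (f : E3 × E3 → ℂ) (z : E3 × E3) : ℂ :=
  fderiv ℝ f z (0, EuclideanSpace.single i 1)

theorem dY_eq_pderiv {f : E3 × E3 → ℂ} (hf : Differentiable ℝ f) (i : Fin 3) (x y : E3) :
    dY i f (x, y) = pderiv i (fun y => f (x, y)) y := by
  have h := (hf (x, y)).hasFDerivAt.comp y (hasFDerivAt_prodMk_right x y)
  rw [pderiv, show (fun y => f (x, y)) = f ∘ fun y => (x, y) from rfl, h.fderiv]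
  simp [dY]

theorem contDiff_dY {f : E3 × E3 → ℂ} (hf : ContDiff ℝ (⊤ : ℕ∞) f) (i : Fin 3) :
    ContDiff ℝ (⊤ : ℕ∞) (dY i f) :=
  (hf.fderiv_right (m := (⊤ : ℕ∞)) (by simp)).clm_apply contDiff_const

theorem IsLayer.fderiv {K : Set E3} (hK : IsClosed K) {f : E3 × E3 → ℂ} (hf : IsLayer K f)
    (hs : ContDiff ℝ (⊤ : ℕ∞) f) (v : E3 × E3) : IsLayer K fun z => fderiv ℝ f z v where
  cont := (hs.continuous_fderiv (by simp)).clm_apply continuous_const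
  periodic x y i hi := by
    have h : (fun z : E3 × E3 => f (z + (0, EuclideanSpace.single i 1))) = f := by
      funext z
      have := hf.periodic z.1 z.2 i hi
      rwa [show (z.1, z.2 + EuclideanSpace.single i 1) = z + (0, EuclideanSpace.single i 1) from
        Prod.ext (by simp) rfl] at this
    have h2 := fderiv_comp_add_right (𝕜 := ℝ) (f := f) (x := (x, y))
      ((0, EuclideanSpace.single i 1) : E3 × E3)
    rw [h] at h2
    rw [h2]
    simp
  zero x hx y := by
    have : f =ᶠ[𝓝 (x, y)] fun _ => 0 := by
      filter_upwards [(hK.isOpen_compl.preimage continuous_fst).mem_nhds hx] with z hz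
      exact hf.zero z.1 hz z.2
    rw [this.fderiv_eq]; simp
  top x y hy := by
    have : f =ᶠ[𝓝 (x, y)] fun _ => 0 := by
      have ho : IsOpen {z : E3 × E3 | 1 / 2 < z.2 2} :=
        isOpen_lt continuous_const (by fun_prop)
      filter_upwards [ho.mem_nhds hy] with z hz
      exact hf.top z.1 z.2 hz
    rw [this.fderiv_eq]; simp

/-- The scalar form of Green's formula above a sheet, for the component `u_j`, `j ≠ 2`. -/
def IsScalarTrace (S : Set E2) (L s : ℝ) (j : Fin 3) (v uj u2 : E3 → ℂ) (g : E2 → ℂ) : Prop :=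
  ∀ f : E3 → ℂ, IsTest (cyl S L) f →
    ∫ x in cyl S L ∩ {x | s < x 2}, (v x * f x - uj x * pderiv 2 f x + u2 x * pderiv j f x) =
      ∫ x' in S, g x' * f (lift x' s)

theorem pderiv_component {Φ : E3 → C3} {x : E3} (h : DifferentiableAt ℝ Φ x) (j i : Fin 3) :
    pderiv j Φ x i = pderiv j (fun x => Φ x i) x := by
  have := (hasFDerivAt_pi'.1 h.hasFDerivAt) i
  rw [pderiv, pderiv, this.fderiv]; rfl

theorem IsTest.smul_const {V : Type*} [NormedAddCommGroup V] [NormedSpace ℝ V] {U : Set V}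
    {f : V → ℂ} (hf : IsTest U f) (c : C3) : IsTest U fun x => f x • c :=
  ⟨hf.1.smul contDiff_const, hf.2.1.smul_right,
    (closure_mono (Function.support_smul_subset_left f _)).trans hf.2.2⟩

theorem curl_smul_const {f : E3 → ℂ} {x : E3} (hf : DifferentiableAt ℝ f x) (c : C3) :
    curl (fun x => f x • c) x = ![pderiv 1 f x * c 2 - pderiv 2 f x * c 1,
      pderiv 2 f x * c 0 - pderiv 0 f x * c 2, pderiv 0 f x * c 1 - pderiv 1 f x * c 0] := by
  have h : ∀ j i, pderiv j (fun x => f x • c) x i = pderiv j f x * c i := fun j i => by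
    rw [pderiv_component (hf.smul_const c)]
    simp only [pderiv, Pi.smul_apply, smul_eq_mul]
    rw [fderiv_mul_const hf]
    simp [mul_comm]
  simp only [curl, h]

/-- Since -e₃ × g = (g₁, -g₀, 0) with components counted from 0, testing Green's formula with f
times the first basis vector isolates g₁. -/
theorem IsSheetTrace.scalar_one {S : Set E2} {L s : ℝ} {u w : E3 → C3} {g : E2 → C3}
    (h : IsSheetTrace S L s u w g) :
    IsScalarTrace S L s 1 (fun x => w x 0) (fun x => u x 1) (fun x => u x 2) (fun x => g x 1) := by
  intro f hf
  have := h.green _ (hf.smul_const ![1, 0, 0])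
  have hd : Differentiable ℝ f := hf.1.differentiable (by simp)
  simp only [curl_smul_const hd.differentiableAt] at this
  convert this using 3 with x x
  · simp [dotProduct, Fin.sum_univ_three]; ring
  · simp [dotProduct, Fin.sum_univ_three, cross_apply, e3]

/-- As for the other component, with -f times the second basis vector, which isolates g₀ with a
positive sign. -/
theorem IsSheetTrace.scalar_zero {S : Set E2} {L s : ℝ} {u w : E3 → C3} {g : E2 → C3}
    (h : IsSheetTrace S L s u w g) :
    IsScalarTrace S L s 0 (fun x => -w x 1) (fun x => u x 0) (fun x => u x 2)
      (fun x => g x 0) := by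
  intro f hf
  have := h.green _ (hf.smul_const ![0, -1, 0])
  have hd : Differentiable ℝ f := hf.1.differentiable (by simp)
  simp only [curl_smul_const hd.differentiableAt] at this
  convert this using 3 with x x
  · simp [dotProduct, Fin.sum_univ_three]; ring
  · simp [dotProduct, Fin.sum_univ_three, cross_apply, e3]

/-! ### Summation of Green's formula over the sheets. -/

section
variable {S : Set E2} {L d : ℝ} {K : Set E3} {f : E3 × E3 → ℂ}

/-- The fast variable seen from the `k`-th sheet. -/
def fromSheet (d : ℝ) (k : ℤ) (x : E3) : E3 := d⁻¹ • x - lift 0 k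

@[fun_prop] theorem continuous_fromSheet (d : ℝ) (k : ℤ) : Continuous (fromSheet d k) := by
  unfold fromSheet; fun_prop

theorem fromSheet_lift (hd : 0 < d) (k : ℤ) (x' : E2) :
    fromSheet d k (lift x' (k * d)) = lift (d⁻¹ • x') 0 :=
  E3_ext (by simp [fromSheet]) (by simp [fromSheet]) (by simp [fromSheet]; field_simp; simp)

theorem IsLayer.isTest_fromSheet {U : Set E3} (hK : IsCompact K) (hKU : K ⊆ U) (hf : IsLayer K f)
    (hs : ContDiff ℝ (⊤ : ℕ∞) f) (d : ℝ) (k : ℤ) : IsTest U fun x => f (x, fromSheet d k x) := by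
  refine ⟨hs.comp ?_, HasCompactSupport.intro hK fun x hx => hf.zero x hx _, ?_⟩
  · unfold fromSheet
    fun_prop
  · refine (closure_minimal ?_ hK.isClosed).trans hKU
    intro x hx
    by_contra h
    exact hx (hf.zero x h _)

theorem pderiv_fromSheet (hs : ContDiff ℝ (⊤ : ℕ∞) f) (d : ℝ) (k : ℤ) (i : Fin 3) (x : E3) :
    pderiv i (fun x => f (x, fromSheet d k x)) x =
      dX i f (x, fromSheet d k x) + d⁻¹ * dY i f (x, fromSheet d k x) := by
  have hd : Differentiable ℝ f := hs.differentiable (by simp)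
  have h1 : HasFDerivAt (fromSheet d k) (d⁻¹ • ContinuousLinearMap.id ℝ E3) x :=
    ((hasFDerivAt_id x).const_smul d⁻¹).sub_const _
  have h2 := (hd (x, fromSheet d k x)).hasFDerivAt.comp x ((hasFDerivAt_id x).prodMk h1)
  rw [pderiv, show (fun x => f (x, fromSheet d k x)) = f ∘ fun x => (id x, fromSheet d k x)
    from rfl, h2.fderiv, dX, dY, ContinuousLinearMap.comp_apply, ContinuousLinearMap.prod_apply]
  rw [← Complex.real_smul, ← map_smul, ← map_add]
  simp

theorem integrable_mul_fromSheet {u : E3 → ℂ} (hK : IsCompact K)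
    (hf : IsLayer K f) {U : Set E3} (hU : volume U < ∞) (hu : MemLp u 2 (volume.restrict U)) (d : ℝ)
    (k : ℤ) : IntegrableOn (fun x => u x * f (x, fromSheet d k x)) U := by
  have : IsFiniteMeasure (volume.restrict U) := ⟨by simpa using hU⟩
  have hc : Continuous fun x => f (x, fromSheet d k x) := hf.cont.comp (by fun_prop)
  obtain ⟨B, hB⟩ := hc.bounded_above_of_compact_support
    (HasCompactSupport.intro hK fun x hx => hf.zero x hx _)
  exact (hu.integrable (by norm_num)).mul_bdd (c := B) hc.aestronglyMeasurable (ae_of_all _ hB)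

/-- Each test field lives within half a period above its own sheet, so at a point x only the sheet
directly below, k = ⌊x₃/d⌋, contributes; seen from it, the fast variable is x/d with its height
reduced modulo one. -/
theorem sum_layers_fromSheet (hSb : Bornology.IsBounded S) (hd : 0 < d)
    (hK : IsCompact K) (hfl : ∀ x ∈ K, ⌊x 2 / d⌋ ∈ layers L d) (hf : IsLayer K f) {u : E3 → ℂ}
    (hu : MemLp u 2 (volume.restrict (cyl S L))) :
    ∑ k ∈ layers L d, ∫ x in cyl S L ∩ {x | k * d < x 2}, u x * f (x, fromSheet d k x) =
      ∫ x in cyl S L, u x * f (x, fr (d⁻¹ • x)) := by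
  have hm : ∀ k : ℤ, MeasurableSet {x : E3 | k * d < x 2} := fun k =>
    (isOpen_lt continuous_const (by fun_prop)).measurableSet
  simp_rw [fun k : ℤ => (setIntegral_indicator (μ := volume) (s := cyl S L)
    (f := fun x => u x * f (x, fromSheet d k x)) (hm k)).symm]
  rw [← integral_finsetSum _ fun k _ =>
    (integrable_mul_fromSheet hK hf (volume_cyl_lt_top hSb L) hu d k).integrable.indicator (hm k)]
  -- The domains above the sheets are open, so points lying exactly on a sheet are excluded as a
  -- null set.
  have hnull : volume (range fun k : ℤ => (k : ℝ) * d) = 0 := (countable_range _).measure_zero _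
  refine integral_congr_ae ?_
  filter_upwards [ae_restrict_of_ae (ae_vert_notMem hnull)] with x hx
  by_cases hxK : x ∈ K
  swap
  · simp [indicator_apply, hf.zero x hxK]
  have hf1 := Int.floor_le (x 2 / d)
  have hf2 := Int.lt_floor_add_one (x 2 / d)
  rw [Finset.sum_eq_single_of_mem _ (hfl x hxK)]
  · rw [indicator_of_mem]
    · congr 2
      refine Prod.ext rfl (E3_ext (by simp [fromSheet, fr]) (by simp [fromSheet, fr]) ?_)
      simp [fromSheet, fr, ← Int.self_sub_floor, div_eq_inv_mul]
    · rw [le_div_iff₀ hd] at hf1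
      exact lt_of_le_of_ne hf1 fun h => hx ⟨_, h⟩
  · intro k _ hk
    -- From a lower sheet x is at least one period away, beyond the height where f lives; a higher
    -- sheet is not below x.
    rcases lt_or_gt_of_ne hk with hk | hk
    · rw [indicator_apply]
      split_ifs
      · rw [hf.top, mul_zero]
        have : (k : ℝ) + 1 ≤ ⌊x 2 / d⌋ := by exact_mod_cast hk
        simp only [fromSheet, PiLp.sub_apply, PiLp.smul_apply, smul_eq_mul, lift_two,
          ← div_eq_inv_mul]
        linarith
      · rfl
    · rw [indicator_of_notMem]
      simp only [mem_ofPred_eq, not_lt]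
      have : (⌊x 2 / d⌋ : ℝ) + 1 ≤ k := by exact_mod_cast hk
      exact ((div_lt_iff₀ hd).1 (hf2.trans_le this)).le

/-- By the chain rule a derivative of the test field is a slow derivative plus 1/d times a fast one;
the factor d cancels the 1/d and makes the other terms small. -/
theorem mul_sum_layers_trace (hSb : Bornology.IsBounded S) (hd : 0 < d)
    (hK : IsCompact K) (hKS : K ⊆ cyl S L) (hfl : ∀ x ∈ K, ⌊x 2 / d⌋ ∈ layers L d)
    (hf : IsLayer K f) (hs : ContDiff ℝ (⊤ : ℕ∞) f) {j : Fin 3} {v uj u2 g : E3 → ℂ}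
    (hv : MemLp v 2 (volume.restrict (cyl S L))) (huj : MemLp uj 2 (volume.restrict (cyl S L)))
    (hu2 : MemLp u2 2 (volume.restrict (cyl S L)))
    (hg : ∀ k ∈ layers L d, IsScalarTrace S L (k * d) j v uj u2 fun x' => g (lift x' (k * d))) :
    (d : ℂ) * ∑ k ∈ layers L d, ∫ x' in S, g (lift x' (k * d)) *
        f (lift x' (k * d), lift (d⁻¹ • x') 0) =
      d * ((∫ x in cyl S L, v x * f (x, fr (d⁻¹ • x))) -
        (∫ x in cyl S L, uj x * dX 2 f (x, fr (d⁻¹ • x))) +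
        ∫ x in cyl S L, u2 x * dX j f (x, fr (d⁻¹ • x))) -
      (∫ x in cyl S L, uj x * dY 2 f (x, fr (d⁻¹ • x))) +
      ∫ x in cyl S L, u2 x * dY j f (x, fr (d⁻¹ • x)) := by
  have hX : ∀ i, IsLayer K (dX i f) := fun i => hf.fderiv hK.isClosed hs (EuclideanSpace.single i 1, 0)
  have hY : ∀ i, IsLayer K (dY i f) := fun i => hf.fderiv hK.isClosed hs (0, EuclideanSpace.single i 1)
  have hvol := volume_cyl_lt_top hSb L
  have hsum := fun (u : E3 → ℂ) (hu : MemLp u 2 (volume.restrict (cyl S L)))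
    (h : E3 × E3 → ℂ) (hh : IsLayer K h) =>
    (sum_layers_fromSheet hSb hd hK hfl hh hu).symm
  rw [hsum v hv _ hf, hsum uj huj _ (hX 2), hsum u2 hu2 _ (hX j), hsum uj huj _ (hY 2),
    hsum u2 hu2 _ (hY j), ← Finset.sum_sub_distrib, ← Finset.sum_add_distrib, Finset.mul_sum,
    Finset.mul_sum, ← Finset.sum_sub_distrib, ← Finset.sum_add_distrib]
  refine Finset.sum_congr rfl fun k hk => ?_
  have h := hg k hk _ (hf.isTest_fromSheet hK hKS hs d k)
  simp only [fromSheet_lift hd, pderiv_fromSheet hs] at h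
  rw [← h]
  have hint := fun (u : E3 → ℂ) (hu : MemLp u 2 (volume.restrict (cyl S L)))
    (h : E3 × E3 → ℂ) (hh : IsLayer K h) =>
    (integrable_mul_fromSheet hK hh hvol hu d k).mono_set
      (inter_subset_left (t := {x : E3 | k * d < x 2}))
  have i1 := hint v hv _ hf
  have i2 := hint uj huj _ (hX 2)
  have i3 := hint u2 hu2 _ (hX j)
  have i4 := hint uj huj _ (hY 2)
  have i5 := hint u2 hu2 _ (hY j)
  set m := (volume : Measure E3).restrict (cyl S L ∩ {x | k * d < x 2})
  have i12 : Integrable (fun x => v x * f (x, fromSheet d k x) -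
    uj x * dX 2 f (x, fromSheet d k x)) m := i1.sub i2
  have i13 : Integrable (fun x => d * (v x * f (x, fromSheet d k x) -
    uj x * dX 2 f (x, fromSheet d k x) + u2 x * dX j f (x, fromSheet d k x))) m :=
    (i12.add i3).const_mul (d : ℂ)
  have i14 : Integrable (fun x => d * (v x * f (x, fromSheet d k x) -
    uj x * dX 2 f (x, fromSheet d k x) + u2 x * dX j f (x, fromSheet d k x)) -
    uj x * dY 2 f (x, fromSheet d k x)) m := i13.sub i4
  rw [← integral_sub i1 i2, ← integral_add i12 i3, ← integral_const_mul,
    ← integral_const_mul, ← integral_sub i13 i4, ← integral_add i14 i5]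
  congr 1 with x
  have : (d : ℂ) ≠ 0 := by exact_mod_cast hd.ne'
  rw [Complex.ofReal_inv]
  field_simp
  ring

end

/-- The terms with prefactor d vanish: boundedness suffices for the curl component v, for which no
limit is assumed. The fast derivatives are layer fields again, and their integrals converge by
`ScalarTwoScale.tendsto_layer`. -/
theorem tendsto_sheets_layer {S : Set E2} (hSb : Bornology.IsBounded S) {L M : ℝ}
    {d : ℕ → ℝ} (hd : Tendsto d atTop (𝓝[>] 0)) (hd0 : ∀ l, 0 < d l) {v uj u2 g : ℕ → E3 → ℂ}
    {uj₀ u2₀ : E3 × E3 → ℂ} {j : Fin 3} (huj : ScalarTwoScale (cyl S L) M d uj uj₀)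
    (hu2 : ScalarTwoScale (cyl S L) M d u2 u2₀)
    (hv : ∀ l, MemLp (v l) 2 (volume.restrict (cyl S L)))
    (hvM : ∀ l, ∫ x in cyl S L, ‖v l x‖ ^ 2 ≤ M)
    (hg : ∀ l, ∀ k ∈ layers L (d l), IsScalarTrace S L (k * d l) j (v l) (uj l) (u2 l)
      fun x' => g l (lift x' (k * d l)))
    {K : Set E3} (hK : IsCompact K) (hKS : K ⊆ cyl S L) {f : E3 × E3 → ℂ}
    (hf : IsLayer K f) (hs : ContDiff ℝ (⊤ : ℕ∞) f) :
    Tendsto (fun l => (d l : ℂ) * ∑ k ∈ layers L (d l), ∫ x' in S, g l (lift x' (k * d l)) *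
        f (lift x' (k * d l), lift ((d l)⁻¹ • x') 0)) atTop
      (𝓝 (-(∫ z, uj₀ z * dY 2 f z ∂((volume.restrict (cyl S L)).prod (volume.restrict cellY))) +
        ∫ z, u2₀ z * dY j f z ∂((volume.restrict (cyl S L)).prod (volume.restrict cellY)))) := by
  have hX : ∀ i, IsLayer K (dX i f) := fun i => hf.fderiv hK.isClosed hs (EuclideanSpace.single i 1, 0)
  have hY : ∀ i, IsLayer K (dY i f) := fun i => hf.fderiv hK.isClosed hs (0, EuclideanSpace.single i 1)
  have hvol := volume_cyl_lt_top hSb L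
  have t2 := huj.tendsto_layer hvol hd hK hKS (hX 2)
  have t3 := hu2.tendsto_layer hvol hd hK hKS (hX j)
  have t4 := huj.tendsto_layer hvol hd hK hKS (hY 2)
  have t5 := hu2.tendsto_layer hvol hd hK hKS (hY j)
  have hdc : Tendsto (fun l => (d l : ℂ)) atTop (𝓝 0) := by
    have := (Complex.continuous_ofReal.tendsto 0).comp (hd.mono_right nhdsWithin_le_nhds)
    rwa [Complex.ofReal_zero] at this
  have t1 : Tendsto (fun l => (d l : ℂ) * ∫ x in cyl S L, v l x * f (x, fr ((d l)⁻¹ • x))) atTop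
      (𝓝 0) := by
    obtain ⟨B, hB0, hB⟩ := hf.exists_bound hK
    refine squeeze_zero_norm (a := fun l => d l * (1 / 2 * M + B ^ 2 / 2 * volume.real (cyl S L)))
      (fun l => ?_) ?_
    · rw [norm_mul, Complex.norm_real, Real.norm_of_nonneg (hd0 l).le]
      refine mul_le_mul_of_nonneg_left ?_ (hd0 l).le
      have hint := (integrable_norm_sq (hv l)).const_mul (1 / 2)
      have hc : IntegrableOn (fun _ : E3 => B ^ 2 / 2) (cyl S L) := integrableOn_const hvol.ne
      refine (norm_integral_le_of_norm_le (hint.add hc) (ae_of_all _ fun x => ?_)).trans ?_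
      · have h1 := young one_pos ‖v l x‖ B
        rw [norm_mul]
        have h2 : ‖f (x, fr ((d l)⁻¹ • x))‖ ≤ B := hB _ _ (Int.fract_nonneg _)
        have := mul_le_mul_of_nonneg_left h2 (norm_nonneg (v l x))
        simp only [Pi.add_apply]
        linarith
      · simp only [Pi.add_apply]
        rw [integral_add hint hc, integral_const_mul, setIntegral_const, smul_eq_mul]
        have := hvM l
        linarith
    · simpa using (hd.mono_right nhdsWithin_le_nhds).mul_const _
  have key := ((t1.sub (hdc.mul t2)).add (hdc.mul t3)).sub t4 |>.add t5
  simp only [zero_mul, sub_zero, add_zero, zero_sub] at key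
  obtain ⟨δ, hδ, hfl⟩ := exists_floor_mem_layers hK hKS
  refine key.congr' ?_
  filter_upwards [(hd.mono_right nhdsWithin_le_nhds).eventually_lt_const hδ] with l hl
  rw [mul_sum_layers_trace hSb (hd0 l) hK hKS (hfl _ (hd0 l) hl) hf hs (hv l) (huj.memLp l)
    (hu2.memLp l) (hg l)]
  simp only [dX, dY]
  ring

/-! ### The two-scale limit of the tangential traces -/

/-- The bound makes T factor through the range of R as a continuous functional; Hahn–Banach extends
it to H and Riesz represents it. -/
theorem exists_inner_repr {V H : Type*} [AddCommGroup V] [Module ℂ V] [NormedAddCommGroup H]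
    [InnerProductSpace ℂ H] [CompleteSpace H] (R : V →ₗ[ℂ] H) (T : V →ₗ[ℂ] ℂ) (C : ℝ)
    (h : ∀ v, ‖T v‖ ≤ C * ‖R v‖) : ∃ g : H, ∀ v, T v = inner ℂ g (R v) := by
  -- A purely algebraic linear section is enough, because the bound makes T ∘ s continuous whatever
  -- s is.
  obtain ⟨s, hs⟩ := R.rangeRestrict.exists_rightInverse_of_surjective R.range_rangeRestrict
  have hsR : ∀ w : R.range, R (s w) = w := fun w => by
    have := LinearMap.congr_fun hs w
    exact congrArg Subtype.val this
  let f : StrongDual ℂ R.range := (T ∘ₗ s).mkContinuous C fun w => by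
    have := h (s w)
    rw [hsR] at this
    exact this
  obtain ⟨F, hF, -⟩ := exists_extension_norm_eq R.range f
  refine ⟨(InnerProductSpace.toDual ℂ H).symm F, fun v => ?_⟩
  rw [InnerProductSpace.toDual_symm_apply]
  have h1 := hF ⟨R v, LinearMap.mem_range_self R v⟩
  -- The difference lies in the kernel of R, on which the bound forces T to vanish.
  have h2 : T (s ⟨R v, LinearMap.mem_range_self R v⟩ - v) = 0 := by
    have := h (s ⟨R v, LinearMap.mem_range_self R v⟩ - v)
    rw [map_sub R, hsR, sub_self, norm_zero, mul_zero] at this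
    exact norm_le_zero_iff.1 this
  rw [map_sub, sub_eq_zero] at h2
  rw [h1, ← h2]
  rfl

theorem exists_inner_repr_of_tendsto {V H : Type*} [AddCommGroup V] [Module ℂ V]
    [NormedAddCommGroup H] [InnerProductSpace ℂ H] [CompleteSpace H] (R : V →ₗ[ℂ] H)
    (a : ℕ → V →ₗ[ℂ] ℂ) (ha : ∀ v, ∃ t, Tendsto (fun l => a l v) atTop (𝓝 t)) (C : ℝ)
    (hC : ∀ v t, Tendsto (fun l => a l v) atTop (𝓝 t) → ‖t‖ ≤ C * ‖R v‖) :
    ∃ g : H, ∀ v, Tendsto (fun l => a l v) atTop (𝓝 (inner ℂ g (R v))) := by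
  choose T hT using ha
  obtain ⟨g, hg⟩ := exists_inner_repr R
    { toFun := T
      map_add' := fun v w => tendsto_nhds_unique (hT (v + w)) (by
        simpa using (hT v).add (hT w))
      map_smul' := fun c v => tendsto_nhds_unique (hT (c • v)) (by
        simpa using (hT v).const_mul c) } C fun v => hC v _ (hT v)
  refine ⟨g, fun v => ?_⟩
  rw [← hg v]
  exact hT v

/-- The optimal choice is κ = N / √M; if N = 0, let κ tend to 0. -/
theorem le_sqrt_mul_of_young {t M N : ℝ} (hM : 0 < M) (hN : 0 ≤ N)
    (h : ∀ κ > 0, t ≤ κ / 2 * M + N ^ 2 / (2 * κ)) : t ≤ √M * N := by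
  rcases hN.eq_or_lt with rfl | hN
  · rw [mul_zero]
    refine le_of_forall_pos_le_add fun ε hε => ?_
    refine (h (2 * ε / M) (by positivity)).trans_eq ?_
    field_simp
    ring
  · have hs : 0 < √M := Real.sqrt_pos.2 hM
    refine (h (N / √M) (by positivity)).trans_eq ?_
    have := Real.sq_sqrt hM.le
    field_simp
    rw [this]; ring

/-- A sequence of fields with bounded curls and traces on the sheets, in scalar form: `uj`, `u2` are
components of the fields, `v` is a component of the curls, and `g` a component of the traces. -/
structure SheetSequence (S : Set E2) (L M : ℝ) (d : ℕ → ℝ) (j : Fin 3) (v uj u2 g : ℕ → E3 → ℂ)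
    (uj₀ u2₀ : E3 × E3 → ℂ) : Prop where
  bounded : Bornology.IsBounded S
  pos : 0 < M
  d_pos : ∀ l, 0 < d l
  d_lim : Tendsto d atTop (𝓝[>] 0)
  twoScale_uj : ScalarTwoScale (cyl S L) M d uj uj₀
  twoScale_u2 : ScalarTwoScale (cyl S L) M d u2 u2₀
  v_memLp : ∀ l, MemLp (v l) 2 (volume.restrict (cyl S L))
  v_bound : ∀ l, ∫ x in cyl S L, ‖v l x‖ ^ 2 ≤ M
  trace : ∀ l, ∀ k ∈ layers L (d l), IsScalarTrace S L (k * d l) j (v l) (uj l) (u2 l)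
      fun x' => g l (lift x' (k * d l))
  g_memLp : ∀ l, ∀ k ∈ layers L (d l),
    MemLp (fun x' => g l (lift x' (k * d l))) 2 (volume.restrict S)
  g_bound : ∀ l, d l * ∑ k ∈ layers L (d l), ∫ x' in S, ‖g l (lift x' (k * d l))‖ ^ 2 ≤ M

/-- The pairing of `g` with `f(x, x/d)` on the sheets. -/
def sheetPairing (S : Set E2) (L d : ℝ) (g : E3 → ℂ) (f : E3 × E3 → ℂ) : ℂ :=
  d * ∑ k ∈ layers L d, ∫ x' in S, g (lift x' (k * d)) * f (lift x' (k * d), lift (d⁻¹ • x') 0)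

theorem norm_sheetPairing_le {S : Set E2} {L d : ℝ} (hd : 0 < d) {g : E3 → ℂ} {f : E3 × E3 → ℂ}
    (hg : ∀ k ∈ layers L d, MemLp (fun x' => g (lift x' (k * d))) 2 (volume.restrict S))
    (hf : ∀ k ∈ layers L d, MemLp (fun x' => f (lift x' (k * d), lift (d⁻¹ • x') 0)) 2
      (volume.restrict S)) {κ : ℝ} (hκ : 0 < κ) :
    ‖sheetPairing S L d g f‖ ≤
      κ / 2 * (d * ∑ k ∈ layers L d, ∫ x' in S, ‖g (lift x' (k * d))‖ ^ 2) +
      (d * ∑ k ∈ layers L d, ∫ x' in S, ‖f (lift x' (k * d), lift (d⁻¹ • x') 0)‖ ^ 2) /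
        (2 * κ) := by
  rw [sheetPairing, norm_mul, Complex.norm_real, Real.norm_of_nonneg hd.le, mul_left_comm,
    mul_div_assoc, ← mul_add, Finset.mul_sum, Finset.sum_div, ← Finset.sum_add_distrib]
  refine mul_le_mul_of_nonneg_left ((norm_sum_le _ _).trans (Finset.sum_le_sum fun k hk => ?_)) hd.le
  have h1 := (integrable_norm_sq (hg k hk)).const_mul (κ / 2)
  have h2 := (integrable_norm_sq (hf k hk)).div_const (2 * κ)
  rw [← integral_const_mul, ← integral_div, ← integral_add h1 h2]
  refine norm_integral_le_of_norm_le (h1.add h2) (ae_of_all _ fun x' => ?_)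
  rw [norm_mul]
  exact young hκ _ _

/-- With y₃ frozen at 0 the dependence on the height disappears, so horizontal periodicity becomes
full periodicity. -/
theorem IsLayer.flat {W : Type*} [NormedAddCommGroup W] {K : Set E3} {f : E3 × E3 → W}
    (hf : IsLayer K f) : IsOsc K fun z : E3 × E3 => f (z.1, lift (proj z.2) 0) where
  cont := hf.cont.comp (by fun_prop)
  periodic x y i := by
    by_cases hi : i = 2
    · subst hi
      congr 2
      exact E3_ext (by simp) (by simp) (by simp)
    · rw [← hf.periodic x (lift (proj y) 0) i hi]
      congr 2
      refine E3_ext (by simp) (by simp) ?_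
      simp [Ne.symm hi]
  zero x hx y := hf.zero x hx _

theorem IsOsc.norm_sq {W : Type*} [NormedAddCommGroup W] {K : Set E3} {f : E3 × E3 → W}
    (hf : IsOsc K f) : IsOsc K fun z : E3 × E3 => ‖f z‖ ^ 2 where
  cont := hf.cont.norm.pow 2
  periodic x y i := by simp only [hf.periodic x y i]
  zero x hx y := by simp [hf.zero x hx]

theorem IsOsc.memLp_trace {S : Set E2} (hSb : Bornology.IsBounded S) {K : Set E3} (hK : IsCompact K)
    {f : E3 × E3 → ℂ} (hf : IsOsc K f) (d : ℝ) (s : ℝ) :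
    MemLp (fun x' => f (lift x' s, lift (d⁻¹ • x') 0)) 2 (volume.restrict S) := by
  have : IsFiniteMeasure (volume.restrict S) := ⟨by simpa using hSb.measure_lt_top⟩
  obtain ⟨B, -, hB⟩ := hf.exists_bound hK
  exact MemLp.of_bound (hf.cont.comp (g := f) (by fun_prop)).aestronglyMeasurable B
    (ae_of_all _ fun x => hB _)

/-- Smooth layer fields with compact support in `Ω` in the slow variable. -/
def layerSpace (Ω : Set E3) : Submodule ℂ (E3 × E3 → ℂ) where
  carrier := {f | ContDiff ℝ (⊤ : ℕ∞) f ∧ ∃ K, IsCompact K ∧ K ⊆ Ω ∧ IsLayer K f}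
  zero_mem' := ⟨contDiff_const, ∅, isCompact_empty, empty_subset _, continuous_const,
    by simp, by simp, by simp⟩
  add_mem' := by
    rintro f g ⟨hf, K, hK, hKΩ, hfK⟩ ⟨hg, K', hK', hKΩ', hgK⟩
    refine ⟨hf.add hg, K ∪ K', hK.union hK', union_subset hKΩ hKΩ', hfK.cont.add hgK.cont, ?_, ?_, ?_⟩
    · intro x y i hi
      simp [hfK.periodic x y i hi, hgK.periodic x y i hi]
    · intro x hx y
      simp [hfK.zero x (fun h => hx (Or.inl h)) y, hgK.zero x (fun h => hx (Or.inr h)) y]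
    · intro x y hy
      simp [hfK.top x y hy, hgK.top x y hy]
  smul_mem' := by
    rintro c f ⟨hf, K, hK, hKΩ, hfK⟩
    refine ⟨hf.const_smul c, K, hK, hKΩ, hfK.cont.const_smul c, ?_, ?_, ?_⟩
    · intro x y i hi
      simp [hfK.periodic x y i hi]
    · intro x hx y
      simp [hfK.zero x hx y]
    · intro x y hy
      simp [hfK.top x y hy]

/-- The measure on `Ω × Σ₀`. -/
def surfMeasure (Ω : Set E3) : Measure (E3 × E2) :=
  (volume.restrict Ω).prod (volume.restrict cellY2)

theorem isFiniteMeasure_surfMeasure {Ω : Set E3} (hΩ : volume Ω < ∞) :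
    IsFiniteMeasure (surfMeasure Ω) := by
  have : IsFiniteMeasure (volume.restrict Ω) := ⟨by simpa using hΩ⟩
  unfold surfMeasure; infer_instance

theorem IsOsc.memLp_surf {Ω : Set E3} (hΩ : volume Ω < ∞) {K : Set E3} (hK : IsCompact K)
    {f : E3 × E3 → ℂ} (hf : IsOsc K f) :
    MemLp (fun z : E3 × E2 => f (z.1, lift z.2 0)) 2 (surfMeasure Ω) := by
  have := isFiniteMeasure_surfMeasure hΩ
  obtain ⟨B, -, hB⟩ := hf.exists_bound hK
  exact MemLp.of_bound (hf.cont.comp (g := f) (by fun_prop)).aestronglyMeasurable B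
    (ae_of_all _ fun x => hB _)

theorem IsLayer.memLp_surf {Ω : Set E3} (hΩ : volume Ω < ∞) {K : Set E3} (hK : IsCompact K)
    {f : E3 × E3 → ℂ} (hf : IsLayer K f) :
    MemLp (fun z : E3 × E2 => f (z.1, lift z.2 0)) 2 (surfMeasure Ω) := by
  simpa using hf.flat.memLp_surf hΩ hK

theorem IsOsc.tendsto_sheets_norm_sq {S : Set E2} (hSb : Bornology.IsBounded S) {L : ℝ}
    {K : Set E3} (hK : IsCompact K) (hKS : K ⊆ cyl S L) {f : E3 × E3 → ℂ} (hf : IsOsc K f) :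
    Tendsto (fun d : ℝ => d * ∑ k ∈ layers L d, ∫ x' in S,
        ‖f (lift x' (k * d), lift (d⁻¹ • x') 0)‖ ^ 2) (𝓝[>] 0)
      (𝓝 (∫ z, ‖f (z.1, lift z.2 0)‖ ^ 2 ∂(surfMeasure (cyl S L)))) := by
  have h := hf.norm_sq.tendsto_sheets hSb hK hKS
  rw [surfMeasure, integral_prod _
    (integrable_norm_sq (hf.memLp_surf (volume_cyl_lt_top hSb L) hK))]
  exact h

theorem norm_sq_toLp {X : Type*} [MeasurableSpace X] {m : Measure X} {f : X → ℂ}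
    (hf : MemLp f 2 m) : ‖hf.toLp f‖ ^ 2 = ∫ x, ‖f x‖ ^ 2 ∂m := by
  have h1 : Integrable (fun x => inner ℂ (hf.toLp f x) (hf.toLp f x)) m :=
    L2.integrable_inner _ _
  rw [← inner_self_eq_norm_sq (𝕜 := ℂ), L2.inner_def, ← integral_re h1]
  refine integral_congr_ae ?_
  filter_upwards [hf.coeFn_toLp] with x hx
  rw [hx, inner_self_eq_norm_sq]

/-- Green's formula gives convergence on smooth layer fields. By the bound on the traces and the
averaging of |f|² on the sheets, the limit is at most √M times the L² norm of f on Ω × Σ₀, so it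
depends only on that trace and is represented by an L² function. -/
theorem SheetSequence.exists_limit {S : Set E2} {L M : ℝ} {d : ℕ → ℝ} {j : Fin 3}
    {v uj u2 g : ℕ → E3 → ℂ} {uj₀ u2₀ : E3 × E3 → ℂ}
    (h : SheetSequence S L M d j v uj u2 g uj₀ u2₀) :
    ∃ G : E3 × E2 → ℂ, StronglyMeasurable G ∧ MemLp G 2 (surfMeasure (cyl S L)) ∧
      ∀ K f, IsCompact K → K ⊆ cyl S L → IsLayer K f → ContDiff ℝ (⊤ : ℕ∞) f →
        Tendsto (fun l => sheetPairing S L (d l) (g l) f) atTop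
          (𝓝 (∫ z, G z * f (z.1, lift z.2 0) ∂(surfMeasure (cyl S L)))) := by
  have hvol := volume_cyl_lt_top h.bounded L
  have hmem : ∀ f : layerSpace (cyl S L),
      MemLp (fun z : E3 × E2 => f.1 (z.1, lift z.2 0)) 2 (surfMeasure (cyl S L)) := fun f => by
    obtain ⟨-, K, hK, -, hf⟩ := f.2
    exact hf.memLp_surf hvol hK
  have htr : ∀ (f : layerSpace (cyl S L)) (l : ℕ) (s : ℝ),
      MemLp (fun x' => f.1 (lift x' s, lift ((d l)⁻¹ • x') 0)) 2 (volume.restrict S) := by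
    intro f l s
    obtain ⟨-, K, hK, -, hf⟩ := f.2
    simpa using hf.flat.memLp_trace h.bounded hK (d l) s
  let R : layerSpace (cyl S L) →ₗ[ℂ] Lp ℂ 2 (surfMeasure (cyl S L)) :=
    { toFun := fun f => (hmem f).toLp _
      map_add' := fun f g => by rw [← MemLp.toLp_add]; rfl
      map_smul' := fun c f => by rw [RingHom.id_apply, ← MemLp.toLp_const_smul]; rfl }
  let a : ℕ → layerSpace (cyl S L) →ₗ[ℂ] ℂ := fun l =>
    { toFun := fun f => sheetPairing S L (d l) (g l) f
      map_add' := fun f f' => by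
        simp only [sheetPairing, ← mul_add, ← Finset.sum_add_distrib]
        congr 1
        refine Finset.sum_congr rfl fun k hk => ?_
        refine Eq.trans ?_ (integral_add ((h.g_memLp l k hk).integrable_mul (htr f l _))
          ((h.g_memLp l k hk).integrable_mul (htr f' l _)))
        congr 1 with x'
        simp [mul_add]
      map_smul' := fun c f => by
        simp only [sheetPairing, RingHom.id_apply, smul_eq_mul]
        rw [mul_left_comm]
        congr 1
        rw [Finset.mul_sum]
        refine Finset.sum_congr rfl fun k hk => ?_
        rw [← integral_const_mul]
        congr 1 with x'
        simp only [SetLike.val_smul, Pi.smul_apply, smul_eq_mul]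
        ring }
  obtain ⟨G, hG⟩ := exists_inner_repr_of_tendsto R a (fun f => by
    obtain ⟨hs, K, hK, hKΩ, hf⟩ := f.2
    exact ⟨_, tendsto_sheets_layer h.bounded h.d_lim h.d_pos h.twoScale_uj h.twoScale_u2 h.v_memLp h.v_bound h.trace
      hK hKΩ hf hs⟩) (√M) (fun f t ht => by
    obtain ⟨hs, K, hK, hKΩ, hf⟩ := f.2
    refine le_sqrt_mul_of_young h.pos (norm_nonneg _) fun κ hκ => ?_
    have h1 := (hf.flat.tendsto_sheets_norm_sq h.bounded hK hKΩ).comp h.d_lim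
    simp only [proj_lift] at h1
    have hR : ‖R f‖ ^ 2 = ∫ z, ‖f.1 (z.1, lift z.2 0)‖ ^ 2 ∂(surfMeasure (cyl S L)) :=
      norm_sq_toLp (hmem f)
    rw [← hR] at h1
    refine le_of_tendsto_of_tendsto' ht.norm ((h1.div_const (2 * κ)).const_add (κ / 2 * M))
      fun l => ?_
    refine (norm_sheetPairing_le (h.d_pos l) (h.g_memLp l) (fun k _ => htr f l _) hκ).trans ?_
    refine add_le_add_left ?_ _
    exact mul_le_mul_of_nonneg_left (h.g_bound l) (by positivity))
  -- The inner product conjugates its first argument, whereas the pairing is bilinear.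
  refine ⟨fun z => star (G z), (Lp.stronglyMeasurable G).star, (Lp.memLp G).star, ?_⟩
  intro K f hK hKΩ hf hs
  have := hG ⟨f, hs, K, hK, hKΩ, hf⟩
  rw [L2.inner_def] at this
  have heq : (∫ z, star (G z) * f (z.1, lift z.2 0) ∂(surfMeasure (cyl S L))) =
      ∫ z, inner ℂ (G z) (R ⟨f, hs, K, hK, hKΩ, hf⟩ z) ∂(surfMeasure (cyl S L)) := ?_
  · rw [heq]
    exact this
  refine integral_congr_ae ?_
  filter_upwards [(hmem ⟨f, hs, K, hK, hKΩ, hf⟩).coeFn_toLp] with z hz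
  change _ = inner ℂ (G z) (((hmem ⟨f, hs, K, hK, hKΩ, hf⟩).toLp _ : E3 × E2 → ℂ) z)
  rw [hz]
  simp [mul_comm]

/-! ### Approximation of test fields -/

/-- Convolution with a narrow bump in both variables: it commutes with translations in y and
enlarges the support in x only slightly. -/
theorem IsOsc.exists_smooth {Ω : Set E3} (hΩ : IsOpen Ω) {K : Set E3} (hK : IsCompact K)
    (hKΩ : K ⊆ Ω) {b : E3 × E3 → ℂ} (hb : IsOsc K b) {δ : ℝ} (hδ : 0 < δ) :
    ∃ f : E3 × E3 → ℂ, ContDiff ℝ (⊤ : ℕ∞) f ∧ (∃ K', IsCompact K' ∧ K' ⊆ Ω ∧ IsOsc K' f) ∧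
      ∀ z, ‖b z - f z‖ ≤ δ := by
  have : (volume : Measure (E3 × E3)).IsAddHaarMeasure :=
    inferInstanceAs (volume.prod volume : Measure (E3 × E3)).IsAddHaarMeasure
  have : (volume : Measure (E3 × E3)).IsNegInvariant :=
    Measure.IsAddHaarMeasure.isNegInvariant_of_regular _
  obtain ⟨r₁, hr₁, hu⟩ := Metric.uniformContinuous_iff.1 (hb.uniformContinuous hK) δ hδ
  obtain ⟨r₂, hr₂, hr₂Ω⟩ := hK.exists_cthickening_subset_open hΩ hKΩ
  -- The radius is at most `r₁` for uniform closeness and at most `r₂` to keep the support in Ω.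
  set r := min r₁ r₂
  have hr : 0 < r := lt_min hr₁ hr₂
  let ψ : ContDiffBump (0 : E3 × E3) := ⟨r / 2, r, by positivity, by linarith⟩
  set f : E3 × E3 → ℂ := convolution (ψ.normed volume) b (ContinuousLinearMap.lsmul ℝ ℝ) volume
    with hf
  have hs : ContDiff ℝ (⊤ : ℕ∞) f :=
    ψ.hasCompactSupport_normed.contDiff_convolution_left _ ψ.contDiff_normed
      hb.cont.locallyIntegrable
  refine ⟨f, hs, ⟨Metric.cthickening r₂ K, hK.cthickening, hr₂Ω, hs.continuous, ?_, ?_⟩, ?_⟩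
  · intro x y i
    simp only [hf, convolution]
    congr 1 with t
    congr 1
    have := hb.periodic (x - t.1) (y - t.2) i
    rw [show (x, y + EuclideanSpace.single i 1) - t =
      (x - t.1, y - t.2 + EuclideanSpace.single i 1) from
        Prod.ext rfl (add_sub_right_comm _ _ _), this]
    rfl
  · intro x hx y
    have h0 : b (x, y) = 0 := hb.zero x (fun h => hx (Metric.self_subset_cthickening _ h)) y
    have := ψ.dist_normed_convolution_le (μ := volume) (g := b) (x₀ := (x, y)) (ε := 0)
      hb.cont.aestronglyMeasurable (by
        rintro ⟨x', y'⟩ hz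
        have h1 : dist x' x < r := lt_of_le_of_lt (le_max_left _ _) hz
        have h2 : x' ∉ K := fun h => hx (Metric.mem_cthickening_of_dist_le _ _ _ _ h
          (by rw [dist_comm]; exact (h1.trans_le (min_le_right _ _)).le))
        rw [h0, hb.zero x' h2, dist_self])
    rw [h0] at this
    exact dist_le_zero.1 this
  · intro z
    rw [← dist_eq_norm, dist_comm]
    refine ψ.dist_normed_convolution_le hb.cont.aestronglyMeasurable fun z' hz => (hu ?_).le
    exact lt_of_lt_of_le hz (min_le_left _ _)

/-- A smooth cutoff in the vertical fast variable. -/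
def cutoff (t : ℝ) : ℝ := Real.smoothTransition (2 - 4 * t)

theorem contDiff_cutoff : ContDiff ℝ (⊤ : ℕ∞) cutoff :=
  Real.smoothTransition.contDiff.comp (by fun_prop)

theorem cutoff_eq_one {t : ℝ} (ht : t ≤ 1 / 4) : cutoff t = 1 :=
  Real.smoothTransition.one_of_one_le (by linarith)

theorem cutoff_eq_zero {t : ℝ} (ht : 1 / 2 ≤ t) : cutoff t = 0 :=
  Real.smoothTransition.zero_of_nonpos (by linarith)

theorem cutoff_nonneg (t : ℝ) : 0 ≤ cutoff t := Real.smoothTransition.nonneg _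

theorem cutoff_le_one (t : ℝ) : cutoff t ≤ 1 := Real.smoothTransition.le_one _

theorem contDiff_cutoff_vert : ContDiff ℝ (⊤ : ℕ∞) fun z : E3 × E3 => cutoff (z.2 2) :=
  contDiff_cutoff.comp (vertL.contDiff.comp contDiff_snd)

/-- The cutoff equals 1 near y₃ = 0, so a periodic field becomes a layer field with the same values
on Σ₀. -/
theorem IsOsc.cutoff {K : Set E3} {f : E3 × E3 → ℂ} (hf : IsOsc K f) :
    IsLayer K fun z : E3 × E3 => cutoff (z.2 2) • f z where
  cont := contDiff_cutoff_vert.continuous.smul hf.cont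
  periodic x y i hi := by
    simp [hf.periodic x y i, Ne.symm hi]
  zero x hx y := by simp [hf.zero x hx]
  top x y hy := by simp [cutoff_eq_zero hy.le]

/-- Inner regularity of the volume: all but a small part of Ω is covered by a compact set on which η
= 1. -/
theorem exists_cutoff {Ω : Set E3} (hΩ : IsOpen Ω) (hvol : volume Ω < ∞) {ρ : ℝ} (hρ : 0 < ρ) :
    ∃ η : E3 → ℝ, ∃ K, Continuous η ∧ IsCompact K ∧ K ⊆ Ω ∧ (∀ x ∉ K, η x = 0) ∧
      (∀ x, 0 ≤ η x ∧ η x ≤ 1) ∧ ∫ x in Ω, (1 - η x) ≤ ρ := by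
  obtain ⟨K, hKΩ, hK, hlt⟩ := hΩ.measurableSet.exists_isCompact_sdiff_lt hvol.ne
    (ENNReal.ofReal_pos.2 hρ).ne'
  obtain ⟨r, hr, hrΩ⟩ := hK.exists_cthickening_subset_open hΩ hKΩ
  have h1 : ∀ x, (thickenedIndicator hr K x : ℝ) ≤ 1 := fun x => by
    exact_mod_cast thickenedIndicator_le_one hr K x
  refine ⟨fun x => thickenedIndicator hr K x, Metric.cthickening r K, by fun_prop, hK.cthickening,
    hrΩ, fun x hx => ?_, fun x => ⟨NNReal.coe_nonneg _, h1 x⟩, ?_⟩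
  · have : x ∉ Metric.thickening r K := fun h => hx (Metric.thickening_subset_cthickening _ _ h)
    simp [thickenedIndicator_zero hr K this]
  · rw [setIntegral_eq_of_subset_of_forall_sdiff_eq_zero hΩ.measurableSet
      (s := Ω \ K) sdiff_subset]
    · have hle := norm_setIntegral_le_of_norm_le_const (μ := volume) (s := Ω \ K) (C := 1)
        (f := fun x => (1 - thickenedIndicator hr K x : ℝ)) (hlt.trans ENNReal.ofReal_lt_top)
        fun x _ => by
          rw [Real.norm_of_nonneg (sub_nonneg.2 (h1 x))]
          linarith [NNReal.coe_nonneg (thickenedIndicator hr K x)]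
      refine (le_abs_self _).trans (hle.trans ?_)
      rw [one_mul, measureReal_def]
      exact ENNReal.toReal_le_of_le_ofReal hρ.le hlt.le
    · intro x hx
      have : x ∈ K := by
        by_contra h
        exact hx.2 ⟨hx.1, h⟩
      simp [thickenedIndicator_one hr K this]

/-- Continuity of f is known only over Ω; off the compact set K the product is locally zero, which
gives continuity everywhere. -/
theorem isOsc_cutoff_mul {Ω : Set E3} (hΩ : IsOpen Ω) {f : E3 → E3 → ℂ} (hp : PeriodicY Ω f)
    (hc : ContinuousOn (Function.uncurry f) (Ω ×ˢ univ)) {K : Set E3} (hK : IsCompact K)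
    (hKΩ : K ⊆ Ω) {η : E3 → ℝ} (hη : Continuous η) (hηK : ∀ x ∉ K, η x = 0) :
    IsOsc K fun z : E3 × E3 => η z.1 • f z.1 z.2 where
  cont := by
    rw [continuous_iff_continuousAt]
    rintro ⟨x, y⟩
    by_cases hx : x ∈ Ω
    · exact (hη.comp continuous_fst).continuousAt.smul
        (hc.continuousAt ((hΩ.prod isOpen_univ).mem_nhds ⟨hx, mem_univ _⟩))
    · have hxK : x ∉ K := fun h => hx (hKΩ h)
      have : (fun z : E3 × E3 => η z.1 • f z.1 z.2) =ᶠ[𝓝 (x, y)] fun _ => 0 := by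
        filter_upwards [(hK.isClosed.isOpen_compl.preimage continuous_fst).mem_nhds hxK] with z hz
        rw [hηK z.1 hz, zero_smul]
      exact this.continuousAt
  periodic x y i := by
    by_cases hx : x ∈ K
    · simp only [hp x (hKΩ hx)]
    · simp only [hηK x hx, zero_smul]
  zero x hx y := by simp only [hηK x hx, zero_smul]

theorem surfMeasure_eq (Ω : Set E3) :
    surfMeasure Ω = (volume.prod volume).restrict (Ω ×ˢ cellY2) := by
  rw [surfMeasure, Measure.prod_restrict]

theorem ae_surfMeasure_mem {Ω : Set E3} (hΩ : IsOpen Ω) : ∀ᵐ z ∂(surfMeasure Ω), z.1 ∈ Ω := by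
  rw [surfMeasure_eq]
  filter_upwards [ae_restrict_mem (hΩ.measurableSet.prod measurableSet_cellY2)] with z hz
  exact hz.1

theorem memLp_surf_of_continuousOn {Ω : Set E3} (hΩ : IsOpen Ω) (hvol : volume Ω < ∞)
    {f : E3 → E3 → ℂ} (hc : ContinuousOn (Function.uncurry f) (Ω ×ˢ univ)) {B : ℝ}
    (hB : ∀ x ∈ Ω, ∀ y, ‖f x y‖ ≤ B) :
    MemLp (fun z : E3 × E2 => f z.1 (lift z.2 0)) 2 (surfMeasure Ω) := by
  have := isFiniteMeasure_surfMeasure hvol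
  refine MemLp.of_bound ?_ B ?_
  · rw [surfMeasure_eq]
    have h : ContinuousOn (fun z : E3 × E2 => Function.uncurry f (z.1, lift z.2 0))
        (Ω ×ˢ cellY2) := hc.comp (by fun_prop) fun z hz => ⟨hz.1, mem_univ _⟩
    exact h.aestronglyMeasurable (hΩ.measurableSet.prod measurableSet_cellY2)
  · filter_upwards [ae_surfMeasure_mem hΩ] with z hz
    exact hB _ hz _

theorem norm_integral_mul_le {X : Type*} [MeasurableSpace X] {m : Measure X} {f g : X → ℂ}
    (hf : MemLp f 2 m) (hg : MemLp g 2 m) {κ : ℝ} (hκ : 0 < κ) :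
    ‖∫ x, f x * g x ∂m‖ ≤ κ / 2 * (∫ x, ‖f x‖ ^ 2 ∂m) + (∫ x, ‖g x‖ ^ 2 ∂m) / (2 * κ) := by
  have h1 := (integrable_norm_sq hf).const_mul (κ / 2)
  have h2 := (integrable_norm_sq hg).div_const (2 * κ)
  rw [← integral_const_mul, ← integral_div, ← integral_add h1 h2]
  refine norm_integral_le_of_norm_le (h1.add h2) (ae_of_all _ fun x' => ?_)
  rw [norm_mul]
  exact young hκ _ _

/-- A bounded continuous periodic field is cut off near ∂Ω, mollified, and made a layer field. The
error is small in L² on Ω × Σ₀ and, uniformly for small d, in the weighted L² norm of the sheets;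
Young's inequality pairs it with the bounded norms of G and of g. -/
theorem SheetSequence.tendsto_pairing {S : Set E2} (hS : IsOpen S) {L M : ℝ} {d : ℕ → ℝ} {j : Fin 3}
    {v uj u2 g : ℕ → E3 → ℂ} {uj₀ u2₀ : E3 × E3 → ℂ}
    (h : SheetSequence S L M d j v uj u2 g uj₀ u2₀) {G : E3 × E2 → ℂ}
    (hG : MemLp G 2 (surfMeasure (cyl S L)))
    (hlim : ∀ K f, IsCompact K → K ⊆ cyl S L → IsLayer K f → ContDiff ℝ (⊤ : ℕ∞) f →
        Tendsto (fun l => sheetPairing S L (d l) (g l) f) atTop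
          (𝓝 (∫ z, G z * f (z.1, lift z.2 0) ∂(surfMeasure (cyl S L)))))
    {f₀ : E3 → E3 → ℂ} (hp : PeriodicY (cyl S L) f₀)
    (hc : ContinuousOn (Function.uncurry f₀) (cyl S L ×ˢ univ)) {B : ℝ}
    (hB : ∀ x ∈ cyl S L, ∀ y, ‖f₀ x y‖ ≤ B) :
    Tendsto (fun l => sheetPairing S L (d l) (g l) (Function.uncurry f₀)) atTop
      (𝓝 (∫ z, G z * f₀ z.1 (lift z.2 0) ∂(surfMeasure (cyl S L)))) := by
  have hvol := volume_cyl_lt_top h.bounded L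
  have hΩ := isOpen_cyl hS L
  have hfin := isFiniteMeasure_surfMeasure hvol
  have hfinS : IsFiniteMeasure (volume.restrict S) := ⟨by simpa using h.bounded.measure_lt_top⟩
  set V := volume.real (cyl S L)
  have hV : 0 ≤ V := measureReal_nonneg
  set N := ∫ z, ‖G z‖ ^ 2 ∂(surfMeasure (cyl S L))
  have hN : 0 ≤ N := integral_nonneg fun _ => by positivity
  have hM := h.pos
  refine tendsto_of_approx fun ε hε => ?_
  -- the parameters of the approximation
  set κ := ε / (M + N) with hκd
  have hκ : 0 < κ := by positivity
  set ρ := ε * κ / (8 * (B ^ 2 + 1)) with hρd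
  have hρ : 0 < ρ := by positivity
  obtain ⟨δ, hδ, hδV⟩ : ∃ δ > 0, 2 * δ ^ 2 * V ≤ ε * κ / 4 := by
    refine ⟨√(ε * κ / (8 * (V + 1))), by positivity, ?_⟩
    rw [Real.sq_sqrt (by positivity)]
    have : V / (V + 1) ≤ 1 := by rw [div_le_one (by positivity)]; linarith
    calc 2 * (ε * κ / (8 * (V + 1))) * V = ε * κ / 4 * (V / (V + 1)) := by field_simp; ring
      _ ≤ ε * κ / 4 * 1 := by gcongr
      _ = _ := mul_one _
  -- This serves both errors: X = M on the sheets and X = N in the limit. The two Young terms are at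
  -- most ε/2 and 3ε/8.
  have hfinal : ∀ X, 0 ≤ X → X ≤ M + N → ∀ T, T ≤ 4 * B ^ 2 * ρ + 2 * δ ^ 2 * V →
      κ / 2 * X + T / (2 * κ) ≤ ε := by
    intro X _ hX T hT
    have h1 : κ * X ≤ ε := by
      rw [hκd, div_mul_eq_mul_div, div_le_iff₀ (by positivity)]
      gcongr
    have h2 : 4 * B ^ 2 * ρ ≤ ε * κ / 2 := by
      have : B ^ 2 / (B ^ 2 + 1) ≤ 1 := by rw [div_le_one (by positivity)]; linarith
      calc 4 * B ^ 2 * ρ = ε * κ / 2 * (B ^ 2 / (B ^ 2 + 1)) := by rw [hρd]; field_simp; ring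
        _ ≤ ε * κ / 2 * 1 := by gcongr
        _ = _ := mul_one _
    have h3 : T / (2 * κ) ≤ 3 / 8 * ε := by
      rw [div_le_iff₀ (by positivity)]
      nlinarith
    linarith
  obtain ⟨η, K, hηc, hK, hKΩ, hηK, hη01, hηρ⟩ := exists_cutoff hΩ hvol hρ
  have hb := isOsc_cutoff_mul hΩ hp hc hK hKΩ hηc hηK
  obtain ⟨f, hfs, ⟨K', hK', hKΩ', hfK'⟩, hfb⟩ := hb.exists_smooth hΩ hK hKΩ hδ
  have herr : ∀ x ∈ cyl S L, ∀ y, ‖f₀ x y - f (x, y)‖ ^ 2 ≤ 2 * B ^ 2 * (1 - η x) + 2 * δ ^ 2 := by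
    intro x hx y
    have h1 : ‖f₀ x y - f (x, y)‖ ≤ (1 - η x) * B + δ := by
      calc ‖f₀ x y - f (x, y)‖ = ‖(1 - η x) • f₀ x y + (η x • f₀ x y - f (x, y))‖ := by
            congr 1; rw [sub_smul, one_smul]; ring
        _ ≤ ‖(1 - η x) • f₀ x y‖ + ‖η x • f₀ x y - f (x, y)‖ := norm_add_le _ _
        _ ≤ _ := by
          refine add_le_add ?_ (hfb (x, y))
          rw [norm_smul, Real.norm_of_nonneg (sub_nonneg.2 (hη01 x).2)]
          exact mul_le_mul_of_nonneg_left (hB x hx y) (sub_nonneg.2 (hη01 x).2)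
    have h2 := hη01 x
    have h3 : (1 - η x) ^ 2 ≤ 1 - η x := by nlinarith
    calc ‖f₀ x y - f (x, y)‖ ^ 2 ≤ ((1 - η x) * B + δ) ^ 2 := by gcongr
      _ ≤ 2 * ((1 - η x) ^ 2 * B ^ 2) + 2 * δ ^ 2 := by nlinarith [sq_nonneg ((1 - η x) * B - δ)]
      _ ≤ 2 * ((1 - η x) * B ^ 2) + 2 * δ ^ 2 := by gcongr
      _ = _ := by ring
  have hsmooth : ContDiff ℝ (⊤ : ℕ∞) fun z : E3 × E3 => cutoff (z.2 2) • f z :=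
    contDiff_cutoff_vert.smul hfs
  have htr : ∀ x y', (fun z : E3 × E3 => cutoff (z.2 2) • f z) (x, lift y' 0) = f (x, lift y' 0) :=
    fun x y' => by simp [cutoff_eq_one]
  refine ⟨_, _, hlim K' _ hK' hKΩ' hfK'.cutoff hsmooth, ?_, ?_⟩
  · have hηosc : IsOsc K fun z : E3 × E3 => η z.1 :=
      ⟨hηc.comp continuous_fst, fun _ _ _ => rfl, fun x hx _ => hηK x hx⟩
    have hηlim := (hηosc.tendsto_sheets h.bounded hK hKΩ).comp h.d_lim
    have hηint : IntegrableOn η (cyl S L) :=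
      (hηc.integrable_of_hasCompactSupport (HasCompactSupport.intro hK hηK)).integrableOn
    have hρ' : V - ∫ x in cyl S L, η x ≤ ρ := by
      rw [integral_sub (integrable_const_iff.2 (Or.inr ⟨by simpa using hvol⟩)) hηint] at hηρ
      simpa using hηρ
    -- The sheet sums of η tend to ∫_Ω η ≥ V - ρ and hence eventually exceed V - 2ρ. As the weighted
    -- area of the sheets is at most V, the weighted sum of 1 - η is then at most 2ρ.
    have hgt : V - 2 * ρ < ∫ x in cyl S L, ∫ _ in cellY2, η x := by
      simp only [integral_const, smul_eq_mul]
      simp only [measureReal_def, Measure.restrict_apply_univ, volume_cellY2, ENNReal.toReal_one,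
        one_mul]
      linarith
    filter_upwards [hηlim.eventually_const_lt hgt] with l hl
    have hd := h.d_pos l
    have hcont : ∀ k ∈ layers L (d l), ContinuousOn (fun x' => Function.uncurry f₀
        (lift x' (k * d l), lift ((d l)⁻¹ • x') 0)) S := fun k hk =>
      hc.comp (by fun_prop) fun x' hx => ⟨lift_mem_cyl hd hk hx, mem_univ _⟩
    have hm0 : ∀ k ∈ layers L (d l), MemLp (fun x' => Function.uncurry f₀
        (lift x' (k * d l), lift ((d l)⁻¹ • x') 0)) 2 (volume.restrict S) := fun k hk => by
      refine MemLp.of_bound ((hcont k hk).aestronglyMeasurable hS.measurableSet) B ?_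
      filter_upwards [ae_restrict_mem hS.measurableSet] with x' hx
      exact hB _ (lift_mem_cyl hd hk hx) _
    have hm1 : ∀ k ∈ layers L (d l), MemLp (fun x' => f
        (lift x' (k * d l), lift ((d l)⁻¹ • x') 0)) 2 (volume.restrict S) := fun k _ =>
      hfK'.memLp_trace h.bounded hK' _ _
    have hsub : sheetPairing S L (d l) (g l) (Function.uncurry f₀) -
        sheetPairing S L (d l) (g l) (fun z => cutoff (z.2 2) • f z) =
        sheetPairing S L (d l) (g l) (fun z => f₀ z.1 z.2 - f z) := by
      simp only [sheetPairing, ← mul_sub, ← Finset.sum_sub_distrib]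
      congr 1
      refine Finset.sum_congr rfl fun k hk => ?_
      simp only [htr]
      refine (integral_sub ((h.g_memLp l k hk).integrable_mul (hm0 k hk))
          ((h.g_memLp l k hk).integrable_mul (hm1 k hk))).symm.trans ?_
      congr 1 with x'
      simp [mul_sub]
    rw [hsub]
    refine (norm_sheetPairing_le hd (h.g_memLp l)
      (fun k hk => (hm0 k hk).sub (hm1 k hk)) hκ).trans ?_
    have e1 : κ / 2 * (d l * ∑ k ∈ layers L (d l), ∫ x' in S, ‖g l (lift x' (k * d l))‖ ^ 2) ≤
        κ / 2 * M := mul_le_mul_of_nonneg_left (h.g_bound l) (by positivity)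
    have e2 : d l * ∑ k ∈ layers L (d l), ∫ x' in S,
        ‖f₀ (lift x' (k * d l)) (lift ((d l)⁻¹ • x') 0) -
          f (lift x' (k * d l), lift ((d l)⁻¹ • x') 0)‖ ^ 2 ≤
        2 * B ^ 2 * (2 * ρ) + 2 * δ ^ 2 * V := by
      have hone : IntegrableOn (fun _ : E2 => (1 : ℝ)) S := integrable_const _
      have hηS : ∀ k : ℤ, IntegrableOn (fun x' => η (lift x' (k * d l))) S := fun k => by
        refine IntegrableOn.of_bound h.bounded.measure_lt_top
          (hηc.comp (by fun_prop)).aestronglyMeasurable 1 (ae_of_all _ fun x' => ?_)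
        rw [Real.norm_of_nonneg (hη01 _).1]
        exact (hη01 _).2
      have hterm : ∀ k ∈ layers L (d l), ∫ x' in S,
          ‖f₀ (lift x' (k * d l)) (lift ((d l)⁻¹ • x') 0) -
            f (lift x' (k * d l), lift ((d l)⁻¹ • x') 0)‖ ^ 2 ≤
          2 * B ^ 2 * ((∫ _ in S, (1 : ℝ)) - ∫ x' in S, η (lift x' (k * d l))) +
            2 * δ ^ 2 * ∫ _ in S, (1 : ℝ) := fun k hk => by
        have i1 : IntegrableOn (fun x' => 2 * B ^ 2 * (1 - η (lift x' (k * d l)))) S :=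
          (hone.sub (hηS k)).const_mul _
        have i2 : IntegrableOn (fun _ => 2 * δ ^ 2 * 1) S := hone.const_mul _
        rw [← integral_sub hone (hηS k), ← integral_const_mul, ← integral_const_mul,
          ← integral_add i1 i2]
        refine integral_mono_ae (integrable_norm_sq ((hm0 k hk).sub (hm1 k hk)))
          (i1.add i2) ?_
        filter_upwards [ae_restrict_mem hS.measurableSet] with x' hx
        simpa using herr _ (lift_mem_cyl hd hk hx) (lift ((d l)⁻¹ • x') 0)
      refine (mul_le_mul_of_nonneg_left (Finset.sum_le_sum hterm) hd.le).trans ?_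
      have hcard := mul_card_layers_le h.bounded (L := L) hd
      rw [Finset.sum_add_distrib, ← Finset.mul_sum, ← Finset.mul_sum, Finset.sum_sub_distrib,
        mul_add, mul_left_comm, mul_left_comm (d l) (2 * δ ^ 2), mul_sub]
      have hl' : V - 2 * ρ < d l * ∑ k ∈ layers L (d l), ∫ x' in S, η (lift x' (k * d l)) := hl
      refine add_le_add (mul_le_mul_of_nonneg_left ?_ (by positivity))
        (mul_le_mul_of_nonneg_left hcard (by positivity))
      linarith
    refine (add_le_add e1 (div_le_div_of_nonneg_right e2 (by positivity))).trans ?_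
    exact hfinal M hM.le (by linarith) _ (by nlinarith [sq_nonneg B])
  · have hF := memLp_surf_of_continuousOn hΩ hvol hc hB
    have hf := hfK'.memLp_surf hvol hK'
    simp only [htr]
    have i1 : Integrable (fun z => G z * f₀ z.1 (lift z.2 0)) (surfMeasure (cyl S L)) :=
      hG.integrable_mul hF
    have i2 : Integrable (fun z => G z * f (z.1, lift z.2 0)) (surfMeasure (cyl S L)) :=
      hG.integrable_mul hf
    rw [norm_sub_rev, ← integral_sub i1 i2]
    simp only [← mul_sub]
    refine (norm_integral_mul_le hG (hF.sub hf) hκ).trans ?_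
    have hηint : IntegrableOn (fun x => 2 * B ^ 2 * (1 - η x) + 2 * δ ^ 2) (cyl S L) := by
      have hfinΩ : IsFiniteMeasure (volume.restrict (cyl S L)) := ⟨by simpa using hvol⟩
      have h1 : IntegrableOn η (cyl S L) :=
        (hηc.integrable_of_hasCompactSupport (HasCompactSupport.intro hK hηK)).integrableOn
      exact (((integrable_const _).sub h1).const_mul _).add (integrable_const _)
    have e2 : ∫ z, ‖f₀ z.1 (lift z.2 0) - f (z.1, lift z.2 0)‖ ^ 2 ∂(surfMeasure (cyl S L)) ≤
        2 * B ^ 2 * ρ + 2 * δ ^ 2 * V := by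
      have h1 : Integrable (fun z : E3 × E2 => 2 * B ^ 2 * (1 - η z.1) + 2 * δ ^ 2)
          (surfMeasure (cyl S L)) := hηint.integrable.comp_fst _
      refine (integral_mono_ae (integrable_norm_sq (hF.sub hf)) h1 ?_).trans ?_
      · filter_upwards [ae_surfMeasure_mem hΩ] with z hz
        exact herr _ hz _
      · rw [surfMeasure, integral_fun_fst (f := fun x => 2 * B ^ 2 * (1 - η x) + 2 * δ ^ 2)]
        have hfinΩ : IsFiniteMeasure (volume.restrict (cyl S L)) := ⟨by simpa using hvol⟩
        have h2 : IntegrableOn (fun x => 1 - η x) (cyl S L) := (integrable_const _).sub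
          (hηc.integrable_of_hasCompactSupport (HasCompactSupport.intro hK hηK)).integrableOn
        rw [integral_add (h2.const_mul _) (integrable_const _), integral_const_mul]
        simp only [measureReal_def, Measure.restrict_apply_univ, volume_cellY2, ENNReal.toReal_one,
          one_mul, integral_const, smul_eq_mul]
        have := mul_le_mul_of_nonneg_left hηρ (show 0 ≤ 2 * B ^ 2 by positivity)
        change _ + V * _ ≤ _
        linarith
    refine (add_le_add le_rfl (div_le_div_of_nonneg_right e2 (by positivity))).trans ?_
    exact hfinal N hN (by linarith) _ (by nlinarith [sq_nonneg B])

/-! ### Unfolding of periodic functions -/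

section Unfold

variable {V ι : Type*} [AddCommGroup V] [MeasurableSpace V] [MeasurableAdd V] {m : Measure E3}
  [SFinite m] {ν : Measure V} [SFinite ν] {D : Set V} {w : ι → V} {s : Finset ι}
  {q a : E3 × V → ℂ}

theorem setIntegral_translate (hw : ∀ n, MeasurePreserving (· + w n) ν ν) (n : ι)
    (f : E3 × V → ℂ) :
    ∫ z in univ ×ˢ {y | y - w n ∈ D}, f z ∂(m.prod ν) =
      ∫ z in univ ×ˢ D, f (z.1, z.2 + w n) ∂(m.prod ν) := by
  have h1 : MeasurePreserving (fun z : E3 × V => (z.1, z.2 + w n)) (m.prod ν) (m.prod ν) :=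
    (MeasurePreserving.id m).prod (hw n)
  have h2 : MeasurableEmbedding fun z : E3 × V => (z.1, z.2 + w n) :=
    (MeasurableEquiv.prodCongr (MeasurableEquiv.refl E3)
      (MeasurableEquiv.addRight (w n))).measurableEmbedding
  rw [← h1.setIntegral_preimage_emb h2]
  congr 2
  ext z; simp

theorem integrableOn_translate (hw : ∀ n, MeasurePreserving (· + w n) ν ν) (n : ι)
    {f : E3 × V → ℂ} (hf : IntegrableOn (fun z => f (z.1, z.2 + w n)) (univ ×ˢ D) (m.prod ν)) :
    IntegrableOn f (univ ×ˢ {y | y - w n ∈ D}) (m.prod ν) := by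
  have h1 : MeasurePreserving (fun z : E3 × V => (z.1, z.2 + w n)) (m.prod ν) (m.prod ν) :=
    (MeasurePreserving.id m).prod (hw n)
  have h2 : MeasurableEmbedding fun z : E3 × V => (z.1, z.2 + w n) :=
    (MeasurableEquiv.prodCongr (MeasurableEquiv.refl E3)
      (MeasurableEquiv.addRight (w n))).measurableEmbedding
  rw [← h1.integrableOn_comp_preimage h2]
  have h3 : (fun z : E3 × V => (z.1, z.2 + w n)) ⁻¹' univ ×ˢ {y | y - w n ∈ D} = univ ×ˢ D := by
    ext z; simp
  rw [h3]
  exact hf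

theorem measurableSet_translate (hD : MeasurableSet D) (n : ι) :
    MeasurableSet ((univ : Set E3) ×ˢ {y | y - w n ∈ D}) := by
  refine MeasurableSet.univ.prod ?_
  simp only [sub_eq_add_neg]
  exact measurable_add_const _ hD

/-- If `q` is invariant under the translations `w n`, then the integral of `q a` unfolds to the
fundamental set `D`. -/
theorem unfold_periodic (hD : MeasurableSet D) (hw : ∀ n, MeasurePreserving (· + w n) ν ν)
    (hdisj : Pairwise fun n n' => Disjoint {y | y - w n ∈ D} {y | y - w n' ∈ D})
    (hq : ∀ᵐ x ∂m, ∀ y n, q (x, y + w n) = q (x, y))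
    (hcov : ∀ x y, a (x, y) ≠ 0 → ∃ n ∈ s, y - w n ∈ D)
    (hint : ∀ n ∈ s, IntegrableOn (fun z => q z * a (z.1, z.2 + w n)) (univ ×ˢ D) (m.prod ν)) :
    Integrable (fun z => q z * a z) (m.prod ν) ∧
      ∫ z, q z * a z ∂(m.prod ν) =
        ∫ z in univ ×ˢ D, q z * ∑ n ∈ s, a (z.1, z.2 + w n) ∂(m.prod ν) := by
  have hq' : ∀ᵐ z ∂(m.prod ν), ∀ n, q (z.1, z.2 + w n) = q z := by
    have := Measure.quasiMeasurePreserving_fst (μ := m) (ν := ν).ae hq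
    filter_upwards [this] with z hz n
    exact hz _ n
  have hint' : ∀ n ∈ s, IntegrableOn (fun z => q z * a z) (univ ×ˢ {y | y - w n ∈ D})
      (m.prod ν) := fun n hn => by
    refine integrableOn_translate hw n ((hint n hn).congr_fun_ae ?_)
    filter_upwards [ae_restrict_of_ae hq'] with z hz
    rw [hz n]
  have hmeas := fun n => measurableSet_translate (w := w) hD n
  have hsupp : ∀ z ∉ ⋃ n ∈ s, (univ : Set E3) ×ˢ {y | y - w n ∈ D}, q z * a z = 0 := by
    rintro ⟨x, y⟩ hz
    by_contra h
    obtain ⟨n, hn, hy⟩ := hcov x y fun h' => h (by rw [h', mul_zero])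
    exact hz (mem_iUnion₂.2 ⟨n, hn, mem_univ _, hy⟩)
  constructor
  · rw [← integrableOn_iff_integrable_of_support_subset (s := ⋃ n ∈ s,
      (univ : Set E3) ×ˢ {y | y - w n ∈ D}) fun z hz => by_contra fun h => hz (hsupp z h)]
    exact integrableOn_finset_iUnion.2 hint'
  · rw [← setIntegral_eq_integral_of_forall_compl_eq_zero hsupp,
      integral_biUnion_finset s (fun n _ => hmeas n) (fun n _ n' _ hne => ?_) hint']
    · simp_rw [setIntegral_translate hw, Finset.mul_sum]
      rw [integral_finsetSum _ hint]
      refine Finset.sum_congr rfl fun n _ => integral_congr_ae ?_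
      filter_upwards [ae_restrict_of_ae hq'] with z hz
      rw [hz n]
    · exact Disjoint.set_prod_right (hdisj hne) _ _

end Unfold

/-! ### Periodization -/

/-- Horizontal integer vectors. -/
def horiz (n : Fin 2 → ℤ) : E3 := lift (intVec n) 0

/-- The periodization of `a(x, y)` in the horizontal part of `y`. -/
def periodize (a : E3 × E3 → ℂ) (z : E3 × E3) : ℂ := ∑ᶠ n : Fin 2 → ℤ, a (z + (0, horiz n))

/-- The same finite set of translates serves a whole horizontal strip, so locally the periodization
is a finite sum and can be differentiated term by term. -/
theorem exists_finset_periodize {a : E3 × E3 → ℂ} (ha : HasCompactSupport a) (R : ℝ) :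
    ∃ s : Finset (Fin 2 → ℤ), ∀ z : E3 × E3, |z.2 0| < R → |z.2 1| < R → ∀ n ∉ s,
      z + (0, horiz n) ∉ tsupport a := by
  obtain ⟨R₀, hR₀⟩ := ha.isBounded.exists_norm_le
  -- If |t| < R and |t + k| ≤ R₀, then |k| ≤ R₀ + R ≤ N.
  obtain ⟨N, h4⟩ : ∃ N : ℤ, R₀ + R ≤ N := ⟨_, Int.le_ceil _⟩
  refine ⟨Fintype.piFinset fun _ => Finset.Icc (-N) N, fun z h0 h1 n hn hz => hn ?_⟩
  clear hn
  have h2 : ‖(z + (0, horiz n)).2‖ ≤ R₀ := (le_max_right _ _).trans (hR₀ _ hz)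
  have e2 : (z + (0, horiz n)).2 = z.2 + horiz n := rfl
  rw [e2] at h2
  have h30 : |z.2 0 + n 0| ≤ R₀ := by
    have := (PiLp.norm_apply_le (z.2 + horiz n) 0).trans h2
    rwa [PiLp.add_apply, Real.norm_eq_abs] at this
  have h31 : |z.2 1 + n 1| ≤ R₀ := by
    have := (PiLp.norm_apply_le (z.2 + horiz n) 1).trans h2
    rwa [PiLp.add_apply, Real.norm_eq_abs] at this
  have key : ∀ t : ℝ, ∀ k : ℤ, |t| < R → |t + k| ≤ R₀ → k ∈ Finset.Icc (-N) N := by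
    intro t k ht hk
    rw [abs_lt] at ht
    rw [abs_le] at hk
    rw [Finset.mem_Icc]
    constructor
    · have : -(N : ℝ) ≤ k := by linarith
      exact_mod_cast this
    · have : (k : ℝ) ≤ N := by linarith
      exact_mod_cast this
  rw [Fintype.mem_piFinset]
  intro i
  fin_cases i
  · exact key (z.2 0) _ h0 h30
  · exact key (z.2 1) _ h1 h31

theorem isOpen_strip (R : ℝ) : IsOpen {z : E3 × E3 | |z.2 0| < R ∧ |z.2 1| < R} :=
  IsOpen.and (isOpen_lt (by fun_prop) continuous_const) (isOpen_lt (by fun_prop) continuous_const)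

theorem periodize_eq_sum {a : E3 × E3 → ℂ} {R : ℝ} {s : Finset (Fin 2 → ℤ)}
    (hs : ∀ z : E3 × E3, |z.2 0| < R → |z.2 1| < R → ∀ n ∉ s, z + (0, horiz n) ∉ tsupport a)
    {z : E3 × E3} (h0 : |z.2 0| < R) (h1 : |z.2 1| < R) :
    periodize a z = ∑ n ∈ s, a (z + (0, horiz n)) := by
  refine finsum_eq_sum_of_support_subset _ fun n hn => ?_
  by_contra h
  exact hn (image_eq_zero_of_notMem_tsupport (hs z h0 h1 n h))

theorem periodize_eventuallyEq {a : E3 × E3 → ℂ} {R : ℝ} {s : Finset (Fin 2 → ℤ)}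
    (hs : ∀ z : E3 × E3, |z.2 0| < R → |z.2 1| < R → ∀ n ∉ s, z + (0, horiz n) ∉ tsupport a)
    {z : E3 × E3} (h0 : |z.2 0| < R) (h1 : |z.2 1| < R) :
    periodize a =ᶠ[𝓝 z] fun z => ∑ n ∈ s, a (z + (0, horiz n)) := by
  filter_upwards [(isOpen_strip R).mem_nhds ⟨h0, h1⟩] with z' hz'
  exact periodize_eq_sum hs hz'.1 hz'.2

theorem contDiff_periodize {a : E3 × E3 → ℂ} (ha : HasCompactSupport a)
    (hs : ContDiff ℝ (⊤ : ℕ∞) a) : ContDiff ℝ (⊤ : ℕ∞) (periodize a) := by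
  rw [contDiff_iff_contDiffAt]
  intro z
  obtain ⟨s, h⟩ := exists_finset_periodize ha (|z.2 0| + |z.2 1| + 1)
  have h0 : |z.2 0| < |z.2 0| + |z.2 1| + 1 := by linarith [abs_nonneg (z.2 1)]
  have h1 : |z.2 1| < |z.2 0| + |z.2 1| + 1 := by linarith [abs_nonneg (z.2 0)]
  refine ContDiffAt.congr_of_eventuallyEq ?_ (periodize_eventuallyEq h h0 h1)
  refine ContDiff.contDiffAt (ContDiff.sum fun n _ => hs.comp (contDiff_id.add contDiff_const))

theorem fderiv_periodize {a : E3 × E3 → ℂ} (hd : ContDiff ℝ (⊤ : ℕ∞) a) {R : ℝ}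
    {s : Finset (Fin 2 → ℤ)}
    (hs : ∀ z : E3 × E3, |z.2 0| < R → |z.2 1| < R → ∀ n ∉ s, z + (0, horiz n) ∉ tsupport a)
    {z : E3 × E3} (h0 : |z.2 0| < R) (h1 : |z.2 1| < R) (v : E3 × E3) :
    fderiv ℝ (periodize a) z v = ∑ n ∈ s, fderiv ℝ a (z + (0, horiz n)) v := by
  have hdd : Differentiable ℝ a := hd.differentiable (by simp)
  have hdn : ∀ n ∈ s, DifferentiableAt ℝ (fun z : E3 × E3 => a (z + (0, horiz n))) z :=
    fun n _ => (hdd.comp (differentiable_id.add_const _)).differentiableAt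
  rw [(periodize_eventuallyEq hs h0 h1).fderiv_eq, fderiv_fun_sum hdn]
  simp [fderiv_comp_add_right]

theorem isLayer_periodize {a : E3 × E3 → ℂ} (ha : HasCompactSupport a)
    (hs : ContDiff ℝ (⊤ : ℕ∞) a) (htop : ∀ x y, 1 / 2 < y 2 → a (x, y) = 0) :
    IsLayer (Prod.fst '' tsupport a) (periodize a) where
  cont := (contDiff_periodize ha hs).continuous
  periodic x y i hi := by
    obtain ⟨i', hi'⟩ : ∃ i' : Fin 2, EuclideanSpace.single i (1 : ℝ) = horiz (Pi.single i' 1) := by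
      fin_cases i
      · exact ⟨0, E3_ext (by simp [horiz]) (by simp [horiz]) (by simp [horiz])⟩
      · exact ⟨1, E3_ext (by simp [horiz]) (by simp [horiz]) (by simp [horiz])⟩
      · exact absurd rfl hi
    refine Eq.trans (finsum_congr fun n => ?_)
      (finsum_comp_equiv (Equiv.addLeft (Pi.single i' (1 : ℤ))))
    congr 1
    refine Prod.ext (by simp) ?_
    rw [hi']
    refine E3_ext ?_ ?_ ?_ <;> simp [horiz, add_assoc]
  zero x hx y := by
    refine finsum_eq_zero_of_forall_eq_zero fun n => ?_
    by_contra h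
    exact hx ⟨_, subset_tsupport _ h, by simp⟩
  top x y hy := by
    refine finsum_eq_zero_of_forall_eq_zero fun n => ?_
    exact htop _ _ (by simpa [horiz] using hy)

/-! ### Green's formula in the unit cell -/

/-- The half space above `Σ₀`. -/
def upper : Set E3 := {y | 0 < y 2}

theorem isOpen_upper : IsOpen upper := isOpen_lt continuous_const (by fun_prop)

/-- The measure on `Ω × {y₃ > 0}`. -/
def upperMeasure (Ω : Set E3) : Measure (E3 × E3) :=
  (volume.restrict Ω).prod (volume.restrict upper)

theorem upperMeasure_eq (Ω : Set E3) :
    upperMeasure Ω = ((volume.restrict Ω).prod volume).restrict (univ ×ˢ upper) := by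
  rw [upperMeasure, ← Measure.prod_restrict, Measure.restrict_univ]

/-- Functions of `(x, y)` that are periodic in `y` and square integrable on `Ω × Y`. -/
structure IsCellFun (Ω : Set E3) (q : E3 × E3 → ℂ) : Prop where
  memLp : MemLp q 2 ((volume.restrict Ω).prod (volume.restrict cellY))
  periodic : ∀ x ∈ Ω, ∀ y, ∀ i : Fin 3, q (x, y + EuclideanSpace.single i 1) = q (x, y)

theorem pairwise_disjoint_cube (m : ℕ) : Pairwise fun n n' : Fin m → ℤ =>
    Disjoint {y : EuclideanSpace ℝ (Fin m) | y - intVec n ∈ cube m} {y | y - intVec n' ∈ cube m} := by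
  intro n n' hne
  rw [Set.disjoint_left]
  intro y hy hy'
  refine hne (funext fun i => ?_)
  have h1 := hy i
  have h2 := hy' i
  simp only [PiLp.sub_apply, intVec_apply, mem_Ico, sub_nonneg, sub_lt_iff_lt_add] at h1 h2
  have h3 : ⌊y i⌋ = n i := Int.floor_eq_iff.2 ⟨h1.1, by linarith⟩
  have h4 : ⌊y i⌋ = n' i := Int.floor_eq_iff.2 ⟨h2.1, by linarith⟩
  rw [← h3, h4]

theorem measurableSet_cube (m : ℕ) : MeasurableSet (cube m) := by
  have : cube m = WithLp.ofLp ⁻¹' univ.pi fun _ : Fin m => Ico (0 : ℝ) 1 := by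
    ext y; simp [cube]
  rw [this]
  exact (PiLp.continuous_ofLp 2 _).measurable (MeasurableSet.univ_pi fun _ => measurableSet_Ico)

theorem exists_floor_mem {m : ℕ} {W : Type*} [NormedAddCommGroup W]
    {b : E3 × EuclideanSpace ℝ (Fin m) → W} (hb : HasCompactSupport b) :
    ∃ s : Finset (Fin m → ℤ), ∀ x y, b (x, y) ≠ 0 → ∃ n ∈ s, y - intVec n ∈ cube m := by
  obtain ⟨R, hR⟩ := hb.isBounded.exists_norm_le
  obtain ⟨N, hN⟩ : ∃ N : ℤ, R + 1 ≤ N := ⟨_, Int.le_ceil _⟩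
  refine ⟨Fintype.piFinset fun _ => Finset.Icc (-N) N, fun x y h => ⟨fun i => ⌊y i⌋, ?_, ?_⟩⟩
  · rw [Fintype.mem_piFinset]
    intro i
    have h0 : ‖(x, y)‖ ≤ R := hR (x, y) (subset_tsupport _ h)
    have h1 : ‖y‖ ≤ R := (norm_snd_le (x, y)).trans h0
    have h2 := (PiLp.norm_apply_le y i).trans h1
    rw [Real.norm_eq_abs] at h2
    rw [abs_le] at h2
    rw [Finset.mem_Icc]
    constructor
    · rw [Int.le_floor]; push_cast; linarith
    · have h3 : (⌊y i⌋ : ℝ) ≤ N := (Int.floor_le (y i)).trans (by linarith)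
      exact Int.cast_le.1 h3
  · intro i
    have : (y - intVec fun i => ⌊y i⌋) i = Int.fract (y i) := by
      simp [← Int.self_sub_floor]
    rw [this]
    exact ⟨Int.fract_nonneg _, Int.fract_lt_one _⟩

theorem restrict_univ_prod {V : Type*} [MeasurableSpace V] (m : Measure E3) [SFinite m]
    (ν : Measure V) [SFinite ν] (D : Set V) :
    (m.prod ν).restrict (univ ×ˢ D) = m.prod (ν.restrict D) := by
  rw [← Measure.prod_restrict, Measure.restrict_univ]

theorem restrict_cube_three : (volume : Measure E3).restrict (cube 3) = volume.restrict cellY :=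
  Measure.restrict_congr_set (cube_ae_eq 3)

theorem restrict_cube_two : (volume : Measure E2).restrict (cube 2) = volume.restrict cellY2 :=
  Measure.restrict_congr_set (cube_ae_eq 2)

theorem IsCellFun.integrable {Ω : Set E3} (hvol : volume Ω < ∞) {q : E3 × E3 → ℂ}
    (hq : IsCellFun Ω q) :
    Integrable q ((volume.restrict Ω).prod (volume.restrict cellY)) := by
  have : IsFiniteMeasure (volume.restrict Ω) := ⟨by simpa using hvol⟩
  exact hq.memLp.integrable (by norm_num)

/-- A compactly supported b meets finitely many translates of the cell, and on each of them q is
integrable and b bounded. -/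
theorem IsCellFun.integrable_mul {Ω : Set E3} (hΩ : IsOpen Ω) (hvol : volume Ω < ∞)
    {q : E3 × E3 → ℂ} (hq : IsCellFun Ω q) {b : E3 × E3 → ℂ} (hb : Continuous b)
    (hbc : HasCompactSupport b) :
    Integrable (fun z => q z * b z) ((volume.restrict Ω).prod volume) := by
  obtain ⟨s, hs⟩ := exists_floor_mem hbc
  obtain ⟨B, hB⟩ := hb.bounded_above_of_compact_support hbc
  refine (unfold_periodic (w := intVec) (measurableSet_cube 3)
    (fun n => measurePreserving_add_right _ _) (pairwise_disjoint_cube 3) ?_ hs fun n _ => ?_).1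
  · filter_upwards [ae_restrict_mem hΩ.measurableSet] with x hx y n
    exact periodic_intVec (q := fun y => q (x, y)) (hq.periodic x hx) n y
  · rw [IntegrableOn, restrict_univ_prod, restrict_cube_three]
    refine (hq.integrable hvol).mul_bdd (c := B) ?_ (ae_of_all _ fun z => hB _)
    exact (hb.comp (by fun_prop)).aestronglyMeasurable

theorem IsCellFun.integrable_mul_upper {Ω : Set E3} (hΩ : IsOpen Ω) (hvol : volume Ω < ∞)
    {q : E3 × E3 → ℂ} (hq : IsCellFun Ω q) {b : E3 × E3 → ℂ} (hb : Continuous b)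
    (hbc : HasCompactSupport b) :
    Integrable (fun z => q z * b z) (upperMeasure Ω) := by
  rw [upperMeasure_eq]
  exact (hq.integrable_mul hΩ hvol hb hbc).integrableOn

/-! #### Unfolding in the horizontal variables -/

/-- The vertical column over the half-open unit square. -/
def column : Set E3 := {y | proj y ∈ cube 2}

theorem measurableSet_column : MeasurableSet column :=
  continuous_proj.measurable (measurableSet_cube 2)

theorem proj_sub_horiz (y : E3) (n : Fin 2 → ℤ) : proj (y - horiz n) = proj y - intVec n :=
  E2_ext (by simp [horiz]) (by simp [horiz])

/-- The slab `0 < y₃ < 1`. -/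
def slab : Set E3 := {y | y 2 ∈ Ioo (0 : ℝ) 1}

theorem measurableSet_slab : MeasurableSet slab :=
  vertL.continuous.measurable measurableSet_Ioo

theorem column_inter_slab_ae_eq : (column ∩ slab : Set E3) =ᵐ[volume] cellY := by
  refine Filter.EventuallyEq.trans ?_ (cube_ae_eq 3)
  have hnull : volume ({0} : Set ℝ) = 0 := by simp
  filter_upwards [ae_vert_notMem hnull] with y hy
  have hy : y 2 ≠ 0 := hy
  rw [eq_iff_iff]
  change y ∈ column ∩ slab ↔ y ∈ cube 3
  simp only [column, slab, cube, mem_inter_iff, mem_ofPred_eq, Fin.forall_fin_succ, mem_Ico, mem_Ioo]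
  simp [and_assoc]
  intro _ _ _ _
  exact fun _ => ⟨le_of_lt, fun h => lt_of_le_of_ne h hy.symm⟩

theorem measurePreserving_add_horiz (n : Fin 2 → ℤ) :
    MeasurePreserving (· + horiz n) (volume.restrict slab) (volume.restrict slab) := by
  have h := (measurePreserving_add_right (volume : Measure E3) (horiz n)).restrict_preimage
    measurableSet_slab
  have h2 : (fun y => y + horiz n) ⁻¹' slab = slab := by
    ext y; simp [slab, horiz]
  rwa [h2] at h

theorem hasCompactSupport_dY {a : E3 × E3 → ℂ} (ha : HasCompactSupport a) (i : Fin 3) :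
    HasCompactSupport (dY i a) :=
  (ha.fderiv (𝕜 := ℝ)).comp_left (g := fun L : E3 × E3 →L[ℝ] ℂ => L (0, EuclideanSpace.single i 1))
    (by simp)

/-- As a vanishes above height 1/2, the half space may be replaced by the slab of height 1.
Horizontal integer translations preserve the slab, and a fundamental domain in it is the unit cell
up to a null set. -/
theorem unfold_upper {Ω : Set E3} (hΩ : IsOpen Ω) (hvol : volume Ω < ∞) {q : E3 × E3 → ℂ}
    (hq : IsCellFun Ω q) {a : E3 × E3 → ℂ} (ha : HasCompactSupport a)
    (hs : ContDiff ℝ (⊤ : ℕ∞) a) (htop : ∀ x y, 1 / 2 < y 2 → a (x, y) = 0) (i : Fin 3) :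
    ∫ z, q z * dY i a z ∂(upperMeasure Ω) =
      ∫ z, q z * dY i (periodize a) z ∂((volume.restrict Ω).prod (volume.restrict cellY)) := by
  have hfin : IsFiniteMeasure (volume.restrict Ω) := ⟨by simpa using hvol⟩
  have hdtop : ∀ x y, 1 / 2 < y 2 → dY i a (x, y) = 0 := fun x y hy => by
    have : a =ᶠ[𝓝 (x, y)] fun _ => 0 := by
      have ho : IsOpen {z : E3 × E3 | 1 / 2 < z.2 2} := isOpen_lt continuous_const (by fun_prop)
      filter_upwards [ho.mem_nhds hy] with z hz
      exact htop z.1 z.2 hz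
    rw [dY, this.fderiv_eq]; simp
  have hdc : Continuous (dY i a) := (contDiff_dY hs i).continuous
  have hslab : ∫ z, q z * dY i a z ∂(upperMeasure Ω) =
      ∫ z, q z * dY i a z ∂((volume.restrict Ω).prod (volume.restrict slab)) := by
    rw [upperMeasure_eq, ← restrict_univ_prod]
    refine setIntegral_eq_of_subset_of_forall_sdiff_eq_zero
      (MeasurableSet.univ.prod isOpen_upper.measurableSet)
      (Set.prod_mono le_rfl fun y hy => hy.1) ?_
    rintro ⟨x, y⟩ ⟨⟨-, hy⟩, hy'⟩
    rw [hdtop x y, mul_zero]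
    by_contra h
    exact hy' ⟨mem_univ _, hy, by linarith⟩
  -- Any radius above 1 would do: the column over the half-open unit square must lie in the strip.
  obtain ⟨s, hs'⟩ := exists_finset_periodize ha 2
  obtain ⟨B, hB⟩ := hdc.bounded_above_of_compact_support (hasCompactSupport_dY ha i)
  have hcol : ∀ y ∈ column, |y 0| < 2 ∧ |y 1| < 2 := fun y hy => by
    have h0 : y 0 ∈ Ico (0 : ℝ) 1 := hy 0
    have h1 : y 1 ∈ Ico (0 : ℝ) 1 := hy 1
    rw [abs_of_nonneg h0.1, abs_of_nonneg h1.1]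
    exact ⟨by linarith [h0.2], by linarith [h1.2]⟩
  have hmeas : ((volume.restrict Ω).prod (volume.restrict slab)).restrict (univ ×ˢ column) =
      (volume.restrict Ω).prod (volume.restrict cellY) := by
    rw [restrict_univ_prod, Measure.restrict_restrict measurableSet_column,
      Measure.restrict_congr_set column_inter_slab_ae_eq]
  have hunf := (unfold_periodic (m := volume.restrict Ω) (ν := volume.restrict slab) (s := s)
    (q := q) (a := dY i a) (w := horiz) measurableSet_column measurePreserving_add_horiz ?_ ?_ ?_
    fun n _ => ?_).2
  · rw [hslab, hunf]
    have hmc : MeasurableSet ((univ : Set E3) ×ˢ column) :=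
      MeasurableSet.univ.prod measurableSet_column
    rw [← hmeas]
    refine setIntegral_congr_fun hmc ?_
    rintro z ⟨-, hz⟩
    have h := fderiv_periodize hs hs' (hcol _ hz).1 (hcol _ hz).2 (0, EuclideanSpace.single i 1)
    dsimp only
    rw [dY, h]
    simp only [dY, Prod.add_def, add_zero]
  · intro n n' hne
    have heq : ∀ n, {y | y - horiz n ∈ column} = proj ⁻¹' {y | y - intVec n ∈ cube 2} := fun n => by
      ext y; simp [column, proj_sub_horiz]
    rw [heq, heq]
    exact (pairwise_disjoint_cube 2 hne).preimage proj
  · filter_upwards [ae_restrict_mem hΩ.measurableSet] with x hx y n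
    have : horiz n = intVec ![n 0, n 1, 0] := E3_ext (by simp [horiz]) (by simp [horiz])
      (by simp [horiz])
    rw [this]
    exact periodic_intVec (q := fun y => q (x, y)) (hq.periodic x hx) _ y
  · intro x y hxy
    have hmem : y - horiz (fun i => ⌊proj y i⌋) ∈ column := by
      intro i
      rw [proj_sub_horiz]
      have : (proj y - intVec fun i => ⌊proj y i⌋) i = Int.fract (proj y i) := by
        simp [← Int.self_sub_floor]
      rw [this]
      exact ⟨Int.fract_nonneg _, Int.fract_lt_one _⟩
    refine ⟨_, ?_, hmem⟩
    by_contra hn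
    refine hs' (x, y - horiz fun i => ⌊proj y i⌋) (hcol _ hmem).1 (hcol _ hmem).2 _ hn ?_
    have he : (x, y - horiz fun i => ⌊proj y i⌋) + (0, horiz fun i => ⌊proj y i⌋) = (x, y) :=
      Prod.ext (by simp) (by simp)
    rw [he]
    by_contra h
    have h0 : fderiv ℝ a (x, y) = 0 := by
      have := (notMem_tsupport_iff_eventuallyEq.1 h).fderiv_eq (𝕜 := ℝ)
      rw [this]; simp
    exact hxy (by rw [dY, h0]; rfl)
  · rw [IntegrableOn, hmeas]
    refine (hq.integrable hvol).mul_bdd (c := B) ?_ (ae_of_all _ fun z => hB _)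
    exact (hdc.comp (by fun_prop)).aestronglyMeasurable

/-- Periodic extension from the unit square. -/
def perExt (G : E3 × E2 → ℂ) (z : E3 × E2) : ℂ := G (z.1, z.2 - intVec fun i => ⌊z.2 i⌋)

theorem perExt_add (G : E3 × E2 → ℂ) (x : E3) (y : E2) (n : Fin 2 → ℤ) :
    perExt G (x, y + intVec n) = perExt G (x, y) := by
  unfold perExt
  congr 2
  ext i
  simp

theorem perExt_eq {G : E3 × E2 → ℂ} {x : E3} {y : E2} (hy : y ∈ cube 2) :
    perExt G (x, y) = G (x, y) := by
  unfold perExt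
  congr 2
  ext i
  simp [Int.floor_eq_zero_iff.2 (hy i)]

theorem perExt_ae_eq {Ω : Set E3} (G : E3 × E2 → ℂ) : perExt G =ᵐ[surfMeasure Ω] G := by
  rw [surfMeasure, ← restrict_cube_two, ← restrict_univ_prod]
  filter_upwards [ae_restrict_mem (MeasurableSet.univ.prod (measurableSet_cube 2))] with z hz
  exact perExt_eq hz.2

/-- The representative G matters only on the unit square; its periodic extension is what turns a
whole-plane integral into one against the periodization of a. -/
theorem unfold_surface {Ω : Set E3} (hvol : volume Ω < ∞) {G : E3 × E2 → ℂ}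
    (hG : MemLp G 2 (surfMeasure Ω)) {a : E3 × E3 → ℂ} (ha : HasCompactSupport a)
    (hs : Continuous a) :
    Integrable (fun z : E3 × E2 => perExt G z * a (z.1, lift z.2 0))
      ((volume.restrict Ω).prod volume) ∧
    ∫ z : E3 × E2, perExt G z * a (z.1, lift z.2 0) ∂((volume.restrict Ω).prod volume) =
      ∫ z : E3 × E2, G z * periodize a (z.1, lift z.2 0) ∂(surfMeasure Ω) := by
  have := isFiniteMeasure_surfMeasure hvol
  obtain ⟨s, hs'⟩ := exists_finset_periodize ha 2
  obtain ⟨B, hB⟩ := hs.bounded_above_of_compact_support ha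
  have hGp : MemLp (perExt G) 2 (surfMeasure Ω) := hG.ae_eq (perExt_ae_eq G).symm
  have hmeas : ((volume.restrict Ω).prod volume).restrict (univ ×ˢ cube 2) = surfMeasure Ω := by
    rw [restrict_univ_prod, restrict_cube_two]; rfl
  have hcol : ∀ y ∈ cube 2, |y 0| < 2 ∧ |y 1| < 2 := fun y hy => by
    have h0 : y 0 ∈ Ico (0 : ℝ) 1 := hy 0
    have h1 : y 1 ∈ Ico (0 : ℝ) 1 := hy 1
    rw [abs_of_nonneg h0.1, abs_of_nonneg h1.1]
    exact ⟨by linarith [h0.2], by linarith [h1.2]⟩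
  have hunf := unfold_periodic (m := volume.restrict Ω) (ν := (volume : Measure E2)) (s := s)
    (q := perExt G) (a := fun z : E3 × E2 => a (z.1, lift z.2 0)) (w := intVec)
    (measurableSet_cube 2) (fun n => measurePreserving_add_right _ _) (pairwise_disjoint_cube 2)
    (ae_of_all _ fun x y n => perExt_add G x y n) ?_ fun n _ => ?_
  · refine ⟨hunf.1, hunf.2.trans ?_⟩
    rw [← hmeas]
    refine setIntegral_congr_fun (MeasurableSet.univ.prod (measurableSet_cube 2)) ?_
    rintro ⟨x, y⟩ ⟨-, hz⟩
    dsimp only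
    rw [perExt_eq hz, periodize_eq_sum hs' (by simpa using (hcol y hz).1)
      (by simpa using (hcol y hz).2)]
    congr 1
    refine Finset.sum_congr rfl fun n _ => ?_
    congr 1
    refine Prod.ext (by simp) (E3_ext ?_ ?_ ?_) <;> simp [horiz]
  · intro x y hxy
    have hmem : y - intVec (fun i => ⌊y i⌋) ∈ cube 2 := by
      intro i
      have : (y - intVec fun i => ⌊y i⌋) i = Int.fract (y i) := by
        simp [← Int.self_sub_floor]
      rw [this]
      exact ⟨Int.fract_nonneg _, Int.fract_lt_one _⟩
    refine ⟨_, ?_, hmem⟩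
    by_contra hn
    refine hs' (x, lift (y - intVec fun i => ⌊y i⌋) 0) (hcol _ hmem).1 (hcol _ hmem).2 _ hn ?_
    have he : (x, lift (y - intVec fun i => ⌊y i⌋) 0) + (0, horiz fun i => ⌊y i⌋) =
        (x, lift y 0) :=
      Prod.ext (by simp) (E3_ext (by simp [horiz]) (by simp [horiz]) (by simp [horiz]))
    rw [he]
    exact subset_tsupport _ hxy
  · rw [IntegrableOn, hmeas]
    refine (hGp.integrable (by norm_num)).mul_bdd (c := B) ?_ (ae_of_all _ fun z => hB _)
    exact (hs.comp (by fun_prop)).aestronglyMeasurable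

/-! #### Integration by parts in the half space -/

section HalfSpace

variable {h : E3 → ℂ}

theorem integrable_pderiv (hs : ContDiff ℝ (⊤ : ℕ∞) h) (hc : HasCompactSupport h) (i : Fin 3) :
    Integrable (pderiv i h) := by
  refine Continuous.integrable_of_hasCompactSupport
    ((hs.continuous_fderiv (by simp)).clm_apply continuous_const) ?_
  exact (hc.fderiv (𝕜 := ℝ)).comp_left
    (g := fun L : E3 →L[ℝ] ℂ => L (EuclideanSpace.single i 1)) (by simp)

theorem upper_eq : upper = {y : E3 | proj y ∈ univ ∧ y 2 ∈ Ioi (0 : ℝ)} := by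
  ext y; simp [upper]

theorem integrable_pderiv_lift (hs : ContDiff ℝ (⊤ : ℕ∞) h) (hc : HasCompactSupport h)
    (i : Fin 3) : Integrable (fun z : E2 × ℝ => pderiv i h (lift z.1 z.2))
      (volume.prod (volume.restrict (Ioi 0))) := by
  have := integrable_lift_iff.2 (upper_eq ▸ (integrable_pderiv hs hc i).integrableOn (s := upper))
  rwa [Measure.restrict_univ] at this

theorem setIntegral_upper_pderiv_eq (i : Fin 3) : ∫ y in upper, pderiv i h y =
    ∫ z : E2 × ℝ, pderiv i h (lift z.1 z.2) ∂(volume.prod (volume.restrict (Ioi 0))) := by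
  rw [upper_eq, setIntegral_lift, Measure.restrict_univ]

theorem hasFDerivAt_lift_left (y : E2) (s : ℝ) :
    HasFDerivAt (fun y => lift y s) (liftL.comp (ContinuousLinearMap.inl ℝ E2 ℝ)) y :=
  liftL.hasFDerivAt.comp y (hasFDerivAt_prodMk_left y s)

theorem hasFDerivAt_lift_right (y : E2) (s : ℝ) :
    HasFDerivAt (fun s => lift y s) (liftL.comp (ContinuousLinearMap.inr ℝ E2 ℝ)) s :=
  liftL.hasFDerivAt.comp s (hasFDerivAt_prodMk_right y s)

theorem hasCompactSupport_lift_left (hc : HasCompactSupport h) (s : ℝ) :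
    HasCompactSupport fun y => h (lift y s) :=
  HasCompactSupport.intro (hc.isCompact.image continuous_proj) fun y hy => by
    by_contra hne
    exact hy ⟨lift y s, subset_tsupport _ hne, by simp⟩

theorem hasCompactSupport_lift_right (hc : HasCompactSupport h) (y : E2) :
    HasCompactSupport fun s => h (lift y s) :=
  HasCompactSupport.intro (hc.isCompact.image vertL.continuous) fun s hs => by
    by_contra hne
    exact hs ⟨lift y s, subset_tsupport _ hne, by simp [vertL]⟩

theorem setIntegral_upper_pderiv_horizontal (hs : ContDiff ℝ (⊤ : ℕ∞) h)
    (hc : HasCompactSupport h) {i : Fin 3} (hi : i ≠ 2) : ∫ y in upper, pderiv i h y = 0 := by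
  obtain ⟨i', hi'⟩ : ∃ i' : Fin 2, EuclideanSpace.single i (1 : ℝ) =
      lift (EuclideanSpace.single i' 1) 0 := by
    fin_cases i
    · exact ⟨0, E3_ext (by simp) (by simp) (by simp)⟩
    · exact ⟨1, E3_ext (by simp) (by simp) (by simp)⟩
    · exact absurd rfl hi
  rw [setIntegral_upper_pderiv_eq, integral_prod_symm _ (integrable_pderiv_lift hs hc i)]
  refine integral_eq_zero_of_ae (ae_of_all _ fun s => ?_)
  have hd : Differentiable ℝ h := hs.differentiable (by simp)
  have hs' : ContDiff ℝ (⊤ : ℕ∞) fun y => h (lift y s) :=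
    hs.comp (liftL.contDiff.comp (contDiff_id.prodMk contDiff_const))
  have hc' := hasCompactSupport_lift_left hc s
  have heq : ∀ y, pderiv i h (lift y s) =
      fderiv ℝ (fun y => h (lift y s)) y (EuclideanSpace.single i' 1) := fun y => by
    have := (hd (lift y s)).hasFDerivAt.comp y (hasFDerivAt_lift_left y s)
    rw [show (fun y => h (lift y s)) = h ∘ fun y => lift y s from rfl, this.fderiv, pderiv, hi']
    rfl
  have hint : Integrable fun y => fderiv ℝ (fun y => h (lift y s)) y (EuclideanSpace.single i' 1) :=
    Continuous.integrable_of_hasCompactSupport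
      ((hs'.continuous_fderiv (by simp)).clm_apply continuous_const)
      ((hc'.fderiv (𝕜 := ℝ)).comp_left
        (g := fun L : E2 →L[ℝ] ℂ => L (EuclideanSpace.single i' 1)) (by simp))
  -- Integration by parts against the constant 1.
  have := integral_mul_fderiv_eq_neg_fderiv_mul_of_integrable (μ := (volume : Measure E2))
    (f := fun _ => (1 : ℂ)) (g := fun y => h (lift y s)) (v := EuclideanSpace.single i' 1)
    (by simp) (by simpa using hint)
    (by simpa using hs'.continuous.integrable_of_hasCompactSupport hc')
    (fun _ _ => differentiableAt_const _) (fun y _ => hs'.differentiable (by simp) y)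
  simpa [heq] using this

theorem setIntegral_upper_pderiv_vertical (hs : ContDiff ℝ (⊤ : ℕ∞) h)
    (hc : HasCompactSupport h) : ∫ y in upper, pderiv 2 h y = -∫ y, h (lift y 0) := by
  have he : EuclideanSpace.single 2 (1 : ℝ) = lift 0 1 := E3_ext (by simp) (by simp) (by simp)
  rw [setIntegral_upper_pderiv_eq, integral_prod _ (integrable_pderiv_lift hs hc 2),
    ← integral_neg]
  refine integral_congr_ae (ae_of_all _ fun y => ?_)
  have hd : Differentiable ℝ h := hs.differentiable (by simp)
  have hs' : ContDiff ℝ (⊤ : ℕ∞) fun s => h (lift y s) :=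
    hs.comp (liftL.contDiff.comp (contDiff_const.prodMk contDiff_id))
  have heq : ∀ s, pderiv 2 h (lift y s) = deriv (fun s => h (lift y s)) s := fun s => by
    have := (hd (lift y s)).hasFDerivAt.comp s (hasFDerivAt_lift_right y s)
    rw [show (fun s => h (lift y s)) = h ∘ fun s => lift y s from rfl, this.hasDerivAt.deriv,
      pderiv, he]
    rfl
  simp only [heq]
  exact (hasCompactSupport_lift_right hc y).integral_Ioi_deriv_eq (hs'.of_le (by simp)) 0

end HalfSpace

theorem hasCompactSupport_slice {W : Type*} [NormedAddCommGroup W] {a : E3 × E3 → W}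
    (ha : HasCompactSupport a) (x : E3) : HasCompactSupport fun y => a (x, y) :=
  HasCompactSupport.intro (ha.isCompact.image continuous_snd) fun y hy => by
    by_contra hne
    exact hy ⟨(x, y), subset_tsupport _ hne, rfl⟩

theorem contDiff_slice {W : Type*} [NormedAddCommGroup W] [NormedSpace ℝ W] {a : E3 × E3 → W}
    (hs : ContDiff ℝ (⊤ : ℕ∞) a) (x : E3) : ContDiff ℝ (⊤ : ℕ∞) fun y => a (x, y) :=
  hs.comp (contDiff_const.prodMk contDiff_id)

theorem isCellFun_fst {Ω : Set E3} {e : E3 → ℂ} (he : MemLp e 2 (volume.restrict Ω)) :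
    IsCellFun Ω fun z => e z.1 where
  memLp := he.comp_fst _
  periodic _ _ _ _ := rfl

/-- Functions of `x` alone do not contribute inside the cell. -/
theorem green_fst {Ω : Set E3} (hΩ : IsOpen Ω) (hvol : volume Ω < ∞) {e e2 : E3 → ℂ}
    (he : MemLp e 2 (volume.restrict Ω)) (he2 : MemLp e2 2 (volume.restrict Ω))
    {a : E3 × E3 → ℂ} (ha : HasCompactSupport a) (hs : ContDiff ℝ (⊤ : ℕ∞) a) {j : Fin 3}
    (hj : j ≠ 2) :
    -(∫ z, e z.1 * dY 2 a z ∂(upperMeasure Ω)) + ∫ z, e2 z.1 * dY j a z ∂(upperMeasure Ω) =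
      ∫ z : E3 × E2, e z.1 * a (z.1, lift z.2 0) ∂((volume.restrict Ω).prod volume) := by
  have hd : Differentiable ℝ a := hs.differentiable (by simp)
  have hI : ∀ {e : E3 → ℂ}, MemLp e 2 (volume.restrict Ω) → ∀ i,
      ∫ z, e z.1 * dY i a z ∂(upperMeasure Ω) =
        ∫ x in Ω, e x * ∫ y in upper, pderiv i (fun y => a (x, y)) y := fun {e} he i => by
    have := (isCellFun_fst he).integrable_mul_upper hΩ hvol (contDiff_dY hs i).continuous
      (hasCompactSupport_dY ha i)
    rw [upperMeasure] at this ⊢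
    rw [integral_prod _ this]
    simp only [integral_const_mul, dY_eq_pderiv hd]
  have hS : Integrable (fun z : E3 × E2 => e z.1 * a (z.1, lift z.2 0))
      ((volume.restrict Ω).prod volume) :=
    (unfold_surface (G := fun z => e z.1) hvol (he.comp_fst _) ha hs.continuous).1
  rw [hI he, hI he2, integral_prod _ hS, ← integral_neg]
  simp only [integral_const_mul, setIntegral_upper_pderiv_vertical (contDiff_slice hs _)
    (hasCompactSupport_slice ha _), setIntegral_upper_pderiv_horizontal (contDiff_slice hs _)
    (hasCompactSupport_slice ha _) hj]
  simp

/-! #### Curl-free fields -/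

theorem dY_comm {f : E3 × E3 → ℂ} (hs : ContDiff ℝ (⊤ : ℕ∞) f) (j k : Fin 3) (z : E3 × E3) :
    dY j (dY k f) z = dY k (dY j f) z := by
  have hsymm : IsSymmSndFDerivAt ℝ f z := 
    ((hs.of_le (m := 2) (WithTop.coe_le_coe.2 (le_top : (2 : ℕ∞) ≤ ⊤))).contDiffAt).isSymmSndFDerivAt
      (by simp)
  have hd : DifferentiableAt ℝ (fderiv ℝ f) z :=
    (hs.fderiv_right (m := (⊤ : ℕ∞)) (by simp)).differentiable (by simp) z
  have h : ∀ v w, fderiv ℝ (fun z => fderiv ℝ f z v) z w = fderiv ℝ (fderiv ℝ f) z w v :=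
    fun v w => by
      rw [fderiv_clm_apply hd (differentiableAt_const v)]; simp
  change fderiv ℝ (fun z => fderiv ℝ f z _) z _ = fderiv ℝ (fun z => fderiv ℝ f z _) z _
  rw [h, h, hsymm.eq]

theorem tsupport_dY_subset (f : E3 × E3 → ℂ) (i : Fin 3) : tsupport (dY i f) ⊆ tsupport f := by
  refine closure_minimal (fun z hz => ?_) (isClosed_tsupport f)
  by_contra h
  have h0 : fderiv ℝ f z = 0 := by
    have := (notMem_tsupport_iff_eventuallyEq.1 h).fderiv_eq (𝕜 := ℝ)
    rw [this]; simp
  exact hz (by rw [dY, h0]; rfl)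

theorem isTest_dY {U : Set (E3 × E3)} {f : E3 × E3 → ℂ} (hf : IsTest U f) (i : Fin 3) :
    IsTest U (dY i f) :=
  ⟨contDiff_dY hf.1 i, hasCompactSupport_dY hf.2.1 i, (tsupport_dY_subset f i).trans hf.2.2⟩

/-- A weak gradient is curl-free. -/
theorem IsWeakGradY.curl_free {Ω : Set E3} {φ : E3 → E3 → ℂ} {p : E3 → E3 → C3}
    (hp : IsWeakGradY Ω φ p) {f : E3 × E3 → ℂ} (hf : IsTest (Ω ×ˢ univ) f) (j k : Fin 3) :
    ∫ z, p z.1 z.2 j * dY k f z ∂((volume.restrict Ω).prod volume) =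
      ∫ z, p z.1 z.2 k * dY j f z ∂((volume.restrict Ω).prod volume) := by
  have h : ∀ i, Differentiable ℝ (dY i f) := fun i => (contDiff_dY hf.1 i).differentiable (by simp)
  -- The definition of the weak gradient is applied to the test functions ∂_k f and ∂_j f, whose
  -- mixed derivatives agree.
  have h1 := hp _ (isTest_dY hf k) j
  have h2 := hp _ (isTest_dY hf j) k
  rw [← neg_inj, ← h1, ← h2]
  refine integral_congr_ae (ae_of_all _ fun z => ?_)
  dsimp only
  rw [← dY_eq_pderiv (h k), ← dY_eq_pderiv (h j), dY_comm hf.1]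

/-- For test functions that vanish below some height, the curl-free relation holds in the half
space. -/
theorem IsWeakGradY.curl_free_upper {Ω : Set E3} {φ : E3 → E3 → ℂ} {p : E3 → E3 → C3}
    (hp : IsWeakGradY Ω φ p) {f : E3 × E3 → ℂ} (hf : IsTest (Ω ×ˢ univ) f) {δ : ℝ} (hδ : 0 < δ)
    (hf0 : ∀ x y, y 2 < δ → f (x, y) = 0) (j k : Fin 3) :
    ∫ z, p z.1 z.2 j * dY k f z ∂(upperMeasure Ω) =
      ∫ z, p z.1 z.2 k * dY j f z ∂(upperMeasure Ω) := by
  have h0 : ∀ i (z : E3 × E3), z ∉ (univ : Set E3) ×ˢ upper → dY i f z = 0 := fun i z hz => by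
    have hz : z.2 2 ≤ 0 := by simpa [upper] using hz
    have : f =ᶠ[𝓝 z] fun _ => 0 := by
      have ho : IsOpen {z : E3 × E3 | z.2 2 < δ} := isOpen_lt (by fun_prop) continuous_const
      filter_upwards [ho.mem_nhds (show z.2 2 < δ by linarith)] with w hw
      exact hf0 w.1 w.2 hw
    rw [dY, this.fderiv_eq]; simp
  rw [upperMeasure_eq, setIntegral_eq_integral_of_forall_compl_eq_zero (fun z hz => by
    rw [h0 k z hz, mul_zero]), setIntegral_eq_integral_of_forall_compl_eq_zero (fun z hz => by
    rw [h0 j z hz, mul_zero]), hp.curl_free hf]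

/-! #### The tangential trace in the cell -/

theorem IsCorrector.isCellFun {Ω : Set E3} {φ : E3 → E3 → ℂ} {p : E3 → E3 → C3}
    (h : IsCorrector Ω φ p) (i : Fin 3) : IsCellFun Ω fun z => p z.1 z.2 i where
  memLp := memLp_component h.memLp_grad i
  periodic x hx y k := by simp only [h.periodic_grad x hx y k]

theorem IsCellFun.add {Ω : Set E3} {q r : E3 × E3 → ℂ} (hq : IsCellFun Ω q) (hr : IsCellFun Ω r) :
    IsCellFun Ω fun z => q z + r z where
  memLp := hq.memLp.add hr.memLp
  periodic x hx y k := by simp only [hq.periodic x hx y k, hr.periodic x hx y k]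

theorem isTest_smul {U : Set (E3 × E3)} {f : E3 × E3 → ℂ} (hf : IsTest U f) {η : E3 × E3 → ℝ}
    (hη : ContDiff ℝ (⊤ : ℕ∞) η) : IsTest U fun z => η z • f z := by
  have h : Function.support (fun z => η z • f z) ⊆ Function.support f := fun z hz h0 =>
    hz (by simp only [h0, smul_zero])
  exact ⟨hη.smul hf.1, hf.2.1.mono h, (closure_mono h).trans hf.2.2⟩

theorem dY_add {f g : E3 × E3 → ℂ} (hf : ContDiff ℝ (⊤ : ℕ∞) f) (hg : ContDiff ℝ (⊤ : ℕ∞) g)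
    (i : Fin 3) (z : E3 × E3) : dY i (fun z => f z + g z) z = dY i f z + dY i g z := by
  have h1 := hf.differentiable (by simp) z
  have h2 := hg.differentiable (by simp) z
  rw [dY, fderiv_fun_add h1 h2]; rfl

/-- The sheet pairings with the periodization of a have two known limits, one from Green's formula
on the sheets and one from the representation by G. Their equality, unfolded from the cell to the
half space, is the claim. -/
theorem SheetSequence.green_of_top {S : Set E2} (hS : IsOpen S) {L M : ℝ} {d : ℕ → ℝ} {j : Fin 3}
    {v uj u2 g : ℕ → E3 → ℂ} {uj₀ u2₀ : E3 × E3 → ℂ}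
    (h : SheetSequence S L M d j v uj u2 g uj₀ u2₀) {G : E3 × E2 → ℂ}
    (hG : MemLp G 2 (surfMeasure (cyl S L)))
    (hlim : ∀ K f, IsCompact K → K ⊆ cyl S L → IsLayer K f → ContDiff ℝ (⊤ : ℕ∞) f →
        Tendsto (fun l => sheetPairing S L (d l) (g l) f) atTop
          (𝓝 (∫ z, G z * f (z.1, lift z.2 0) ∂(surfMeasure (cyl S L)))))
    (huj : IsCellFun (cyl S L) uj₀) (hu2 : IsCellFun (cyl S L) u2₀) {a : E3 × E3 → ℂ}
    (ha : IsTest (cyl S L ×ˢ univ) a) (htop : ∀ x y, 1 / 2 < y 2 → a (x, y) = 0) :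
    -(∫ z, uj₀ z * dY 2 a z ∂(upperMeasure (cyl S L))) +
      ∫ z, u2₀ z * dY j a z ∂(upperMeasure (cyl S L)) =
      ∫ z : E3 × E2, perExt G z * a (z.1, lift z.2 0)
        ∂((volume.restrict (cyl S L)).prod volume) := by
  have hvol := volume_cyl_lt_top h.bounded L
  have hΩ := isOpen_cyl hS L
  have hK : IsCompact (Prod.fst '' tsupport a) := ha.2.1.isCompact.image continuous_fst
  have hKS : Prod.fst '' tsupport a ⊆ cyl S L := by
    rintro _ ⟨z, hz, rfl⟩
    exact (ha.2.2 hz).1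
  have hf := isLayer_periodize ha.2.1 ha.1 htop
  have hs := contDiff_periodize ha.2.1 ha.1
  rw [unfold_upper hΩ hvol huj ha.2.1 ha.1 htop, unfold_upper hΩ hvol hu2 ha.2.1 ha.1 htop,
    (unfold_surface hvol hG ha.2.1 ha.1.continuous).2]
  exact tendsto_nhds_unique
    (tendsto_sheets_layer h.bounded h.d_lim h.d_pos h.twoScale_uj h.twoScale_u2 h.v_memLp h.v_bound
      h.trace hK hKS hf hs) (hlim _ _ hK hKS hf hs)

/-- The test function splits into a part near Σ₀, covered by `green_of_top`, and a part vanishing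
near Σ₀, on which curl-freeness cancels both terms. The contribution of e and e2, constant in y, is
computed by `green_fst` and produces the subtraction of e from G. -/
theorem SheetSequence.cell_green {S : Set E2} (hS : IsOpen S) {L M : ℝ} {d : ℕ → ℝ} {j : Fin 3}
    {v uj u2 g : ℕ → E3 → ℂ} {e e2 : E3 → ℂ} {φ : E3 → E3 → ℂ} {p : E3 → E3 → C3}
    (h : SheetSequence S L M d j v uj u2 g (fun z => e z.1 + p z.1 z.2 j)
      (fun z => e2 z.1 + p z.1 z.2 2)) {G : E3 × E2 → ℂ}
    (hG : MemLp G 2 (surfMeasure (cyl S L)))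
    (hlim : ∀ K f, IsCompact K → K ⊆ cyl S L → IsLayer K f → ContDiff ℝ (⊤ : ℕ∞) f →
        Tendsto (fun l => sheetPairing S L (d l) (g l) f) atTop
          (𝓝 (∫ z, G z * f (z.1, lift z.2 0) ∂(surfMeasure (cyl S L)))))
    (he : MemLp e 2 (volume.restrict (cyl S L))) (he2 : MemLp e2 2 (volume.restrict (cyl S L)))
    (hφ : IsCorrector (cyl S L) φ p) (hj : j ≠ 2) {a : E3 × E3 → ℂ}
    (ha : IsTest (cyl S L ×ˢ univ) a) :
    -(∫ z, p z.1 z.2 j * dY 2 a z ∂(upperMeasure (cyl S L))) +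
      ∫ z, p z.1 z.2 2 * dY j a z ∂(upperMeasure (cyl S L)) =
      ∫ z : E3 × E2, (perExt G z - e z.1) * a (z.1, lift z.2 0)
        ∂((volume.restrict (cyl S L)).prod volume) := by
  have hvol := volume_cyl_lt_top h.bounded L
  have hΩ := isOpen_cyl hS L
  set a1 : E3 × E3 → ℂ := fun z => cutoff (z.2 2) • a z with ha1
  set a2 : E3 × E3 → ℂ := fun z => (1 - cutoff (z.2 2)) • a z with ha2
  have h1 : IsTest (cyl S L ×ˢ univ) a1 := isTest_smul ha contDiff_cutoff_vert
  have h2 : IsTest (cyl S L ×ˢ univ) a2 := isTest_smul ha (contDiff_const.sub contDiff_cutoff_vert)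
  have hsum : a = fun z => a1 z + a2 z := by
    funext z; simp only [ha1, ha2, ← add_smul]; simp
  have hint : ∀ {q : E3 × E3 → ℂ}, IsCellFun (cyl S L) q → ∀ {f}, IsTest (cyl S L ×ˢ univ) f →
      ∀ i, Integrable (fun z => q z * dY i f z) (upperMeasure (cyl S L)) := fun hq _ hf i =>
    hq.integrable_mul_upper hΩ hvol (contDiff_dY hf.1 i).continuous (hasCompactSupport_dY hf.2.1 i)
  have hsplit : ∀ k i, ∫ z, p z.1 z.2 k * dY i a z ∂(upperMeasure (cyl S L)) =
      (∫ z, p z.1 z.2 k * dY i a1 z ∂(upperMeasure (cyl S L))) +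
      ∫ z, p z.1 z.2 k * dY i a2 z ∂(upperMeasure (cyl S L)) := fun k i => by
    rw [← integral_add (hint (hφ.isCellFun k) h1 i) (hint (hφ.isCellFun k) h2 i)]
    refine integral_congr_ae (ae_of_all _ fun z => ?_)
    dsimp only
    rw [hsum, dY_add h1.1 h2.1, mul_add]
  have hadd : ∀ {e : E3 → ℂ}, MemLp e 2 (volume.restrict (cyl S L)) → ∀ k i,
      ∫ z, (e z.1 + p z.1 z.2 k) * dY i a1 z ∂(upperMeasure (cyl S L)) =
      (∫ z, e z.1 * dY i a1 z ∂(upperMeasure (cyl S L))) +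
      ∫ z, p z.1 z.2 k * dY i a1 z ∂(upperMeasure (cyl S L)) := fun he k i => by
    rw [← integral_add (hint (isCellFun_fst he) h1 i) (hint (hφ.isCellFun k) h1 i)]
    simp only [add_mul]
  -- The cutoff is identically 1 up to height 1/4, so the second part vanishes there.
  have hfree := hφ.grad.curl_free_upper h2 (δ := 1 / 4) (by norm_num)
    (fun x y hy => by simp [ha2, cutoff_eq_one hy.le]) j 2
  have hgreen := h.green_of_top hS hG hlim ((isCellFun_fst he).add (hφ.isCellFun j))
    ((isCellFun_fst he2).add (hφ.isCellFun 2)) h1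
    (fun x y hy => by simp [ha1, cutoff_eq_zero hy.le])
  have hfst := green_fst hΩ hvol he he2 h1.2.1 h1.1 hj
  have hi1 := (unfold_surface hvol hG ha.2.1 ha.1.continuous).1
  have hi2 : Integrable (fun z : E3 × E2 => e z.1 * a (z.1, lift z.2 0))
      ((volume.restrict (cyl S L)).prod volume) :=
    (unfold_surface (G := fun z => e z.1) hvol (he.comp_fst _) ha.2.1 ha.1.continuous).1
  have hval : ∀ z : E3 × E2, a1 (z.1, lift z.2 0) = a (z.1, lift z.2 0) := fun z => by
    simp [ha1, cutoff_eq_one]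
  simp only [hval] at hgreen hfst
  simp only [sub_mul]
  rw [integral_sub hi1 hi2, ← hgreen, ← hfst, hsplit, hsplit, hadd he, hadd he2, hfree]
  ring

/-! #### The vertical component of Green's formula -/

theorem dY_smul_vert {η : ℝ → ℝ} (hη : ContDiff ℝ (⊤ : ℕ∞) η) {f : E3 × E3 → ℂ}
    (hf : ContDiff ℝ (⊤ : ℕ∞) f) {i : Fin 3} (hi : i ≠ 2) (z : E3 × E3) :
    dY i (fun z => η (z.2 2) • f z) z = η (z.2 2) • dY i f z := by
  have hv : HasFDerivAt (fun z : E3 × E3 => z.2 2) (vertL.comp (ContinuousLinearMap.snd ℝ E3 E3)) z :=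
    (vertL.comp (ContinuousLinearMap.snd ℝ E3 E3)).hasFDerivAt
  have h1 : HasFDerivAt (fun z : E3 × E3 => η (z.2 2)) _ z :=
    (hη.differentiable (by simp) (z.2 2)).hasDerivAt.comp_hasFDerivAt z hv
  have h2 := (hf.differentiable (by simp) z).hasFDerivAt
  have h3 : fderiv ℝ (fun z : E3 × E3 => η (z.2 2) • f z) z = _ := (h1.smul h2).fderiv
  rw [dY, h3]
  simp [dY, vertL, Ne.symm hi]

/-- A cutoff depending only on the height commutes with horizontal derivatives. It can thus be
inserted to keep away from Σ₀ and removed by dominated convergence without leaving a boundary term.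
-/
theorem IsCorrector.curl_free_horizontal {Ω : Set E3} (hΩ : IsOpen Ω) (hvol : volume Ω < ∞)
    {φ : E3 → E3 → ℂ} {p : E3 → E3 → C3} (hφ : IsCorrector Ω φ p) {a : E3 × E3 → ℂ}
    (ha : IsTest (Ω ×ˢ univ) a) {j k : Fin 3} (hj : j ≠ 2) (hk : k ≠ 2) :
    ∫ z, p z.1 z.2 j * dY k a z ∂(upperMeasure Ω) =
      ∫ z, p z.1 z.2 k * dY j a z ∂(upperMeasure Ω) := by
  -- η n vanishes up to height 1/(4n) and equals 1 from 1/(2n) on.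
  set η : ℕ → ℝ → ℝ := fun n t => 1 - cutoff (n * t) with hη
  have hηs : ∀ n, ContDiff ℝ (⊤ : ℕ∞) (η n) := fun n =>
    contDiff_const.sub (contDiff_cutoff.comp (contDiff_const.mul contDiff_id))
  have hη1 : ∀ n t, ‖η n t‖ ≤ 1 := fun n t => by
    rw [Real.norm_eq_abs, abs_le]
    constructor <;> simp only [hη] <;> linarith [cutoff_nonneg (n * t), cutoff_le_one (n * t)]
  have hlim : ∀ t > 0, Tendsto (fun n => η n t) atTop (𝓝 1) := fun t ht => by
    obtain ⟨N, hN⟩ := exists_nat_gt (1 / t)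
    refine tendsto_const_nhds.congr' ?_
    filter_upwards [eventually_ge_atTop N] with n hn
    have h1 : (1 : ℝ) ≤ n * t := by
      rw [div_lt_iff₀ ht] at hN
      have : (N : ℝ) ≤ n := by exact_mod_cast hn
      nlinarith
    simp only [hη]
    rw [cutoff_eq_zero (by linarith), sub_zero]
  have key : ∀ i k, k ≠ 2 → Tendsto (fun n : ℕ => ∫ z, p z.1 z.2 i *
      dY k (fun z => η n (z.2 2) • a z) z ∂(upperMeasure Ω)) atTop
      (𝓝 (∫ z, p z.1 z.2 i * dY k a z ∂(upperMeasure Ω))) := fun i k hk => by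
    have hint := fun f (hf : IsTest (Ω ×ˢ univ) f) => (hφ.isCellFun i).integrable_mul_upper hΩ hvol
      (contDiff_dY hf.1 k).continuous (hasCompactSupport_dY hf.2.1 k)
    refine tendsto_integral_of_dominated_convergence (fun z => ‖p z.1 z.2 i * dY k a z‖)
      (fun n => (hint _ (isTest_smul ha ((hηs n).comp
        (vertL.contDiff.comp contDiff_snd)))).aestronglyMeasurable) (hint a ha).norm
      (fun n => ae_of_all _ fun z => ?_) ?_
    · dsimp only
      rw [dY_smul_vert (hηs n) ha.1 hk, mul_smul_comm, norm_smul]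
      exact mul_le_of_le_one_left (norm_nonneg _) (hη1 _ _)
    · rw [upperMeasure_eq]
      filter_upwards [ae_restrict_mem (MeasurableSet.univ.prod isOpen_upper.measurableSet)]
        with z hz
      have := ((hlim _ hz.2).smul_const (p z.1 z.2 i * dY k a z))
      simp only [one_smul] at this
      refine this.congr fun n => ?_
      rw [dY_smul_vert (hηs n) ha.1 hk, mul_smul_comm]
  refine tendsto_nhds_unique_of_eventuallyEq (key j k hk) (key k j hj) ?_
  filter_upwards [eventually_gt_atTop 0] with n hn
  have hn : (0 : ℝ) < n := by exact_mod_cast hn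
  refine hφ.grad.curl_free_upper (isTest_smul ha ((hηs n).comp (vertL.contDiff.comp contDiff_snd)))
    (δ := 1 / (4 * n)) (by positivity) (fun x y hy => ?_) j k
  have h1 : n * y 2 ≤ 1 / 4 := by
    rw [lt_div_iff₀ (by positivity)] at hy
    linarith
  have h2 : η n (y 2) = 0 := by simp only [hη, cutoff_eq_one h1, sub_self]
  change η n (y 2) • a (x, y) = 0
  rw [h2, zero_smul]

theorem IsTest.component {U : Set (E3 × E3)} {Φ : E3 × E3 → C3} (h : IsTest U Φ) (i : Fin 3) :
    IsTest U fun z => Φ z i := by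
  have hsub : Function.support (fun z => Φ z i) ⊆ Function.support Φ := fun z hz h0 =>
    hz (by simp only [h0, Pi.zero_apply])
  exact ⟨contDiff_pi.1 h.1 i, h.2.1.mono hsub, (closure_mono hsub).trans h.2.2⟩

/-- The tangential trace in the cell, assembled from its two components. -/
theorem isCellTrace_of_components {Ω : Set E3} (hΩ : IsOpen Ω) (hvol : volume Ω < ∞)
    {φ : E3 → E3 → ℂ} {p : E3 → E3 → C3} (hφ : IsCorrector Ω φ p) {e : Fin 2 → E3 → ℂ}
    (he : ∀ j, MemLp (e j) 2 (volume.restrict Ω)) {G : Fin 2 → E3 × E2 → ℂ}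
    (hG : ∀ j, MemLp (G j) 2 (surfMeasure Ω))
    (hgreen : ∀ j : Fin 2, ∀ a, IsTest (Ω ×ˢ univ) a →
      -(∫ z, p z.1 z.2 j.castSucc * dY 2 a z ∂(upperMeasure Ω)) +
        ∫ z, p z.1 z.2 2 * dY j.castSucc a z ∂(upperMeasure Ω) =
      ∫ z : E3 × E2, (perExt (G j) z - e j z.1) * a (z.1, lift z.2 0)
        ∂((volume.restrict Ω).prod volume)) :
    IsCellTrace Ω p fun x y => ![perExt (G 0) (x, y) - e 0 x, perExt (G 1) (x, y) - e 1 x, 0] where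
  periodic x _ y i := by
    have h : EuclideanSpace.single i (1 : ℝ) = intVec (Pi.single i 1) := by
      ext k
      by_cases hk : k = i
      · subst hk; simp
      · simp [hk]
    simp only [h, perExt_add]
  memLp := by
    have h : ∀ j, MemLp (fun z : E3 × E2 => perExt (G j) z - e j z.1) 2 (surfMeasure Ω) := fun j =>
      ((hG j).ae_eq (perExt_ae_eq (G j)).symm).sub ((he j).comp_fst _)
    refine memLp_pi_iff.2 fun i => ?_
    fin_cases i
    · exact h 0
    · exact h 1
    · exact MemLp.zero
  tangential _ _ _ := rfl
  green Φ hΦ := by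
    have hc := fun m => hΦ.component m
    have hd : ∀ m, Differentiable ℝ fun z => Φ z m := fun m => (hc m).1.differentiable (by simp)
    have hds : ∀ x y, DifferentiableAt ℝ (fun y => Φ (x, y)) y := fun x y =>
      (contDiff_slice hΦ.1 x).differentiable (by simp) y
    have hI : ∀ k i m, Integrable (fun z => p z.1 z.2 k * dY i (fun z => Φ z m) z)
        (upperMeasure Ω) := fun k i m => (hφ.isCellFun k).integrable_mul_upper hΩ hvol
      (contDiff_dY (hc m).1 i).continuous (hasCompactSupport_dY (hc m).2.1 i)
    -- The six terms are regrouped by component of Φ: those with Φ₂ cancel by the horizontal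
    -- curl-free relation, and those with Φ₁ and Φ₀ are Green's formula for j = 0 and j = 1.
    have hL : ∫ z, p z.1 z.2 ⬝ᵥ curl (fun y => Φ (z.1, y)) z.2 ∂(upperMeasure Ω) =
        ((∫ z, p z.1 z.2 0 * dY 1 (fun z => Φ z 2) z ∂(upperMeasure Ω)) -
          (∫ z, p z.1 z.2 0 * dY 2 (fun z => Φ z 1) z ∂(upperMeasure Ω))) +
        ((∫ z, p z.1 z.2 1 * dY 2 (fun z => Φ z 0) z ∂(upperMeasure Ω)) -
          (∫ z, p z.1 z.2 1 * dY 0 (fun z => Φ z 2) z ∂(upperMeasure Ω))) +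
        ((∫ z, p z.1 z.2 2 * dY 0 (fun z => Φ z 1) z ∂(upperMeasure Ω)) -
          (∫ z, p z.1 z.2 2 * dY 1 (fun z => Φ z 0) z ∂(upperMeasure Ω))) := by
      have h0 := (hI 0 1 2).sub (hI 0 2 1)
      have h1 := (hI 1 2 0).sub (hI 1 0 2)
      have h2 := (hI 2 0 1).sub (hI 2 1 0)
      rw [← integral_sub (hI 0 1 2) (hI 0 2 1), ← integral_sub (hI 1 2 0) (hI 1 0 2),
        ← integral_sub (hI 2 0 1) (hI 2 1 0)]
      have h3 := integral_add (h0.add h1) h2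
      have h4 := integral_add h0 h1
      simp only [Pi.add_apply, Pi.sub_apply] at h3 h4
      rw [← h4, ← h3]
      refine integral_congr_ae (ae_of_all _ fun z => ?_)
      simp only [curl, pderiv_component (hds _ _), dY_eq_pderiv (hd _), Matrix.vec3_dotProduct,
        Matrix.cons_val]
      ring
    have hfree := hφ.curl_free_horizontal hΩ hvol (hc 2) (j := 0) (k := 1) (by decide) (by decide)
    have hg0 := hgreen 0 _ (hc 1)
    have hg1 := hgreen 1 _ (hc 0)
    have hS : ∀ (j : Fin 2) m, Integrable (fun z : E3 × E2 =>
        (perExt (G j) z - e j z.1) * Φ (z.1, lift z.2 0) m) ((volume.restrict Ω).prod volume) :=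
      fun j m => by
        have h1 := (unfold_surface hvol (hG j) (hc m).2.1 (hc m).1.continuous).1
        have h2 := (unfold_surface (G := fun z => e j z.1) hvol ((he j).comp_fst _) (hc m).2.1
          (hc m).1.continuous).1
        have h3 := h1.sub h2
        refine h3.congr (ae_of_all _ fun z => ?_)
        simp only [perExt, Pi.sub_apply, sub_mul]
    have hR : ∫ z : E3 × E2, ((-e3) ⨯₃ ![perExt (G 0) (z.1, z.2) - e 0 z.1,
          perExt (G 1) (z.1, z.2) - e 1 z.1, 0]) ⬝ᵥ Φ (z.1, lift z.2 0)
          ∂((volume.restrict Ω).prod volume) =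
        (∫ z : E3 × E2, (perExt (G 1) z - e 1 z.1) * Φ (z.1, lift z.2 0) 0
          ∂((volume.restrict Ω).prod volume)) -
        ∫ z : E3 × E2, (perExt (G 0) z - e 0 z.1) * Φ (z.1, lift z.2 0) 1
          ∂((volume.restrict Ω).prod volume) := by
      rw [← integral_sub (hS 1 0) (hS 0 1)]
      refine integral_congr_ae (ae_of_all _ fun z => ?_)
      simp only [e3, cross_apply, Matrix.vec3_dotProduct, Matrix.cons_val, Pi.neg_apply]
      ring
    rw [hR, ← hg0, ← hg1]
    change -(∫ z, p z.1 z.2 ⬝ᵥ curl (fun y => Φ (z.1, y)) z.2 ∂(upperMeasure Ω)) = _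
    rw [hL, hfree]
    simp only [Fin.castSucc_zero, show (Fin.castSucc (1 : Fin 2) : Fin 3) = 1 from rfl]
    ring

/-! ### Components of the solutions -/

theorem scalarTwoScale_component {Ω : Set E3} (hvol : volume Ω < ∞) {d : ℕ → ℝ}
    {u : ℕ → E3 → C3} {u₀ : E3 → E3 → C3} (h : TwoScale Ω d u u₀) {M : ℝ}
    (hM : ∀ l, ∫ x in Ω, nsq (u l x) ≤ M) (i : Fin 3) :
    ScalarTwoScale Ω M d (fun l x => u l x i) (fun z => u₀ z.1 z.2 i) where
  memLp l := memLp_component (h.1 l) i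
  bound l := (integral_mono (integrable_norm_sq (memLp_component (h.1 l) i))
    (integrable_nsq (h.1 l)) fun x => norm_sq_le_nsq _ i).trans (hM l)
  memLp_lim := memLp_component h.2.1 i
  tendsto K hKΩ hK b hb := by
    have : IsFiniteMeasure (volume.restrict Ω) := ⟨by simpa using hvol⟩
    obtain ⟨B, -, hB⟩ := hb.exists_bound hK
    have hlim := h.2.2 (fun x y => b (x, y) • Pi.single i 1)
      (by
        have : Continuous fun z : E3 × E3 => b z • (Pi.single i 1 : C3) :=
          hb.cont.smul continuous_const
        exact this)
      (fun x _ y k => by simp only [hb.periodic x y k])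
      ⟨K, hKΩ, hK, fun x hx y => by simp only [hb.zero x hx y, zero_smul]⟩
    simp only [dotProduct_smul, dotProduct_single, mul_one, smul_eq_mul, mul_comm (b _)] at hlim
    have hint : Integrable (fun z : E3 × E3 => u₀ z.1 z.2 i * b z)
        ((volume.restrict Ω).prod (volume.restrict cellY)) :=
      ((memLp_component h.2.1 i).integrable (by norm_num)).mul_bdd (c := B)
        hb.cont.aestronglyMeasurable (ae_of_all _ fun z => hB z)
    rw [integral_prod _ hint]
    exact hlim

/-- An essential bound holds everywhere on an open set where the function is continuous. -/
theorem IsW1Inf.exists_bound {Ω : Set E3} (hΩ : IsOpen Ω) {f : E3 → E3 → ℂ} (hf : IsW1Inf Ω f) :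
    ∃ B, ∀ x ∈ Ω, ∀ y, ‖f x y‖ ≤ B := by
  have hbdd := hf.bdd
  have hm : (volume.restrict Ω).prod (volume : Measure E3) =
      (volume.prod volume).restrict (Ω ×ˢ univ) := by
    rw [← Measure.prod_restrict, Measure.restrict_univ]
  obtain ⟨B, hB⟩ : ∃ B, ∀ᵐ z ∂((volume.prod volume).restrict (Ω ×ˢ (univ : Set E3))),
      ‖Function.uncurry f z‖ ≤ B := by
    rw [← hm]
    have hfin : eLpNormEssSup (Function.uncurry f) ((volume.restrict Ω).prod volume) < ∞ := by
      simpa using hbdd.2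
    refine ⟨(eLpNormEssSup (Function.uncurry f) ((volume.restrict Ω).prod volume)).toReal, ?_⟩
    filter_upwards [ae_le_eLpNormEssSup (f := Function.uncurry f)] with z hz
    have := ENNReal.toReal_mono hfin.ne hz
    rwa [toReal_enorm] at this
  refine ⟨B, fun x hx y => ?_⟩
  -- The inequality is encoded as the equality max(‖f‖, B) = B of continuous functions, to which
  -- uniqueness of continuous representatives applies.
  have := Measure.eqOn_open_of_ae_eq (f := fun z => max ‖Function.uncurry f z‖ B)
    (g := fun _ => B) (hB.mono fun z hz => max_eq_right hz) (hΩ.prod isOpen_univ)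
    (hf.cont.norm.sup continuousOn_const) continuousOn_const
  exact max_eq_right_iff.1 (this (show (x, y) ∈ Ω ×ˢ univ from ⟨hx, mem_univ y⟩))

/-- On the k-th sheet the fast variable has the integer height k, so by periodicity F may be
evaluated at height 0; the tangential projection leaves only the first two components. -/
theorem sheetIntegral_dotProduct_tang {S : Set E2} (hS : IsOpen S) (hSb : Bornology.IsBounded S)
    {L d : ℝ} (hd : 0 < d) {g : E3 → C3}
    (hg : ∀ k ∈ layers L d, MemLp (fun x' => g (lift x' (k * d))) 2 (volume.restrict S))
    {F : E3 → E3 → C3} (hF : ∀ i, IsW1Inf (cyl S L) fun x y => F x y i) :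
    (d : ℂ) * sheetIntegral S L d (fun x => g x ⬝ᵥ tang (F x (d⁻¹ • x))) =
      sheetPairing S L d (fun x => g x 0) (Function.uncurry fun x y => F x y 0) +
      sheetPairing S L d (fun x => g x 1) (Function.uncurry fun x y => F x y 1) := by
  have : IsFiniteMeasure (volume.restrict S) := ⟨by simpa using hSb.measure_lt_top⟩
  rw [sheetPairing, sheetPairing, ← mul_add, ← Finset.sum_add_distrib, sheetIntegral]
  congr 1
  refine Finset.sum_congr rfl fun k hk => ?_
  have hint : ∀ i, Integrable (fun x' => g (lift x' (k * d)) i *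
      Function.uncurry (fun x y => F x y i) (lift x' (k * d), lift (d⁻¹ • x') 0))
      (volume.restrict S) := fun i => by
    obtain ⟨B, hB⟩ := (hF i).exists_bound (isOpen_cyl hS L)
    refine ((memLp_component (hg k hk) i).integrable (by norm_num)).mul_bdd (c := B) ?_ ?_
    · refine ContinuousOn.aestronglyMeasurable ?_ hS.measurableSet
      refine (hF i).cont.comp (f := fun x' : E2 => (lift x' (k * d), lift (d⁻¹ • x') 0))
        (by fun_prop) fun x' hx' => ⟨lift_mem_cyl hd hk hx', mem_univ _⟩
    · filter_upwards [ae_restrict_mem hS.measurableSet] with x' hx'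
      exact hB _ (lift_mem_cyl hd hk hx') _
  rw [← integral_add (hint 0) (hint 1)]
  refine setIntegral_congr_fun hS.measurableSet fun x' hx' => ?_
  have hy : d⁻¹ • lift x' (k * d) = lift (d⁻¹ • x') 0 + intVec ![0, 0, k] :=
    E3_ext (by simp) (by simp) (by simp; field_simp)
  have hp : ∀ i, F (lift x' (k * d)) (d⁻¹ • lift x' (k * d)) i =
      F (lift x' (k * d)) (lift (d⁻¹ • x') 0) i := fun i => by
    rw [hy]
    exact periodic_intVec (q := fun y => F (lift x' (k * d)) y i)
      ((hF i).periodic _ (lift_mem_cyl hd hk hx')) _ _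
  simp only [Matrix.vec3_dotProduct, tang, Matrix.cons_val, hp, Function.uncurry_apply_pair,
    mul_zero, add_zero]

/-- The sequence of the `j`-th tangential components of the traces on the sheets. -/
theorem exists_sheetSequence {S : Set E2} (hSb : Bornology.IsBounded S) {L M : ℝ} (hM : 0 < M)
    {ν : E3 → E3} {d : ℕ → ℝ} (hd : ∀ l, 0 < d l) (hlim : Tendsto d atTop (𝓝 0))
    {E : ℕ → FieldData} (hX : ∀ l, MemX S L ν (d l) (E l))
    (hfld : ∀ l, ∫ x in cyl S L, nsq ((E l).fld x) ≤ M)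
    (hrot : ∀ l, ∫ x in cyl S L, nsq ((E l).rot x) ≤ M)
    (hsheet : ∀ l, sheetEnergy S L (d l) (E l).sheet ≤ M) {u₀ : E3 → E3 → C3}
    (hts : TwoScale (cyl S L) d (fun l => (E l).fld) u₀) (j : Fin 2) :
    ∃ v uj u2, SheetSequence S L M d j.castSucc v uj u2 (fun l x => (E l).sheet x j.castSucc)
      (fun z => u₀ z.1 z.2 j.castSucc) (fun z => u₀ z.1 z.2 2) := by
  have hvol := volume_cyl_lt_top hSb L
  obtain ⟨v, hv, hvM, htr⟩ : ∃ v : ℕ → E3 → ℂ,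
      (∀ l, MemLp (v l) 2 (volume.restrict (cyl S L))) ∧
      (∀ l, ∫ x in cyl S L, ‖v l x‖ ^ 2 ≤ M) ∧
      ∀ l, ∀ k ∈ layers L (d l), IsScalarTrace S L (k * d l) j.castSucc (v l)
        (fun x => (E l).fld x j.castSucc) (fun x => (E l).fld x 2)
        fun x' => (E l).sheet (lift x' (k * d l)) j.castSucc := by
    have hc : ∀ l i, MemLp (fun x => (E l).rot x i) 2 (volume.restrict (cyl S L)) := fun l i =>
      memLp_component (hX l).memLp_rot i
    have hb : ∀ l i, ∫ x in cyl S L, ‖(E l).rot x i‖ ^ 2 ≤ M := fun l i =>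
      (integral_mono (integrable_norm_sq (hc l i)) (integrable_nsq (hX l).memLp_rot)
        fun x => norm_sq_le_nsq _ i).trans (hrot l)
    -- Green's formula couples the j-th tangential trace to the other horizontal component of the
    -- curl: minus component 1 for j = 0, component 0 for j = 1.
    fin_cases j
    · exact ⟨fun l x => -(E l).rot x 1, fun l => (hc l 1).neg, fun l => by simpa using hb l 1,
        fun l k hk => ((hX l).sheetTrace k hk).scalar_zero⟩
    · exact ⟨fun l x => (E l).rot x 0, fun l => hc l 0, fun l => hb l 0,
        fun l k hk => ((hX l).sheetTrace k hk).scalar_one⟩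
  refine ⟨v, fun l x => (E l).fld x j.castSucc, fun l x => (E l).fld x 2, ⟨hSb, hM, hd, ?_,
    scalarTwoScale_component hvol hts hfld _, scalarTwoScale_component hvol hts hfld _, hv, hvM, htr,
    fun l k hk => memLp_component ((hX l).sheetTrace k hk).memLp _, fun l => ?_⟩⟩
  · exact tendsto_nhdsWithin_iff.2 ⟨hlim, Eventually.of_forall hd⟩
  · refine le_trans ?_ (hsheet l)
    refine mul_le_mul_of_nonneg_left (Finset.sum_le_sum fun k hk => ?_) (hd l).le
    exact integral_mono (integrable_norm_sq (memLp_component ((hX l).sheetTrace k hk).memLp _))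
      (integrable_nsq ((hX l).sheetTrace k hk).memLp) fun x => norm_sq_le_nsq _ _

/-- The limit of the surface integrals as an integral over `Ω × Σ₀`. -/
theorem integral_trace_eq {Ω : Set E3} (hΩ : IsOpen Ω) (hvol : volume Ω < ∞) {E₀ : E3 → C3}
    {G : Fin 2 → E3 × E2 → ℂ} (hG : ∀ j, MemLp (G j) 2 (surfMeasure Ω)) {F : E3 → E3 → C3}
    (hF : ∀ i, IsW1Inf Ω fun x y => F x y i) :
    ∫ x in Ω, ∫ y' in cellY2, (tang (E₀ x) +
        ![perExt (G 0) (x, y') - E₀ x 0, perExt (G 1) (x, y') - E₀ x 1, 0]) ⬝ᵥ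
          tang (F x (lift y' 0)) =
      (∫ z, G 0 z * F z.1 (lift z.2 0) 0 ∂(surfMeasure Ω)) +
        ∫ z, G 1 z * F z.1 (lift z.2 0) 1 ∂(surfMeasure Ω) := by
  have := isFiniteMeasure_surfMeasure hvol
  have hint : ∀ j i, Integrable (fun z => perExt (G j) z * F z.1 (lift z.2 0) i)
      (surfMeasure Ω) := fun j i => by
    obtain ⟨B, hB⟩ := (hF i).exists_bound hΩ
    refine (((hG j).ae_eq (perExt_ae_eq (G j)).symm).integrable (by norm_num)).mul_bdd (c := B)
      (memLp_surf_of_continuousOn hΩ hvol (hF i).cont hB).1 ?_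
    filter_upwards [ae_surfMeasure_mem hΩ] with z hz using hB _ hz _
  have hcongr : ∀ j i, ∫ z, G j z * F z.1 (lift z.2 0) i ∂(surfMeasure Ω) =
      ∫ z, perExt (G j) z * F z.1 (lift z.2 0) i ∂(surfMeasure Ω) := fun j i => by
    refine integral_congr_ae ?_
    filter_upwards [perExt_ae_eq (Ω := Ω) (G j)] with z hz
    rw [hz]
  have hsum : Integrable (fun z : E3 × E2 => perExt (G 0) z * F z.1 (lift z.2 0) 0 +
      perExt (G 1) z * F z.1 (lift z.2 0) 1) (surfMeasure Ω) := (hint 0 0).add (hint 1 1)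
  rw [hcongr, hcongr, ← integral_add (hint 0 0) (hint 1 1)]
  rw [surfMeasure] at hsum ⊢
  rw [integral_prod _ hsum]
  congr 1
  funext x
  congr 1
  funext y'
  -- The subtraction of 𝓔 in the cell trace cancels the tangential part of 𝓔, leaving the periodic
  -- extension of G.
  simp only [Matrix.vec3_dotProduct, tang, Matrix.cons_val, Pi.add_apply, mul_zero, add_zero]
  ring

end LayeredMaxwell

end

/-! ### The proposition. -/

open LayeredMaxwell in
theorem proposition4p3
    -- the cylinder `Ω = S × (-L, L)` and its outer unit normal
    (S : Set E2) (hSo : IsOpen S) (hSb : Bornology.IsBounded S) (L : ℝ) (hL : 0 < L)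
    (ν : E3 → E3) (hν : IsOuterUnitNormal (cyl S L) ν)
    -- the material and the source
    (ω μ lam : ℝ) (hω : 0 < ω) (hμ : 0 < μ) (hlam : 0 < lam)
    (ε σ : E3 → E3 → ℂ) (c C : ℝ) (hmat : IsMaterial (cyl S L) ε σ c C)
    (J : E3 → C3) (hJ : MemLp J 2 (volume.restrict (cyl S L)))
    -- the solutions along the sequence `d l → 0`
    (d : ℕ → ℝ) (hd : ∀ l, 0 < d l) (hlim : Tendsto d atTop (𝓝 0))
    (E : ℕ → FieldData) (hE : ∀ l, IsSolution S L ν ω μ lam ε σ J (d l) (E l))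
    -- their two-scale limit `𝓔(x) + ∇_y φ(x, y)`, with `p = ∇_y φ`
    (E₀ : E3 → C3) (hE₀ : MemLp E₀ 2 (volume.restrict (cyl S L)))
    (φ : E3 → E3 → ℂ) (p : E3 → E3 → C3) (hφ : IsCorrector (cyl S L) φ p)
    (hts : TwoScale (cyl S L) d (fun l => (E l).fld) (fun x y => E₀ x + p x y)) :
    -- the tangential trace `G` of `∇_y φ` on `Ω × Σ₀` exists in `L²`
    ∃ G : E3 → E2 → C3, IsCellTrace (cyl S L) p G ∧
      ∀ F : E3 → E3 → C3, (∀ i, IsW1Inf (cyl S L) (fun x y => F x y i)) →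
        Tendsto
          (fun l => (d l : ℂ) * sheetIntegral S L (d l)
            (fun x => (E l).sheet x ⬝ᵥ tang (F x ((d l)⁻¹ • x))))
          atTop
          (𝓝 (∫ x in cyl S L, ∫ y' in cellY2,
            (tang (E₀ x) + G x y') ⬝ᵥ tang (F x (lift y' 0)))) := by
  have hΩ := isOpen_cyl hSo L
  have hvol := volume_cyl_lt_top hSb L
  obtain ⟨M, hM, hen⟩ := energy_estimate hSo hω hμ hlam hmat hJ (ν := ν)
  have hen := fun l => hen (d l) (hd l) (E l) (hE l)
  have hseq := exists_sheetSequence hSb hM hd hlim (fun l => (hE l).1) (fun l => (hen l).1)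
    (fun l => (hen l).2.1) (fun l => (hen l).2.2) hts
  choose v uj u2 hs using hseq
  choose G _ hG hGlim using fun j => (hs j).exists_limit
  -- G represents the limit of the traces of the whole field, that is the trace of 𝓔 + ∇_yφ, so the
  -- trace of ∇_yφ is its periodic extension minus 𝓔.
  refine ⟨_, isCellTrace_of_components hΩ hvol hφ (e := fun j x => E₀ x j.castSucc)
    (fun j => memLp_component hE₀ _) hG fun j a ha => ?_, fun F hF => ?_⟩
  · exact SheetSequence.cell_green hSo (hs j) (hG j) (hGlim j) (memLp_component hE₀ _)
      (memLp_component hE₀ 2) hφ (Fin.castSucc_lt_last j).ne ha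
  · have hpair : ∀ j : Fin 2, _ := fun j =>
      ((hF j.castSucc).exists_bound hΩ).elim fun B hB =>
        (hs j).tendsto_pairing hSo (hG j) (hGlim j) (hF j.castSucc).periodic (hF j.castSucc).cont hB
    refine (((hpair 0).add (hpair 1)).congr fun l => ?_).trans_eq
      (congrArg 𝓝 (integral_trace_eq hΩ hvol hG hF).symm)
    exact (sheetIntegral_dotProduct_tang hSo hSb (hd l)
      (fun k hk => ((hE l).1.sheetTrace k hk).memLp) hF).symm
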